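/- **Setting.** Let $R\subseteq\mathbb R^D$ be open. For each component $j$ in a finite set of components let $\mathbb M_j$ be a finite set of modes, and let $\phi_{j,n}$, $n\in\mathbb M_j$, be complex mode functions that are orthonormal in $L^2(R)$, $C^2$ in $R$, continuous on $\overline R$, zero on $\partial R$, and tend to $0$ at infinity in $R$ (if $R$ is unbounded), such that every $\phi_{j,n}^*\nabla^2\phi_{j,m}$ is integrable on $R$. Write $\int d\boldsymbol x$ for integration over $R$. Let $\hat a_{j,n}$ be the bosonic annihilation operators on the Fock space of all these modes, with number states $|\mu\rangle$, and let $\tilde\Psi_j(\boldsymbol x)=\sum_n\phi_{j,n}(\boldsymbol x)\hat a_{j,n}$ and $\nabla^2\tilde\Psi_j=\sum_n(\nabla^2\phi_{j,n})\hat a_{j,n}$. Fields $\Psi_j=\sum_n\phi_{j,n}\alpha_{j,n}$ and $\Lambda_j=\sum_n\phi_{j,n}\lambda_{j,n}$ are identified with their amplitude vectors $\alpha,\lambda$. For a functional $F$ of the field put $$\frac{\delta F}{\delta\Psi_j(\boldsymbol x)}=\sum_n\phi_{j,n}^*(\boldsymbol x)\frac{\partial F}{\partial\alpha_{j,n}},\qquad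 \frac{\delta F}{\delta\Psi_j^*(\boldsymbol x)}=\sum_n\phi_{j,n}(\boldsymbol x)\frac{\partial F}{\partial\alpha_{j,n}^*}$$ with Wirtinger derivatives. The Wigner transform of an operator $\hat C$ is $$\mathcal W[\hat C]=\frac1{\pi^{2\sum_j|\mathbb M_j|}}\int d^2\lambda\;\prod_j e^{\int d\boldsymbol x(-\Lambda_j\Psi_j^*+\Lambda_j^*\Psi_j)}\;\chi_{\hat C}(\lambda),\qquad \chi_{\hat C}(\lambda)=\mathrm{Tr}\Big\{\hat C\prod_j e^{\int d\boldsymbol x(\Lambda_j\tilde\Psi_j^\dagger-\Lambda_j^*\tilde\Psi_j)}\Big\},$$ whenever the trace (as the sum of the diagonal elements in the number basis) and the integral converge absolutely, in particular when $\hat C$ has only finitely many non-zero matrix elements in the number basis. For a Hilbert–Schmidt operator, $\mathcal W[\hat C]\in L^2$ is the $L^2$ limit of the transforms of the finite truncations of the matrix $\langle\mu|\hat C|\nu\rangle$, along the directed set of finite sets of entries. For an arbitrary matrix it is the limit of the same transforms in the sense of distributions (tested against smooth compactly supported functions of the amplitudes), if this exists. **Theorem.** For every component $j$ and every Hilbert–Schmidt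 operator $\hat A$, with the commutator understood through its matrix elements in the number basis, $$\mathcal W\left[\int d\boldsymbol x\,[\tilde\Psi_j^\dagger\nabla^2\tilde\Psi_j,\hat A]\right]=\int d\boldsymbol x\left(-\frac{\delta}{\delta\Psi_j}\nabla^2\Psi_j+\frac{\delta}{\delta\Psi_j^*}\nabla^2\Psi_j^*\right)\mathcal W[\hat A].$$ Precisely: 1. $\mathcal W[\hat A]$ exists as an element of $L^2$. 2. The transform on the left exists as a distribution, and the identity holds in the sense of distributions: the left side, paired with any smooth compactly supported $g$, equals $$\int d^2\alpha\;\mathcal W[\hat A]\int d\boldsymbol x\left(\nabla^2\Psi_j\,\frac{\delta g}{\delta\Psi_j}-\nabla^2\Psi_j^*\,\frac{\delta g}{\delta\Psi_j^*}\right).$$ 3. If moreover the commutator $\int d\boldsymbol x\,[\tilde\Psi_j^\dagger\nabla^2\tilde\Psi_j,\hat A]$ is Hilbert–Schmidt, the traces and integrals that define the transforms of $\hat A$ and of this commutator converge absolutely, and $\mathcal W[\hat A]$ is continuously differentiable, then the identity holds pointwise, at every field $\Psi$. -/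

import Mathlib

open MeasureTheory Filter Topology
open scoped ComplexConjugate Laplacian ENNReal

noncomputable section

namespace FieldWigner

/-! ### Modes, amplitudes, Fock space

`J` is the type of components and `M j` the finite type of (retained) modes of component `j`.
A field is determined by its mode amplitudes, a vector in `Amp M`. -/

/-- All modes of all components. -/
abbrev Modes {J : Type*} (M : J → Type*) := Σ j, M j

/-- Occupation numbers. -/
abbrev Occ {J : Type*} (M : J → Type*) := Modes M → ℕ

/-- Vectors of complex mode amplitudes. -/
abbrev Amp {J : Type*} (M : J → Type*) := Modes M → ℂ

/-- The bosonic Fock space, in the number basis. -/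
abbrev Fock {J : Type*} (M : J → Type*) := lp (fun _ : Occ M => ℂ) 2

/-- Arbitrary coefficient sequences in the number basis. They contain the Fock space, and all
ladder operators act on them, so that no operator domains need to be tracked. -/
abbrev NumSeq {J : Type*} (M : J → Type*) := Occ M → ℂ

/-- Infinite matrices in the number basis: `c μ ν = ⟨μ| C |ν⟩`. -/
abbrev Kernel {J : Type*} (M : J → Type*) := Occ M → Occ M → ℂ

open Classical in
/-- The number state `|ν⟩`, as a coefficient sequence. -/
def numState {J : Type*} {M : J → Type*} (ν : Occ M) : NumSeq M := Pi.single ν 1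

open Classical in
/-- The number state `|ν⟩`, as a vector of the Fock space. -/
def fockState {J : Type*} {M : J → Type*} (ν : Occ M) : Fock M := lp.single 2 ν (1 : ℂ)

/-- Hilbert-Schmidt operators on the Fock space: `∑_ν ‖A |ν⟩‖² < ∞`. -/
def IsHilbertSchmidt {J : Type*} {M : J → Type*} (A : Fock M →L[ℂ] Fock M) : Prop :=
  Summable fun ν : Occ M => ‖A (fockState ν)‖ ^ 2

/-- The matrix elements `⟨μ| A |ν⟩` of an operator on the Fock space. -/
def matrixElement {J : Type*} {M : J → Type*} (A : Fock M →L[ℂ] Fock M) : Kernel M :=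
  fun μ ν => (A (fockState ν) : Occ M → ℂ) μ

/-- A matrix with square-summable entries, that is, the matrix of a Hilbert-Schmidt operator. -/
def IsHilbertSchmidtKernel {J : Type*} {M : J → Type*} (c : Kernel M) : Prop :=
  Summable fun p : Occ M × Occ M => ‖c p.1 p.2‖ ^ 2

open Classical in
/-- The annihilation operator `a_i`. -/
def annihilate {J : Type*} {M : J → Type*} (i : Modes M) (v : NumSeq M) : NumSeq M :=
  fun μ => (Real.sqrt (μ i + 1) : ℂ) * v (μ + Pi.single i 1)

open Classical in
/-- The creation operator `a_i†`. (The factor is `0` where the truncated subtraction is junk.) -/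
def create {J : Type*} {M : J → Type*} (i : Modes M) (v : NumSeq M) : NumSeq M :=
  fun μ => (Real.sqrt (μ i) : ℂ) * v (μ - Pi.single i 1)

/-! ### Restricted fields and field operators -/

/-- The restricted field `Ψ_j = ∑_n φ_{j,n} α_{j,n}` with amplitudes `α`. -/
def compose {d : ℕ} {J : Type*} {M : J → Type*} [∀ j, Fintype (M j)]
    (φ : ∀ j, M j → EuclideanSpace ℝ (Fin d) → ℂ) (j : J) (α : Amp M) :
    EuclideanSpace ℝ (Fin d) → ℂ :=
  fun x => ∑ n : M j, φ j n x * α ⟨j, n⟩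

/-- The restricted field operator `Ψ̃_j(x) = ∑_n φ_{j,n}(x) a_{j,n}`. -/
def fieldOp {d : ℕ} {J : Type*} {M : J → Type*} [∀ j, Fintype (M j)]
    (φ : ∀ j, M j → EuclideanSpace ℝ (Fin d) → ℂ) (j : J) (x : EuclideanSpace ℝ (Fin d))
    (v : NumSeq M) : NumSeq M :=
  ∑ n : M j, φ j n x • annihilate ⟨j, n⟩ v

/-- The adjoint restricted field operator `Ψ̃_j†(x) = ∑_n φ_{j,n}(x)^* a_{j,n}†`. -/
def fieldOpDagger {d : ℕ} {J : Type*} {M : J → Type*} [∀ j, Fintype (M j)]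
    (φ : ∀ j, M j → EuclideanSpace ℝ (Fin d) → ℂ) (j : J) (x : EuclideanSpace ℝ (Fin d))
    (v : NumSeq M) : NumSeq M :=
  ∑ n : M j, conj (φ j n x) • create ⟨j, n⟩ v

/-- The operator `∇²Ψ̃_j(x) = ∑_n (∇²φ_{j,n})(x) a_{j,n}`. -/
def laplacianFieldOp {d : ℕ} {J : Type*} {M : J → Type*} [∀ j, Fintype (M j)]
    (φ : ∀ j, M j → EuclideanSpace ℝ (Fin d) → ℂ) (j : J) (x : EuclideanSpace ℝ (Fin d))
    (v : NumSeq M) : NumSeq M :=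
  ∑ n : M j, (Δ (φ j n)) x • annihilate ⟨j, n⟩ v

/-- The kinetic density `Ψ̃_j†(x) ∇²Ψ̃_j(x)`. -/
def kineticDensity {d : ℕ} {J : Type*} {M : J → Type*} [∀ j, Fintype (M j)]
    (φ : ∀ j, M j → EuclideanSpace ℝ (Fin d) → ℂ) (j : J) (x : EuclideanSpace ℝ (Fin d))
    (v : NumSeq M) : NumSeq M :=
  fieldOpDagger φ j x (laplacianFieldOp φ j x v)

/-- The matrix `⟨μ| T C - C T |ν⟩` of the commutator of `T` with the operator whose matrix is `c`.
It is used for polynomials `T` in the ladder operators: then all the sums are finite. -/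
def commutatorKernel {J : Type*} {M : J → Type*} (T : NumSeq M → NumSeq M) (c : Kernel M) :
    Kernel M :=
  fun μ ν => T (fun κ => c κ ν) μ - ∑' κ, c μ κ * T (numState ν) κ

/-- The matrix of `∫_R dx [Ψ̃_j†(x) ∇²Ψ̃_j(x), C]`. -/
def kineticCommutator {d : ℕ} {J : Type*} {M : J → Type*} [∀ j, Fintype (M j)]
    (R : Set (EuclideanSpace ℝ (Fin d))) (φ : ∀ j, M j → EuclideanSpace ℝ (Fin d) → ℂ) (j : J)
    (c : Kernel M) : Kernel M :=
  fun μ ν => ∫ x in R, commutatorKernel (kineticDensity φ j x) c μ ν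

/-! ### The functional Wigner transformation -/

/-- `∫_R dx ∑_j (Λ_j Ψ̃_j† - Λ_j^* Ψ̃_j)`, where `Λ` has the amplitudes `lam`. -/
def displacementGenerator {d : ℕ} {J : Type*} {M : J → Type*} [Fintype J] [∀ j, Fintype (M j)]
    (R : Set (EuclideanSpace ℝ (Fin d))) (φ : ∀ j, M j → EuclideanSpace ℝ (Fin d) → ℂ)
    (lam : Amp M) (v : NumSeq M) : NumSeq M :=
  fun μ => ∫ x in R, ∑ j : J,
    (compose φ j lam x * fieldOpDagger φ j x v μ - conj (compose φ j lam x) * fieldOp φ j x v μ)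

/-- The matrix of the displacement operator `∏_j exp ∫_R dx (Λ_j Ψ̃_j† - Λ_j^* Ψ̃_j)`, through the
exponential series on number states. Since the exponents for different components commute, the
product is the exponential of their sum. -/
def displacementOp {d : ℕ} {J : Type*} {M : J → Type*} [Fintype J] [∀ j, Fintype (M j)]
    (R : Set (EuclideanSpace ℝ (Fin d))) (φ : ∀ j, M j → EuclideanSpace ℝ (Fin d) → ℂ)
    (lam : Amp M) : Kernel M :=
  fun μ ν => ∑' k : ℕ,
    ((Nat.factorial k : ℂ))⁻¹ * ((displacementGenerator R φ lam)^[k] (numState ν)) μ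

/-- The diagonal element `⟨μ| C D̂[Λ,Λ^*] |μ⟩`. -/
def charDiag {d : ℕ} {J : Type*} {M : J → Type*} [Fintype J] [∀ j, Fintype (M j)]
    (R : Set (EuclideanSpace ℝ (Fin d))) (φ : ∀ j, M j → EuclideanSpace ℝ (Fin d) → ℂ)
    (c : Kernel M) (lam : Amp M) (μ : Occ M) : ℂ :=
  ∑' ν, c μ ν * displacementOp R φ lam ν μ

/-- The characteristic functional `Tr {C D̂[Λ,Λ^*]}`. -/
def charFunctional {d : ℕ} {J : Type*} {M : J → Type*} [Fintype J] [∀ j, Fintype (M j)]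
    (R : Set (EuclideanSpace ℝ (Fin d))) (φ : ∀ j, M j → EuclideanSpace ℝ (Fin d) → ℂ)
    (c : Kernel M) (lam : Amp M) : ℂ :=
  ∑' μ, charDiag R φ c lam μ

/-- The displacement functional `∏_j exp ∫_R dx (-Λ_j Ψ_j^* + Λ_j^* Ψ_j)`. -/
def displacementFunctional {d : ℕ} {J : Type*} {M : J → Type*} [Fintype J]
    [∀ j, Fintype (M j)]
    (R : Set (EuclideanSpace ℝ (Fin d))) (φ : ∀ j, M j → EuclideanSpace ℝ (Fin d) → ℂ)
    (lam α : Amp M) : ℂ :=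
  ∏ j : J, Complex.exp (∫ x in R,
    (-(compose φ j lam x) * conj (compose φ j α x) + conj (compose φ j lam x) * compose φ j α x))

/-- The Wigner transform, by its defining integral
`π^{-2∑|M_j|} ∫ δ²Λ D[Λ,Λ^*,Ψ,Ψ^*] Tr {C D̂[Λ,Λ^*]}`, at the field with amplitudes `α`. -/
def wigner {d : ℕ} {J : Type*} {M : J → Type*} [Fintype J] [∀ j, Fintype (M j)]
    (R : Set (EuclideanSpace ℝ (Fin d))) (φ : ∀ j, M j → EuclideanSpace ℝ (Fin d) → ℂ)
    (c : Kernel M) (α : Amp M) : ℂ :=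
  ((Real.pi : ℂ) ^ (2 * Fintype.card (Modes M)))⁻¹ *
    ∫ lam : Amp M, displacementFunctional R φ lam α * charFunctional R φ c lam

/-- The trace and the integral that define the Wigner transform converge absolutely. -/
def HasWignerIntegral {d : ℕ} {J : Type*} {M : J → Type*} [Fintype J] [∀ j, Fintype (M j)]
    (R : Set (EuclideanSpace ℝ (Fin d))) (φ : ∀ j, M j → EuclideanSpace ℝ (Fin d) → ℂ)
    (c : Kernel M) : Prop :=
  (∀ lam : Amp M, Summable fun μ => charDiag R φ c lam μ) ∧
    Integrable (fun lam : Amp M => charFunctional R φ c lam)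

open Classical in
/-- The finite matrix with the entries of `c` in `s`, and `0` elsewhere. -/
def truncate {J : Type*} {M : J → Type*} (c : Kernel M) (s : Finset (Occ M × Occ M)) : Kernel M :=
  fun μ ν => if (μ, ν) ∈ s then c μ ν else 0

/-- `w` is the Wigner transform of the Hilbert-Schmidt operator with matrix `c`, in the sense of
Fourier-Plancherel: the limit in the mean of the Wigner integrals of the finite truncations. -/
def IsWignerL2 {d : ℕ} {J : Type*} {M : J → Type*} [Fintype J] [∀ j, Fintype (M j)]
    (R : Set (EuclideanSpace ℝ (Fin d))) (φ : ∀ j, M j → EuclideanSpace ℝ (Fin d) → ℂ)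
    (c : Kernel M) (w : Amp M → ℂ) : Prop :=
  MemLp w 2 volume ∧
    Tendsto (fun s : Finset (Occ M × Occ M) =>
      eLpNorm (fun α => wigner R φ (truncate c s) α - w α) 2 volume) atTop (𝓝 0)

/-- The Wigner transform of the matrix `c` exists as a distribution, and is `T`: the Wigner
integrals of the finite truncations converge to `T` when paired with any test function. -/
def IsWignerDistribution {d : ℕ} {J : Type*} {M : J → Type*} [Fintype J] [∀ j, Fintype (M j)]
    (R : Set (EuclideanSpace ℝ (Fin d))) (φ : ∀ j, M j → EuclideanSpace ℝ (Fin d) → ℂ)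
    (c : Kernel M) (T : (Amp M → ℂ) → ℂ) : Prop :=
  ∀ g : Amp M → ℂ, ContDiff ℝ (⊤ : ℕ∞) g → HasCompactSupport g →
    Tendsto (fun s : Finset (Occ M × Occ M) => ∫ α, wigner R φ (truncate c s) α * g α)
      atTop (𝓝 (T g))

/-! ### Functional derivatives -/

open Classical in
/-- The Wirtinger derivative `∂/∂α_i = (∂/∂x_i - i ∂/∂y_i)/2`. -/
def wirtinger {J : Type*} {M : J → Type*} [Fintype J] [∀ j, Fintype (M j)]
    (i : Modes M) (F : Amp M → ℂ) (α : Amp M) : ℂ :=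
  (1 / 2) * (lineDeriv ℝ F α (Pi.single i 1) - Complex.I * lineDeriv ℝ F α (Pi.single i Complex.I))

open Classical in
/-- The Wirtinger derivative `∂/∂α_i^* = (∂/∂x_i + i ∂/∂y_i)/2`. -/
def wirtingerConj {J : Type*} {M : J → Type*} [Fintype J] [∀ j, Fintype (M j)]
    (i : Modes M) (F : Amp M → ℂ) (α : Amp M) : ℂ :=
  (1 / 2) * (lineDeriv ℝ F α (Pi.single i 1) + Complex.I * lineDeriv ℝ F α (Pi.single i Complex.I))

/-- The functional derivative `δF/δΨ_j(x) = ∑_n φ_{j,n}(x)^* ∂F/∂α_{j,n}`. -/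
def funcDeriv {d : ℕ} {J : Type*} {M : J → Type*} [Fintype J] [∀ j, Fintype (M j)]
    (φ : ∀ j, M j → EuclideanSpace ℝ (Fin d) → ℂ) (j : J) (x : EuclideanSpace ℝ (Fin d))
    (F : Amp M → ℂ) (α : Amp M) : ℂ :=
  ∑ n : M j, conj (φ j n x) * wirtinger ⟨j, n⟩ F α

/-- The functional derivative `δF/δΨ_j^*(x) = ∑_n φ_{j,n}(x) ∂F/∂α_{j,n}^*`. -/
def funcDerivConj {d : ℕ} {J : Type*} {M : J → Type*} [Fintype J] [∀ j, Fintype (M j)]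
    (φ : ∀ j, M j → EuclideanSpace ℝ (Fin d) → ℂ) (j : J) (x : EuclideanSpace ℝ (Fin d))
    (F : Amp M → ℂ) (α : Amp M) : ℂ :=
  ∑ n : M j, φ j n x * wirtingerConj ⟨j, n⟩ F α

/-- `∫_R dx (-δ/δΨ_j ∇²Ψ_j + δ/δΨ_j^* ∇²Ψ_j^*) F`, where each derivative acts on the product of all
that stands to its right. -/
def kineticOp {d : ℕ} {J : Type*} {M : J → Type*} [Fintype J] [∀ j, Fintype (M j)]
    (R : Set (EuclideanSpace ℝ (Fin d))) (φ : ∀ j, M j → EuclideanSpace ℝ (Fin d) → ℂ) (j : J)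
    (F : Amp M → ℂ) (α : Amp M) : ℂ :=
  ∫ x in R,
    (-(funcDeriv φ j x (fun β => (Δ (compose φ j β)) x * F β) α) +
      funcDerivConj φ j x (fun β => (Δ (fun y => conj (compose φ j β y))) x * F β) α)

/-- The formal transpose of `kineticOp`, which acts on test functions:
`∫_R dx (∇²Ψ_j δg/δΨ_j - ∇²Ψ_j^* δg/δΨ_j^*)`. -/
def kineticOpTranspose {d : ℕ} {J : Type*} {M : J → Type*} [Fintype J] [∀ j, Fintype (M j)]
    (R : Set (EuclideanSpace ℝ (Fin d))) (φ : ∀ j, M j → EuclideanSpace ℝ (Fin d) → ℂ) (j : J)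
    (g : Amp M → ℂ) (α : Amp M) : ℂ :=
  ∫ x in R,
    ((Δ (compose φ j α)) x * funcDeriv φ j x g α -
      (Δ (fun y => conj (compose φ j α y))) x * funcDerivConj φ j x g α)

end FieldWigner

end

/-!
The identity is a statement about matrix units: the Wigner function of `|μ⟩⟨ν|` is explicit, and
multiplying `|μ⟩⟨ν|` by a ladder operator from either side acts on that function as multiplication
by an amplitude plus or minus half a Wirtinger derivative. In the commutator with `a_n† a_m` the
terms of order zero and two cancel, which leaves a first-order differential operator; the
coefficients `K n m = ∫ φ_n^* ∇²φ_m` are supplied by the integration over `R`. What remains is to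
make sense of the infinite sums, and to see that the part with `∇²Ψ^*` has the same coefficients.

*Explicit transforms.* The matrix elements of the displacement operator are products of complex
Hermite functions: along a ray these are entire and solve the differential equation of the
exponential, so their Taylor series is the exponential series
(`IsOrthonormalModes.displacementOp_eq`). They are orthogonal and, up to a rescaling,
eigenfunctions of the symplectic Fourier transform (`modeInner_eq`, `modeFourier_eq`). Hence the
Wigner functions of the matrix units are an orthogonal family of constant norm, and
square-summable matrices have transforms in `L²` (`IsOrthonormalModes.exists_isWignerL2`).

*Distributions.* Against a test function `g`, a matrix `c` is the sum of `c μ ν` times the pairing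
of `g` with the Wigner function of `|μ⟩⟨ν|`. Ladder operators move from `c` to the pairing by a
shift of the summation index (`hasSum_create_annihilate_mul`) and from there to `g` by the ladder
relations and an integration by parts. So the sum for the commutator is the sum for `c` with
another test function (`hasSum_kineticCommutator_mul`), and convergence is inherited from `c`; no
domains of operators enter.

*Green's identity.* The matrix `K` is hermitian (`integral_conj_mul_laplacian_symm`), although
neither the boundary of `R` nor `∇φ_n` at the boundary need be regular. For one function `u` the flux
`u^* ∇u` is multiplied by a cut-off in `|u|²`, which makes its support compact; the energy bound
then shows that `|∇u|²` is integrable where `u ≠ 0`, and the contribution of the cut-off vanishes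
by dominated convergence (`im_integral_conj_mul_laplacian`). Polarisation gives the rest.

*Pointwise.* If the defining trace and integral converge absolutely, the characteristic functional
agrees almost everywhere with the `L²` sum of its expansion. The Fourier transforms of test
functions lie in `L²`, so the integral transform agrees with the limit of the truncations in the
sense of distributions (`IsOrthonormalModes.hasSum_of_hasWignerIntegral`). Applied to the matrix
and to its commutator, this shows that the two sides of the identity are continuous functions that
agree as distributions.
-/

noncomputable section

namespace FieldWigner

/-! ### Integration by parts -/

lemma integral_lineDeriv_eq_zero {E : Type*} [NormedAddCommGroup E] [NormedSpace ℝ E]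
    [FiniteDimensional ℝ E] [MeasureSpace E] [BorelSpace E]
    [(volume : Measure E).IsAddHaarMeasure] {f f' : E → ℂ} {v : E} (hf : Integrable f)
    (hf' : Integrable f') (h : ∀ x, HasLineDerivAt ℝ f (f' x) x v) : ∫ x, f' x = 0 := by
  have := integral_bilinear_hasLineDerivAt_right_eq_neg_left_of_integrable
    (μ := (volume : Measure E)) (f := fun _ : E => (1 : ℂ)) (f' := fun _ => 0) (g := f) (g' := f')
    (v := v) (B := ContinuousLinearMap.mul ℝ ℂ) (by simp) (by simpa using hf')
    (by simpa using hf) (fun x _ => (hasFDerivAt_const (1 : ℂ) x).hasLineDerivAt v)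
    (fun x _ => h x)
  simpa using this

lemma integral_fderiv_eq_zero_of_compactSupport {E : Type*} [NormedAddCommGroup E]
    [NormedSpace ℝ E] [FiniteDimensional ℝ E] [MeasureSpace E] [BorelSpace E]
    [(volume : Measure E).IsAddHaarMeasure] {V : E → ℂ} (hV : ContDiff ℝ 1 V)
    (hc : HasCompactSupport V) (v : E) : ∫ x, fderiv ℝ V x v = 0 :=
  integral_lineDeriv_eq_zero (hV.continuous.integrable_of_hasCompactSupport hc)
    (((hV.continuous_fderiv one_ne_zero).clm_apply
      continuous_const).integrable_of_hasCompactSupport (hc.fderiv_apply ℝ v))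
    fun x => (hV.differentiable one_ne_zero x).hasFDerivAt.hasLineDerivAt v

/-! ### Symmetry of the Laplacian on functions that vanish at the boundary -/

section Green

variable {E : Type*} [NormedAddCommGroup E] [InnerProductSpace ℝ E] [FiniteDimensional ℝ E]

lemma laplacian_eq_sum_fderiv {u : E → ℂ} {x : E} (hu : ContDiffAt ℝ 2 u x) :
    (Δ u) x = ∑ i, fderiv ℝ (fun y => fderiv ℝ u y (stdOrthonormalBasis ℝ E i)) x
      (stdOrthonormalBasis ℝ E i) := by
  rw [InnerProductSpace.laplacian_eq_iteratedFDeriv_stdOrthonormalBasis]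
  refine Finset.sum_congr rfl fun i _ => ?_
  have hd : DifferentiableAt ℝ (fderiv ℝ u) x :=
    (hu.fderiv_right (m := 1) (by norm_num)).differentiableAt one_ne_zero
  rw [iteratedFDeriv_two_apply, fderiv_clm_apply hd (differentiableAt_const _)]
  simp

variable [MeasurableSpace E] [BorelSpace E]

lemma integrableOn_of_eq_zero_off_compact {F : Type*} [NormedAddCommGroup F] {R K : Set E}
    (hR : IsOpen R) (hK : IsCompact K) (hKR : K ⊆ R) {f : E → F} (hf : ContinuousOn f R)
    (h0 : ∀ x ∈ R, x ∉ K → f x = 0) : IntegrableOn f R :=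
  ((hf.mono hKR).integrableOn_compact hK).of_forall_sdiff_eq_zero hR.measurableSet
    fun x hx => h0 x hx.1 hx.2

/-- The divergence theorem for a field that is `C¹` in an open set and vanishes off a compact
part of it. -/
lemma setIntegral_fderiv_eq_zero {R K : Set E} (hR : IsOpen R) (hK : IsCompact K) (hKR : K ⊆ R)
    {V : E → ℂ} (hV : ContDiffOn ℝ 1 V R) (h0 : ∀ x ∈ R, x ∉ K → V x = 0) (v : E) :
    ∫ x in R, fderiv ℝ V x v = 0 := by
  have hV' : ContDiff ℝ 1 (R.indicator V) := by
    rw [contDiff_iff_contDiffAt]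
    intro x
    by_cases hx : x ∈ K
    · refine (hV.contDiffAt (hR.mem_nhds (hKR hx))).congr_of_eventuallyEq ?_
      filter_upwards [hR.mem_nhds (hKR hx)] with y hy using Set.indicator_of_mem hy V
    · refine (contDiffAt_const (c := (0 : ℂ))).congr_of_eventuallyEq ?_
      filter_upwards [hK.isClosed.isOpen_compl.mem_nhds hx] with y hy
      by_cases hyR : y ∈ R
      · rw [Set.indicator_of_mem hyR, h0 y hyR hy]
      · rw [Set.indicator_of_notMem hyR]
  have hsupp : ∀ x, x ∉ K → R.indicator V x = 0 := by
    intro x hx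
    by_cases hxR : x ∈ R
    · rw [Set.indicator_of_mem hxR, h0 x hxR hx]
    · rw [Set.indicator_of_notMem hxR]
  have hc : HasCompactSupport (R.indicator V) := HasCompactSupport.intro hK hsupp
  have key := integral_fderiv_eq_zero_of_compactSupport hV' hc v
  rw [← key, ← integral_indicator hR.measurableSet]
  congr 1
  ext x
  by_cases hx : x ∈ R
  · rw [Set.indicator_of_mem hx]
    have : R.indicator V =ᶠ[𝓝 x] V := by
      filter_upwards [hR.mem_nhds hx] with y hy using Set.indicator_of_mem hy V
    rw [this.fderiv_eq]
  · rw [Set.indicator_of_notMem hx]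
    have : R.indicator V =ᶠ[𝓝 x] fun _ => 0 := by
      filter_upwards [hK.isClosed.isOpen_compl.mem_nhds (fun h => hx (hKR h))] with y hy
        using hsupp y hy
    rw [this.fderiv_eq]
    simp

/-- A smooth cut-off: `0` on `s ≤ ε`, `1` on `s ≥ 2ε`. -/
def cutoff (ε s : ℝ) : ℝ := Real.smoothTransition (ε⁻¹ * s - 1)

lemma contDiff_cutoff (ε : ℝ) : ContDiff ℝ 1 (cutoff ε) :=
  (Real.smoothTransition.contDiff (n := 1)).comp
    ((contDiff_const.mul contDiff_id).sub contDiff_const)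

lemma cutoff_eq_zero {ε s : ℝ} (hε : 0 < ε) (h : s ≤ ε) : cutoff ε s = 0 := by
  refine Real.smoothTransition.zero_of_nonpos ?_
  have : ε⁻¹ * s ≤ ε⁻¹ * ε := by gcongr
  rw [inv_mul_cancel₀ hε.ne'] at this
  linarith

lemma cutoff_eq_one {ε s : ℝ} (hε : 0 < ε) (h : 2 * ε ≤ s) : cutoff ε s = 1 := by
  refine Real.smoothTransition.one_of_one_le ?_
  have : ε⁻¹ * (2 * ε) ≤ ε⁻¹ * s := by gcongr
  have h2 : ε⁻¹ * (2 * ε) = 2 := by field_simp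
  linarith

lemma cutoff_nonneg (ε s : ℝ) : 0 ≤ cutoff ε s := Real.smoothTransition.nonneg _

lemma cutoff_le_one (ε s : ℝ) : cutoff ε s ≤ 1 := Real.smoothTransition.le_one _

lemma deriv_cutoff_nonneg {ε : ℝ} (hε : 0 < ε) (s : ℝ) : 0 ≤ deriv (cutoff ε) s :=
  Monotone.deriv_nonneg (fun a b hab => Real.smoothTransition.monotone (by gcongr))

lemma deriv_cutoff_eq_zero_of_lt {ε s : ℝ} (hε : 0 < ε) (h : s < ε) : deriv (cutoff ε) s = 0 := by
  have : cutoff ε =ᶠ[𝓝 s] fun _ => 0 := by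
    filter_upwards [Iio_mem_nhds h] with t ht using cutoff_eq_zero hε (le_of_lt ht)
  rw [this.deriv_eq, deriv_const]

lemma deriv_cutoff_eq_zero_of_gt {ε s : ℝ} (hε : 0 < ε) (h : 2 * ε < s) :
    deriv (cutoff ε) s = 0 := by
  have : cutoff ε =ᶠ[𝓝 s] fun _ => 1 := by
    filter_upwards [Ioi_mem_nhds h] with t ht using cutoff_eq_one hε (le_of_lt ht)
  rw [this.deriv_eq, deriv_const]

/-- The bound is uniform in `ε` by scaling. It makes the part of the divergence of a cut-off flux
that comes from the cut-off integrable uniformly in `ε`. -/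
lemma exists_mul_deriv_cutoff_le :
    ∃ C : ℝ, 0 ≤ C ∧ ∀ ε s : ℝ, 0 < ε → 0 ≤ s → s * deriv (cutoff ε) s ≤ C := by
  have hcont : Continuous (deriv (cutoff 1)) := (contDiff_cutoff 1).continuous_deriv le_rfl
  obtain ⟨C, hC⟩ := (isCompact_Icc (a := (0 : ℝ)) (b := 2)).exists_bound_of_continuousOn
    (f := fun s => s * deriv (cutoff 1) s) (continuous_id.mul hcont).continuousOn
  have hC0 : 0 ≤ C := (norm_nonneg _).trans (hC 0 (by simp))
  refine ⟨C, hC0, fun ε s hε hs => ?_⟩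
  by_cases h2 : 2 * ε < s
  · rw [deriv_cutoff_eq_zero_of_gt hε h2, mul_zero]
    exact hC0
  have hscale : deriv (cutoff ε) s = ε⁻¹ * deriv (cutoff 1) (ε⁻¹ * s) := by
    have : cutoff ε = fun t => cutoff 1 (ε⁻¹ * t) := by
      ext t
      simp [cutoff]
    rw [this, deriv_comp_mul_left, smul_eq_mul]
  have hmem : ε⁻¹ * s ∈ Set.Icc (0 : ℝ) 2 := by
    refine ⟨by positivity, ?_⟩
    rw [inv_mul_le_iff₀ hε]
    linarith
  have := (Real.le_norm_self _).trans (hC _ hmem)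
  rw [hscale]
  calc s * (ε⁻¹ * deriv (cutoff 1) (ε⁻¹ * s)) = ε⁻¹ * s * deriv (cutoff 1) (ε⁻¹ * s) := by ring
    _ ≤ C := this

end Green

section Green

variable {E : Type*} [NormedAddCommGroup E] [InnerProductSpace ℝ E]

/-- The product rule for the flux `h(|u|²) u^* ∂ᵢu` through the surfaces where `|u|` is small. -/
lemma fderiv_cutoff_flux {u : E → ℂ} {x : E} (hu : ContDiffAt ℝ 2 u x) (ε : ℝ) (v : E) :
    fderiv ℝ (fun y => (cutoff ε (‖u y‖ ^ 2) : ℂ) * (conj (u y) * fderiv ℝ u y v)) x v =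
      2 * ((deriv (cutoff ε) (‖u x‖ ^ 2) : ℝ) : ℂ) * (((conj (u x) * fderiv ℝ u x v).re : ℝ) : ℂ) *
          (conj (u x) * fderiv ℝ u x v) +
        (cutoff ε (‖u x‖ ^ 2) : ℂ) * ((‖fderiv ℝ u x v‖ ^ 2 : ℝ) : ℂ) +
        (cutoff ε (‖u x‖ ^ 2) : ℂ) *
          (conj (u x) * fderiv ℝ (fun y => fderiv ℝ u y v) x v) := by
  have hDu : ContDiffAt ℝ 1 (fun y => fderiv ℝ u y v) x :=
    (hu.fderiv_right (m := 1) (by norm_num)).clm_apply contDiffAt_const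
  have hconj : ContDiffAt ℝ 1 (fun y => conj (u y)) x :=
    Complex.conjCLE.contDiff.contDiffAt.comp x (hu.of_le (by norm_num))
  have hcut : ContDiffAt ℝ 1 (fun y => (cutoff ε (‖u y‖ ^ 2) : ℂ)) x :=
    Complex.ofRealCLM.contDiff.contDiffAt.comp x
      ((contDiff_cutoff ε).contDiffAt.comp x ((hu.of_le (by norm_num)).norm_sq ℝ))
  have hdiff :=
    ((hcut.mul (hconj.mul hDu)).differentiableAt one_ne_zero).hasFDerivAt.hasLineDerivAt v
  have h0 : x + (0 : ℝ) • v = x := by simp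
  have h1 : HasDerivAt (fun t : ℝ => u (x + t • v)) (fderiv ℝ u x v) 0 :=
    (hu.differentiableAt two_ne_zero).hasFDerivAt.hasLineDerivAt v
  have h2 : HasDerivAt (fun t : ℝ => fderiv ℝ u (x + t • v) v)
      (fderiv ℝ (fun y => fderiv ℝ u y v) x v) 0 :=
    (hDu.differentiableAt one_ne_zero).hasFDerivAt.hasLineDerivAt v
  have h3 : HasDerivAt (fun t : ℝ => conj (u (x + t • v))) (conj (fderiv ℝ u x v)) 0 := h1.star
  have h4 := h1.norm_sq
  have h5 : HasDerivAt (fun t : ℝ => cutoff ε (‖u (x + t • v)‖ ^ 2))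
      (deriv (cutoff ε) (‖u x‖ ^ 2) * (2 * inner ℝ (u x) (fderiv ℝ u x v))) 0 := by
    have hc : HasDerivAt (cutoff ε) (deriv (cutoff ε) (‖u x‖ ^ 2)) (‖u (x + (0 : ℝ) • v)‖ ^ 2) := by
      rw [h0]
      exact ((contDiff_cutoff ε).differentiable one_ne_zero _).hasDerivAt
    have := hc.comp (0 : ℝ) h4
    rw [h0] at this
    exact this
  have h6 := h5.ofReal_comp.fun_mul (h3.fun_mul h2)
  have h7 := HasDerivAt.unique hdiff h6
  refine h7.trans ?_
  simp only [h0, Complex.inner]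
  have hn : ((‖fderiv ℝ u x v‖ ^ 2 : ℝ) : ℂ) = conj (fderiv ℝ u x v) * fderiv ℝ u x v := by
    rw [mul_comm, Complex.mul_conj, Complex.normSq_eq_norm_sq]
  rw [hn]
  push_cast
  rw [mul_comm (fderiv ℝ u x v) (conj (u x))]
  ring

variable [FiniteDimensional ℝ E]

/-- The squared norm `|∇u|²` of the gradient. -/
def gradSq (u : E → ℂ) (x : E) : ℝ := ∑ i, ‖fderiv ℝ u x (stdOrthonormalBasis ℝ E i)‖ ^ 2

lemma gradSq_nonneg (u : E → ℂ) (x : E) : 0 ≤ gradSq u x :=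
  Finset.sum_nonneg fun _ _ => by positivity

/-- The part of the divergence of the flux `h(|u|²) u^* ∇u` that comes from the cut-off `h`. -/
def cutoffTerm (ε : ℝ) (u : E → ℂ) (x : E) : ℂ :=
  ∑ i, 2 * ((deriv (cutoff ε) (‖u x‖ ^ 2) : ℝ) : ℂ) *
    (((conj (u x) * fderiv ℝ u x (stdOrthonormalBasis ℝ E i)).re : ℝ) : ℂ) *
      (conj (u x) * fderiv ℝ u x (stdOrthonormalBasis ℝ E i))

lemma cutoffTerm_re_nonneg {ε : ℝ} (hε : 0 < ε) (u : E → ℂ) (x : E) :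
    0 ≤ (cutoffTerm ε u x).re := by
  rw [cutoffTerm, Complex.re_sum]
  refine Finset.sum_nonneg fun i _ => ?_
  set z := conj (u x) * fderiv ℝ u x (stdOrthonormalBasis ℝ E i)
  rw [show (2 * ((deriv (cutoff ε) (‖u x‖ ^ 2) : ℝ) : ℂ) * ((z.re : ℝ) : ℂ)) =
    ((2 * deriv (cutoff ε) (‖u x‖ ^ 2) * z.re : ℝ) : ℂ) by push_cast; ring,
    Complex.re_ofReal_mul, mul_assoc]
  have := deriv_cutoff_nonneg hε (‖u x‖ ^ 2)
  exact mul_nonneg (by positivity) (mul_self_nonneg _)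

lemma cutoffTerm_eq_zero {ε : ℝ} {u : E → ℂ} {x : E} (h : deriv (cutoff ε) (‖u x‖ ^ 2) = 0) :
    cutoffTerm ε u x = 0 := by
  simp [cutoffTerm, h]

lemma norm_cutoffTerm_le {ε : ℝ} (hε : 0 < ε) (u : E → ℂ) (x : E) :
    ‖cutoffTerm ε u x‖ ≤ 2 * (‖u x‖ ^ 2 * deriv (cutoff ε) (‖u x‖ ^ 2)) * gradSq u x := by
  rw [cutoffTerm, gradSq, Finset.mul_sum]
  refine (norm_sum_le _ _).trans (Finset.sum_le_sum fun i _ => ?_)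
  have hd := deriv_cutoff_nonneg hε (‖u x‖ ^ 2)
  set z := conj (u x) * fderiv ℝ u x (stdOrthonormalBasis ℝ E i) with hz
  have hzn : ‖z‖ = ‖u x‖ * ‖fderiv ℝ u x (stdOrthonormalBasis ℝ E i)‖ := by simp [hz]
  rw [norm_mul, norm_mul, norm_mul, Complex.norm_real, Complex.norm_real, Complex.norm_two,
    Real.norm_eq_abs, abs_of_nonneg hd, Real.norm_eq_abs]
  calc 2 * deriv (cutoff ε) (‖u x‖ ^ 2) * |z.re| * ‖z‖
      ≤ 2 * deriv (cutoff ε) (‖u x‖ ^ 2) * ‖z‖ * ‖z‖ := by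
        gcongr
        exact Complex.abs_re_le_norm _
    _ = _ := by
        rw [hzn]
        ring

variable [MeasurableSpace E] [BorelSpace E]

/-- Integrating the divergence of the cut-off flux. The first term comes from the cut-off and
lives where `ε ≤ |u|² ≤ 2ε`. -/
lemma cutoff_green {R : Set E} (hR : IsOpen R) {u : E → ℂ} (hu : ContDiffOn ℝ 2 u R)
    (hcpt : ∀ ε : ℝ, 0 < ε → IsCompact {x | x ∈ R ∧ ε ≤ ‖u x‖ ^ 2}) {ε : ℝ} (hε : 0 < ε) :
    IntegrableOn (fun x => cutoffTerm ε u x) R ∧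
    IntegrableOn (fun x => cutoff ε (‖u x‖ ^ 2) * gradSq u x) R ∧
    IntegrableOn (fun x => (cutoff ε (‖u x‖ ^ 2) : ℂ) * (conj (u x) * (Δ u) x)) R ∧
    (∫ x in R, cutoffTerm ε u x) +
    ((∫ x in R, cutoff ε (‖u x‖ ^ 2) * gradSq u x : ℝ) : ℂ) +
    ∫ x in R, (cutoff ε (‖u x‖ ^ 2) : ℂ) * (conj (u x) * (Δ u) x) = 0 := by
  set K : Set E := {x | x ∈ R ∧ ε ≤ ‖u x‖ ^ 2} with hKdef
  have hK : IsCompact K := hcpt ε hε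
  have hKR : K ⊆ R := fun x hx => hx.1
  have hlt : ∀ x ∈ R, x ∉ K → ‖u x‖ ^ 2 < ε := fun x hx hxK => not_le.mp fun h => hxK ⟨hx, h⟩
  have huAt : ∀ x ∈ R, ContDiffAt ℝ 2 u x := fun x hx => hu.contDiffAt (hR.mem_nhds hx)
  have hD1 : ∀ v : E, ContDiffOn ℝ 1 (fun y => fderiv ℝ u y v) R := fun v x hx =>
    (((huAt x hx).fderiv_right (m := 1) (by norm_num)).clm_apply contDiffAt_const).contDiffWithinAt
  have hcu : ContinuousOn u R := hu.continuousOn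
  have hcD : ∀ v : E, ContinuousOn (fun y => fderiv ℝ u y v) R := fun v => (hD1 v).continuousOn
  have hcc : ContinuousOn (fun y => conj (u y)) R := Complex.continuous_conj.comp_continuousOn hcu
  have hcs : ContinuousOn (fun y => ‖u y‖ ^ 2) R := hcu.norm.pow 2
  have hch : ContinuousOn (fun y => cutoff ε (‖u y‖ ^ 2)) R :=
    (contDiff_cutoff ε).continuous.comp_continuousOn hcs
  have hchC : ContinuousOn (fun y => (cutoff ε (‖u y‖ ^ 2) : ℂ)) R :=
    Complex.continuous_ofReal.comp_continuousOn hch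
  have hch' : ContinuousOn (fun y => ((deriv (cutoff ε) (‖u y‖ ^ 2) : ℝ) : ℂ)) R :=
    Complex.continuous_ofReal.comp_continuousOn
      (((contDiff_cutoff ε).continuous_deriv le_rfl).comp_continuousOn hcs)
  have hcΔ : ContinuousOn (Δ u) R := by
    have : ContinuousOn (fun x => ∑ i, fderiv ℝ (fun y => fderiv ℝ u y
        (stdOrthonormalBasis ℝ E i)) x (stdOrthonormalBasis ℝ E i)) R :=
      continuousOn_finsetSum _ fun i _ =>
        ((hD1 _).continuousOn_fderiv_of_isOpen hR le_rfl).clm_apply continuousOn_const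
    exact this.congr fun x hx => laplacian_eq_sum_fderiv (huAt x hx)
  have hi1 : ∀ i, IntegrableOn (fun x => 2 * ((deriv (cutoff ε) (‖u x‖ ^ 2) : ℝ) : ℂ) *
      (((conj (u x) * fderiv ℝ u x (stdOrthonormalBasis ℝ E i)).re : ℝ) : ℂ) *
          (conj (u x) * fderiv ℝ u x (stdOrthonormalBasis ℝ E i))) R := fun i => by
    refine integrableOn_of_eq_zero_off_compact hR hK hKR ?_ ?_
    · exact ((continuousOn_const.mul hch').mul (Complex.continuous_ofReal.comp_continuousOn
        (Complex.continuous_re.comp_continuousOn (hcc.mul (hcD _))))).mul (hcc.mul (hcD _))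
    · intro x hx hxK
      rw [deriv_cutoff_eq_zero_of_lt hε (hlt x hx hxK)]
      simp
  have hi2 : ∀ i, IntegrableOn (fun x => cutoff ε (‖u x‖ ^ 2) *
      ‖fderiv ℝ u x (stdOrthonormalBasis ℝ E i)‖ ^ 2) R := fun i => by
    refine integrableOn_of_eq_zero_off_compact hR hK hKR (hch.mul ((hcD _).norm.pow 2)) ?_
    intro x hx hxK
    rw [cutoff_eq_zero hε (hlt x hx hxK).le, zero_mul]
  have hi3 : IntegrableOn (fun x => (cutoff ε (‖u x‖ ^ 2) : ℂ) * (conj (u x) * (Δ u) x)) R := by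
    refine integrableOn_of_eq_zero_off_compact hR hK hKR (hchC.mul (hcc.mul hcΔ)) ?_
    intro x hx hxK
    rw [cutoff_eq_zero hε (hlt x hx hxK).le]
    simp
  have hi2' : IntegrableOn (fun x => cutoff ε (‖u x‖ ^ 2) * gradSq u x) R := by
    simp only [gradSq, Finset.mul_sum]
    exact integrable_finsetSum _ fun i _ => hi2 i
  have hi2C : IntegrableOn (fun x => ((cutoff ε (‖u x‖ ^ 2) * gradSq u x : ℝ) : ℂ)) R := hi2'.ofReal
  have hi1' : IntegrableOn (cutoffTerm ε u) R := integrable_finsetSum _ fun i _ => hi1 i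
  refine ⟨hi1', hi2', hi3, ?_⟩
  have hV : ∀ i, ∫ x in R, fderiv ℝ (fun y => (cutoff ε (‖u y‖ ^ 2) : ℂ) *
      (conj (u y) * fderiv ℝ u y (stdOrthonormalBasis ℝ E i))) x (stdOrthonormalBasis ℝ E i) = 0 :=
    fun i => by
    refine setIntegral_fderiv_eq_zero hR hK hKR ?_ ?_ _
    · have h1 : ContDiffOn ℝ 1 u R := hu.of_le (by norm_num)
      exact (Complex.ofRealCLM.contDiff.comp_contDiffOn ((contDiff_cutoff ε).comp_contDiffOn
        (h1.norm_sq ℝ))).mul ((Complex.conjCLE.contDiff.comp_contDiffOn h1).mul (hD1 _))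
    · intro x hx hxK
      rw [cutoff_eq_zero hε (hlt x hx hxK).le]
      simp
  have hcongr : ∀ i, IntegrableOn (fun x => fderiv ℝ (fun y => (cutoff ε (‖u y‖ ^ 2) : ℂ) *
      (conj (u y) * fderiv ℝ u y (stdOrthonormalBasis ℝ E i))) x (stdOrthonormalBasis ℝ E i)) R :=
    fun i => by
    refine integrableOn_of_eq_zero_off_compact hR hK hKR ?_ ?_
    · have h1 : ContDiffOn ℝ 1 u R := hu.of_le (by norm_num)
      exact (((Complex.ofRealCLM.contDiff.comp_contDiffOn ((contDiff_cutoff ε).comp_contDiffOn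
        (h1.norm_sq ℝ))).mul ((Complex.conjCLE.contDiff.comp_contDiffOn h1).mul
          (hD1 _))).continuousOn_fderiv_of_isOpen hR le_rfl).clm_apply continuousOn_const
    · intro x hx hxK
      rw [fderiv_cutoff_flux (huAt x hx), deriv_cutoff_eq_zero_of_lt hε (hlt x hx hxK),
        cutoff_eq_zero hε (hlt x hx hxK).le]
      simp
  have hsum : ∫ x in R, ∑ i, fderiv ℝ (fun y => (cutoff ε (‖u y‖ ^ 2) : ℂ) *
      (conj (u y) * fderiv ℝ u y (stdOrthonormalBasis ℝ E i))) x
        (stdOrthonormalBasis ℝ E i) = 0 := by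
    rw [integral_finsetSum _ fun i _ => hcongr i]
    exact Finset.sum_eq_zero fun i _ => hV i
  have hi12 : IntegrableOn
      (fun x => cutoffTerm ε u x + ((cutoff ε (‖u x‖ ^ 2) * gradSq u x : ℝ) : ℂ)) R := hi1'.add hi2C
  rw [← integral_complex_ofReal, ← integral_add hi1' hi2C, ← integral_add hi12 hi3, ← hsum]
  refine setIntegral_congr_fun hR.measurableSet fun x hx => ?_
  simp only [fderiv_cutoff_flux (huAt x hx), laplacian_eq_sum_fderiv (huAt x hx), gradSq,
    cutoffTerm]
  push_cast
  rw [Finset.mul_sum, Finset.mul_sum, Finset.mul_sum, Finset.sum_add_distrib,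
    Finset.sum_add_distrib]

/-- The energy bound: the term from the cut-off has a non-negative real part, so the cut-off energy
is at most the norm integral of `u^* ∇²u`. -/
lemma setIntegral_cutoff_mul_gradSq_le {R : Set E} (hR : IsOpen R) {u : E → ℂ}
    (hu : ContDiffOn ℝ 2 u R)
    (hcpt : ∀ ε : ℝ, 0 < ε → IsCompact {x | x ∈ R ∧ ε ≤ ‖u x‖ ^ 2})
    (hint : IntegrableOn (fun x => conj (u x) * (Δ u) x) R) {ε : ℝ} (hε : 0 < ε) :
    ∫ x in R, cutoff ε (‖u x‖ ^ 2) * gradSq u x ≤ ∫ x in R, ‖conj (u x) * (Δ u) x‖ := by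
  obtain ⟨h1, h2, h3, h4⟩ := cutoff_green hR hu hcpt hε
  have hre := congrArg Complex.re h4
  simp only [Complex.add_re, Complex.ofReal_re, Complex.zero_re] at hre
  have hA : 0 ≤ (∫ x in R, cutoffTerm ε u x).re := by
    have := integral_re (𝕜 := ℂ) h1
    simp only [RCLike.re_eq_complex_re] at this
    rw [← this]
    exact integral_nonneg fun x => cutoffTerm_re_nonneg hε u x
  have hB : -(∫ x in R, (cutoff ε (‖u x‖ ^ 2) : ℂ) * (conj (u x) * (Δ u) x)).re ≤
      ∫ x in R, ‖conj (u x) * (Δ u) x‖ := by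
    refine (neg_le_abs _).trans ((Complex.abs_re_le_norm _).trans
      ((norm_integral_le_integral_norm _).trans ?_))
    refine integral_mono h3.norm hint.norm fun x => ?_
    rw [norm_mul, Complex.norm_real, Real.norm_eq_abs, abs_of_nonneg (cutoff_nonneg _ _)]
    exact mul_le_of_le_one_left (norm_nonneg _) (cutoff_le_one _ _)
  linarith

lemma tendsto_cutoff_mul {e : ℕ → ℝ} (he0 : ∀ k, 0 < e k) (helim : Tendsto e atTop (𝓝 0))
    {s : ℝ} (hs : 0 ≤ s) (a : ℝ) :
    Tendsto (fun k => cutoff (e k) s * a) atTop (𝓝 (if 0 < s then a else 0)) := by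
  rcases hs.eq_or_lt with rfl | hs
  · simp [fun k => cutoff_eq_zero (he0 k) (he0 k).le]
  · rw [if_pos hs]
    have h2 : Tendsto (fun k => 2 * e k) atTop (𝓝 0) := by simpa using helim.const_mul 2
    refine tendsto_const_nhds.congr' ((h2.eventually_lt_const hs).mono fun k hk => ?_)
    simp only [cutoff_eq_one (he0 k) hk.le, one_mul]

/-- `|∇u|²` is integrable where `u ≠ 0`, by the energy bound and Fatou's lemma. -/
lemma integrableOn_gradSq_of_ne_zero {R : Set E} (hR : IsOpen R) {u : E → ℂ}
    (hu : ContDiffOn ℝ 2 u R)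
    (hcpt : ∀ ε : ℝ, 0 < ε → IsCompact {x | x ∈ R ∧ ε ≤ ‖u x‖ ^ 2})
    (hint : IntegrableOn (fun x => conj (u x) * (Δ u) x) R) :
    IntegrableOn (fun x => if 0 < ‖u x‖ ^ 2 then gradSq u x else 0) R := by
  set e : ℕ → ℝ := fun k => 1 / ((k : ℝ) + 1) with he
  have he0 : ∀ k, 0 < e k := fun k => by positivity
  have helim : Tendsto e atTop (𝓝 0) := tendsto_one_div_add_atTop_nhds_zero_nat
  have hGlim : ∀ x, Tendsto (fun k => cutoff (e k) (‖u x‖ ^ 2) * gradSq u x) atTop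
      (𝓝 (if 0 < ‖u x‖ ^ 2 then gradSq u x else 0)) := fun x =>
    tendsto_cutoff_mul he0 helim (by positivity) _
  have hmeas : ∀ k, AEStronglyMeasurable (fun x => cutoff (e k) (‖u x‖ ^ 2) * gradSq u x)
      (volume.restrict R) := fun k => (cutoff_green hR hu hcpt (he0 k)).2.1.aestronglyMeasurable
  refine ⟨aestronglyMeasurable_of_tendsto_ae atTop hmeas (Eventually.of_forall hGlim), ?_⟩
  have hfatou := lintegral_liminf_le' (u := atTop) fun k => (hmeas k).aemeasurable.enorm
  have hlim : ∀ x, liminf (fun k => ‖cutoff (e k) (‖u x‖ ^ 2) * gradSq u x‖ₑ) atTop =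
      ‖(if 0 < ‖u x‖ ^ 2 then gradSq u x else 0 : ℝ)‖ₑ := fun x => (hGlim x).enorm.liminf_eq
  simp only [hlim] at hfatou
  refine lt_of_le_of_lt hfatou (lt_of_le_of_lt
    (b := ENNReal.ofReal (∫ x in R, ‖conj (u x) * (Δ u) x‖)) ?_ ENNReal.ofReal_lt_top)
  refine liminf_le_of_le (by isBoundedDefault) fun b hb => ?_
  obtain ⟨k, hk⟩ := hb.exists
  refine hk.trans ?_
  rw [← ofReal_integral_norm_eq_lintegral_enorm (cutoff_green hR hu hcpt (he0 k)).2.1]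
  refine ENNReal.ofReal_le_ofReal (le_trans (le_of_eq ?_)
    (setIntegral_cutoff_mul_gradSq_le hR hu hcpt hint (he0 k)))
  refine integral_congr_ae (Eventually.of_forall fun x => ?_)
  exact abs_of_nonneg (mul_nonneg (cutoff_nonneg _ _) (gradSq_nonneg _ _))

lemma tendsto_setIntegral_cutoff_mul {R : Set E} (hR : IsOpen R) {u : E → ℂ}
    (hu : ContDiffOn ℝ 2 u R)
    (hcpt : ∀ ε : ℝ, 0 < ε → IsCompact {x | x ∈ R ∧ ε ≤ ‖u x‖ ^ 2})
    (hint : IntegrableOn (fun x => conj (u x) * (Δ u) x) R)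
    {e : ℕ → ℝ} (he0 : ∀ k, 0 < e k) (helim : Tendsto e atTop (𝓝 0)) :
    Tendsto (fun k => ∫ x in R, (cutoff (e k) (‖u x‖ ^ 2) : ℂ) * (conj (u x) * (Δ u) x)) atTop
      (𝓝 (∫ x in R, conj (u x) * (Δ u) x)) := by
  set f : E → ℂ := fun x => conj (u x) * (Δ u) x with hf
  have hnorm : Integrable (fun x => ‖f x‖) (volume.restrict R) := Integrable.norm hint
  refine tendsto_integral_of_dominated_convergence (fun x => ‖f x‖)
    (fun k => (cutoff_green hR hu hcpt (he0 k)).2.2.1.aestronglyMeasurable) hnorm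
    (fun k => Eventually.of_forall fun x => ?_) (Eventually.of_forall fun x => ?_)
  · rw [norm_mul, Complex.norm_real, Real.norm_eq_abs, abs_of_nonneg (cutoff_nonneg _ _)]
    exact mul_le_of_le_one_left (norm_nonneg _) (cutoff_le_one _ _)
  · change Tendsto (fun k => (cutoff (e k) (‖u x‖ ^ 2) : ℂ) * f x) atTop (𝓝 (f x))
    rcases (sq_nonneg ‖u x‖).eq_or_lt with hx | hx
    · have hx0 : f x = 0 := by
        simp [hf, norm_eq_zero.mp (pow_eq_zero_iff two_ne_zero |>.mp hx.symm)]
      simp [hx0]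
    · have h1 := tendsto_cutoff_mul he0 helim hx.le 1
      simp only [if_pos hx, mul_one] at h1
      have h2 := (Complex.continuous_ofReal.tendsto 1).comp h1
      simpa using Tendsto.mul_const (f x) h2

/-- If `u` vanishes at the boundary of `R` and at infinity, in the sense of the compactness of the
sets where `|u|²` is at least `ε`, then `∫_R u^* ∇²u` is real: in the cut-off identity the term with
`|∇u|²` is real, and the term from the cut-off tends to `0`. -/
theorem im_integral_conj_mul_laplacian {R : Set E} (hR : IsOpen R) {u : E → ℂ}
    (hu : ContDiffOn ℝ 2 u R)
    (hcpt : ∀ ε : ℝ, 0 < ε → IsCompact {x | x ∈ R ∧ ε ≤ ‖u x‖ ^ 2})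
    (hint : IntegrableOn (fun x => conj (u x) * (Δ u) x) R) :
    (∫ x in R, conj (u x) * (Δ u) x).im = 0 := by
  set e : ℕ → ℝ := fun k => 1 / ((k : ℝ) + 1) with he
  have he0 : ∀ k, 0 < e k := fun k => by positivity
  have helim : Tendsto e atTop (𝓝 0) := tendsto_one_div_add_atTop_nhds_zero_nat
  obtain ⟨C, hC0, hC⟩ := exists_mul_deriv_cutoff_le
  have hzero : ∀ x, ‖u x‖ ^ 2 = 0 ∨ 0 < ‖u x‖ ^ 2 := fun x =>
    (le_iff_eq_or_lt.mp (sq_nonneg ‖u x‖)).imp_left Eq.symm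
  have hd0 : ∀ k x, ‖u x‖ ^ 2 = 0 → deriv (cutoff (e k)) (‖u x‖ ^ 2) = 0 := fun k x hx =>
    deriv_cutoff_eq_zero_of_lt (he0 k) (hx.symm ▸ he0 k)
  have hlim1 : Tendsto (fun k => ∫ x in R, cutoffTerm (e k) u x) atTop
      (𝓝 (∫ x in R, (0 : ℂ))) := by
    refine tendsto_integral_of_dominated_convergence
      (fun x => 2 * C * if 0 < ‖u x‖ ^ 2 then gradSq u x else 0)
      (fun k => (cutoff_green hR hu hcpt (he0 k)).1.aestronglyMeasurable)
      ((integrableOn_gradSq_of_ne_zero hR hu hcpt hint).const_mul _)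
      (fun k => Eventually.of_forall fun x => ?_) (Eventually.of_forall fun x => ?_)
    · rcases hzero x with hx | hx
      · rw [cutoffTerm_eq_zero (hd0 k x hx), hx]
        simp
      · rw [if_pos hx]
        refine (norm_cutoffTerm_le (he0 k) u x).trans ?_
        have := gradSq_nonneg u x
        gcongr
        exact hC _ _ (he0 k) hx.le
    · refine tendsto_const_nhds.congr' ?_
      rcases hzero x with hx | hx
      · exact Eventually.of_forall fun k => (cutoffTerm_eq_zero (hd0 k x hx)).symm
      · have h2 : Tendsto (fun k => 2 * e k) atTop (𝓝 0) := by simpa using helim.const_mul 2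
        exact (h2.eventually_lt_const hx).mono fun k hk =>
          (cutoffTerm_eq_zero (deriv_cutoff_eq_zero_of_gt (he0 k) hk)).symm
  have hlim2 := tendsto_setIntegral_cutoff_mul hR hu hcpt hint he0 helim
  have him : ∀ k, (∫ x in R, cutoffTerm (e k) u x).im +
      (∫ x in R, (cutoff (e k) (‖u x‖ ^ 2) : ℂ) * (conj (u x) * (Δ u) x)).im = 0 := fun k => by
    have := congrArg Complex.im (cutoff_green hR hu hcpt (he0 k)).2.2.2
    simpa only [Complex.add_im, Complex.ofReal_im, add_zero, Complex.zero_im] using this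
  have hl := ((Complex.continuous_im.tendsto _).comp hlim1).add
    ((Complex.continuous_im.tendsto _).comp hlim2)
  have := tendsto_nhds_unique hl (tendsto_const_nhds.congr fun k => (him k).symm)
  simpa using this

end Green

section KineticMatrix

/-- The conditions at the boundary and at infinity enter the argument only through this. -/
lemma isCompact_superlevel {E : Type*} [NormedAddCommGroup E] {R : Set E} {u : E → ℂ}
    (hcont : ContinuousOn u (closure R)) (hboundary : ∀ x ∈ frontier R, u x = 0)
    (hinfty : Tendsto u (cocompact E ⊓ 𝓟 R) (𝓝 0)) {ε : ℝ} (hε : 0 < ε) :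
    IsCompact {x | x ∈ R ∧ ε ≤ ‖u x‖ ^ 2} := by
  have hS : {x | x ∈ R ∧ ε ≤ ‖u x‖ ^ 2} = {x | x ∈ closure R ∧ ε ≤ ‖u x‖ ^ 2} := by
    ext x
    refine ⟨fun h => ⟨subset_closure h.1, h.2⟩, fun h => ⟨?_, h.2⟩⟩
    by_contra hx
    have hfr : x ∈ frontier R := ⟨h.1, fun hi => hx (interior_subset hi)⟩
    have h2 := h.2
    rw [hboundary x hfr] at h2
    simp only [norm_zero, ne_eq, OfNat.ofNat_ne_zero, not_false_eq_true, zero_pow] at h2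
    linarith
  have hclosed : IsClosed {x | x ∈ R ∧ ε ≤ ‖u x‖ ^ 2} := by
    rw [hS]
    exact (hcont.norm.pow 2).preimage_isClosed_of_isClosed isClosed_closure isClosed_Ici
  have hlim : Tendsto (fun x => ‖u x‖ ^ 2) (cocompact E ⊓ 𝓟 R) (𝓝 0) := by
    simpa using (hinfty.norm).pow 2
  have hev := hlim.eventually_lt_const hε
  rw [eventually_inf_principal] at hev
  obtain ⟨t, ht, hts⟩ := mem_cocompact.mp hev
  refine ht.of_isClosed_subset hclosed fun x hx => ?_
  by_contra hxt
  exact absurd (hts hxt hx.1) (not_lt.mpr hx.2)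

variable {E : Type*} [NormedAddCommGroup E] [InnerProductSpace ℝ E] [FiniteDimensional ℝ E]
  [MeasurableSpace E] [BorelSpace E]

/-- The matrix of the Laplacian in modes that vanish at the boundary and at infinity is
hermitian: its quadratic form is real. -/
theorem integral_conj_mul_laplacian_symm {R : Set E} (hR : IsOpen R) {ι : Type*} {φ : ι → E → ℂ}
    (hsmooth : ∀ n, ContDiffOn ℝ 2 (φ n) R) (hcont : ∀ n, ContinuousOn (φ n) (closure R))
    (hboundary : ∀ n, ∀ x ∈ frontier R, φ n x = 0)
    (hinfty : ∀ n, Tendsto (φ n) (cocompact E ⊓ 𝓟 R) (𝓝 0))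
    (hkin : ∀ n m, IntegrableOn (fun x => conj (φ n x) * (Δ (φ m)) x) R) (n m : ι) :
    conj (∫ x in R, conj (φ n x) * (Δ (φ m)) x) = ∫ x in R, conj (φ m x) * (Δ (φ n)) x := by
  have hq : ∀ c : ℂ, ((∫ x in R, conj (φ n x) * (Δ (φ n)) x) +
      c * (∫ x in R, conj (φ n x) * (Δ (φ m)) x) +
      conj c * (∫ x in R, conj (φ m x) * (Δ (φ n)) x) +
      conj c * c * (∫ x in R, conj (φ m x) * (Δ (φ m)) x)).im = 0 := by
    intro c
    have hm' : ∀ x ∈ R, ContDiffAt ℝ 2 (c • φ m) x := fun x hx =>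
      ((hsmooth m).contDiffAt (hR.mem_nhds hx)).const_smul c
    set u : E → ℂ := φ n + c • φ m with hu
    have hΔ : ∀ x ∈ R, conj (u x) * (Δ u) x = conj (φ n x) * (Δ (φ n)) x +
        c * (conj (φ n x) * (Δ (φ m)) x) + conj c * (conj (φ m x) * (Δ (φ n)) x) +
        conj c * c * (conj (φ m x) * (Δ (φ m)) x) := by
      intro x hx
      have hn := (hsmooth n).contDiffAt (hR.mem_nhds hx)
      have hm := (hsmooth m).contDiffAt (hR.mem_nhds hx)
      rw [hu, hn.laplacian_add (hm' x hx), InnerProductSpace.laplacian_smul c hm]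
      simp only [Pi.add_apply, Pi.smul_apply, smul_eq_mul, map_add, map_mul]
      ring
    have h1 := hkin n n
    have h2 := (hkin n m).const_mul c
    have h3 := (hkin m n).const_mul (conj c)
    have h4 := (hkin m m).const_mul (conj c * c)
    have hint : IntegrableOn (fun x => conj (u x) * (Δ u) x) R :=
      IntegrableOn.congr_fun (((h1.add h2).add h3).add h4) (fun x hx => (hΔ x hx).symm)
        hR.measurableSet
    have hlim : Tendsto u (cocompact E ⊓ 𝓟 R) (𝓝 0) := by
      have := (hinfty n).add ((hinfty m).const_smul c)
      rw [smul_zero, add_zero] at this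
      exact this
    have key := im_integral_conj_mul_laplacian hR (u := u)
      ((hsmooth n).add ((hsmooth m).const_smul c)) (fun ε hε => isCompact_superlevel
        ((hcont n).add ((hcont m).const_smul c))
        (fun x hx => by simp [hboundary n x hx, hboundary m x hx])
        hlim hε) hint
    rw [setIntegral_congr_fun hR.measurableSet hΔ] at key
    have e : ∫ x in R, (conj (φ n x) * (Δ (φ n)) x +
        c * (conj (φ n x) * (Δ (φ m)) x) + conj c * (conj (φ m x) * (Δ (φ n)) x) +
        conj c * c * (conj (φ m x) * (Δ (φ m)) x)) =
        (∫ x in R, conj (φ n x) * (Δ (φ n)) x) +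
      c * (∫ x in R, conj (φ n x) * (Δ (φ m)) x) +
      conj c * (∫ x in R, conj (φ m x) * (Δ (φ n)) x) +
      conj c * c * (∫ x in R, conj (φ m x) * (Δ (φ m)) x) := by
      have h12 : IntegrableOn (fun x => conj (φ n x) * (Δ (φ n)) x +
        c * (conj (φ n x) * (Δ (φ m)) x)) R := h1.add h2
      have h123 : IntegrableOn (fun x => conj (φ n x) * (Δ (φ n)) x +
        c * (conj (φ n x) * (Δ (φ m)) x) + conj c * (conj (φ m x) * (Δ (φ n)) x)) R := h12.add h3
      simp only [← integral_const_mul]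
      rw [← integral_add h1 h2, ← integral_add h12 h3, ← integral_add h123 h4]
    rwa [e] at key
  -- polarisation: these five values of `c` determine the matrix up to the asserted symmetry
  have h0 := hq 0
  have h1 := hq 1
  have h2 := hq (-1)
  have h3 := hq Complex.I
  have h4 := hq (-Complex.I)
  simp only [map_neg, map_one, map_zero, Complex.conj_I, Complex.add_im, Complex.mul_im,
    Complex.mul_re, Complex.neg_re, Complex.neg_im, Complex.one_re, Complex.one_im, Complex.I_re,
    Complex.I_im, Complex.zero_re, Complex.zero_im] at h0 h1 h2 h3 h4
  apply Complex.ext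
  · simp only [Complex.conj_re]
    linarith
  · simp only [Complex.conj_im]
    linarith

end KineticMatrix

/-! ### Matrix elements of the displacement operator of one mode -/

/-- The complex Hermite polynomials `∑_k k! (m choose k) (n choose k) x^(m-k) y^(n-k)`, defined by
their recursion in `m`. -/
def complexHermite : ℕ → ℕ → ℂ → ℂ → ℂ
  | 0, n, _, y => y ^ n
  | m + 1, n, x, y => x * complexHermite m n x y + n * complexHermite m (n - 1) x y

lemma complexHermite_succ_left (m n : ℕ) (x y : ℂ) :
    complexHermite (m + 1) n x y = x * complexHermite m n x y + n * complexHermite m (n - 1) x y :=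
  rfl

lemma complexHermite_succ_right (m n : ℕ) (x y : ℂ) :
    complexHermite m (n + 1) x y =
      y * complexHermite m n x y + m * complexHermite (m - 1) n x y := by
  induction m generalizing n with
  | zero => simp [complexHermite, pow_succ']
  | succ m ih =>
    have h1 : (m : ℂ) * complexHermite m n x y = m * x * complexHermite (m - 1) n x y +
        m * n * complexHermite (m - 1) (n - 1) x y := by
      cases m with
      | zero => simp
      | succ m => rw [complexHermite_succ_left, Nat.add_sub_cancel]; ring
    have h2 : (n : ℂ) * complexHermite m n x y = n * y * complexHermite m (n - 1) x y +
        m * n * complexHermite (m - 1) (n - 1) x y := by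
      cases n with
      | zero => simp
      | succ n => rw [ih, Nat.add_sub_cancel]; ring
    rw [complexHermite_succ_left, ih, complexHermite_succ_left m n, Nat.add_sub_cancel]
    push_cast
    linear_combination h2 - h1

lemma hasDerivAt_complexHermite {𝕜 : Type*} [NontriviallyNormedField 𝕜] [NormedAlgebra 𝕜 ℂ]
    {x y : 𝕜 → ℂ} {x' y' : ℂ} {t : 𝕜} (hx : HasDerivAt x x' t) (hy : HasDerivAt y y' t) (m n : ℕ) :
    HasDerivAt (fun s => complexHermite m n (x s) (y s))
      (m * complexHermite (m - 1) n (x t) (y t) * x' +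
        n * complexHermite m (n - 1) (x t) (y t) * y') t := by
  induction m generalizing n with
  | zero =>
    simp only [complexHermite]
    refine (hy.fun_pow n).congr_deriv ?_
    simp
  | succ m ih =>
    simp only [complexHermite_succ_left]
    refine ((hx.fun_mul (ih n)).fun_add ((ih (n - 1)).const_mul (n : ℂ))).congr_deriv ?_
    have h1 : (m : ℂ) * complexHermite m n (x t) (y t) =
        m * x t * complexHermite (m - 1) n (x t) (y t) +
        m * n * complexHermite (m - 1) (n - 1) (x t) (y t) := by
      cases m with
      | zero => simp
      | succ m => rw [complexHermite_succ_left, Nat.add_sub_cancel]; ring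
    rw [Nat.add_sub_cancel]
    push_cast
    linear_combination (-x') * h1

lemma norm_complexHermite_le (m n : ℕ) (x y : ℂ) :
    ‖complexHermite m n x y‖ ≤ (‖x‖ + n) ^ m * (1 + ‖y‖) ^ n := by
  induction m generalizing n with
  | zero =>
    simp only [complexHermite, norm_pow, pow_zero, one_mul]
    gcongr
    linarith
  | succ m ih =>
    rw [complexHermite_succ_left]
    have h1 : ‖complexHermite m (n - 1) x y‖ ≤ (‖x‖ + n) ^ m * (1 + ‖y‖) ^ n := by
      refine (ih (n - 1)).trans ?_
      have : ((n - 1 : ℕ) : ℝ) ≤ n := by exact_mod_cast Nat.sub_le n 1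
      gcongr
      · linarith [norm_nonneg y]
      · exact Nat.sub_le n 1
    calc _ ≤ ‖x‖ * ‖complexHermite m n x y‖ + n * ‖complexHermite m (n - 1) x y‖ := by
          refine (norm_add_le _ _).trans (le_of_eq ?_)
          simp
      _ ≤ ‖x‖ * ((‖x‖ + n) ^ m * (1 + ‖y‖) ^ n) + n * ((‖x‖ + n) ^ m * (1 + ‖y‖) ^ n) := by
          gcongr
          exact ih n
      _ = _ := by ring

/-- The normalised complex Hermite function `e^{xy/2} H_{m,n}(x, y) / √(m! n!)`. At `x = z`,
`y = -z^*` it is the matrix element `⟨m| exp(z a† - z^* a) |n⟩`; keeping `x` and `y` independent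
makes it entire in both. -/
def hermiteFun (m n : ℕ) (x y : ℂ) : ℂ :=
  Complex.exp (x * y / 2) * complexHermite m n x y /
    ((Real.sqrt (m.factorial : ℝ) : ℂ) * (Real.sqrt (n.factorial : ℝ) : ℂ))

lemma sqrt_factorial_ne_zero (n : ℕ) : (Real.sqrt (n.factorial : ℝ) : ℂ) ≠ 0 := by
  rw [Complex.ofReal_ne_zero, Real.sqrt_ne_zero']
  exact_mod_cast n.factorial_pos

lemma sqrt_factorial_succ (n : ℕ) : (Real.sqrt ((n + 1).factorial : ℝ) : ℂ) =
    (Real.sqrt ((n : ℝ) + 1) : ℂ) * (Real.sqrt (n.factorial : ℝ) : ℂ) := by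
  rw [Nat.factorial_succ, Nat.cast_mul, Real.sqrt_mul (by positivity)]
  push_cast
  rfl

lemma sqrt_succ_mul_self (n : ℕ) :
    (Real.sqrt ((n : ℝ) + 1) : ℂ) * (Real.sqrt ((n : ℝ) + 1) : ℂ) = n + 1 := by
  rw [← Complex.ofReal_mul, Real.mul_self_sqrt (by positivity)]
  push_cast
  rfl

lemma sqrt_succ_ne_zero (n : ℕ) : (Real.sqrt ((n : ℝ) + 1) : ℂ) ≠ 0 := by
  rw [Complex.ofReal_ne_zero, Real.sqrt_ne_zero']
  positivity

/-- At `n = 0` both sides are `0`, so the truncated `n - 1` does no harm. -/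
lemma div_sqrt_factorial (n : ℕ) (f : ℕ → ℂ) :
    (n : ℂ) * f (n - 1) / (Real.sqrt (n.factorial : ℝ) : ℂ) =
      (Real.sqrt (n : ℝ) : ℂ) * (f (n - 1) / (Real.sqrt ((n - 1).factorial : ℝ) : ℂ)) := by
  cases n with
  | zero => simp
  | succ n =>
    rw [sqrt_factorial_succ, Nat.add_sub_cancel]
    have h1 := sqrt_succ_mul_self n
    have h2 := sqrt_succ_ne_zero n
    have h3 := sqrt_factorial_ne_zero n
    push_cast
    field_simp
    linear_combination (-f n) * h1

lemma hermiteFun_succ_left (m n : ℕ) (x y : ℂ) :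
    (Real.sqrt ((m : ℝ) + 1) : ℂ) * hermiteFun (m + 1) n x y =
      x * hermiteFun m n x y + (Real.sqrt (n : ℝ) : ℂ) * hermiteFun m (n - 1) x y := by
  have h := div_sqrt_factorial n fun k => complexHermite m k x y
  have h1 := sqrt_succ_ne_zero m
  have h2 := sqrt_factorial_ne_zero m
  have h3 := sqrt_factorial_ne_zero n
  have h4 := sqrt_factorial_ne_zero (n - 1)
  simp only [hermiteFun, complexHermite_succ_left, sqrt_factorial_succ]
  field_simp at h ⊢
  linear_combination h

lemma hermiteFun_succ_right (m n : ℕ) (x y : ℂ) :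
    (Real.sqrt ((n : ℝ) + 1) : ℂ) * hermiteFun m (n + 1) x y =
      y * hermiteFun m n x y + (Real.sqrt (m : ℝ) : ℂ) * hermiteFun (m - 1) n x y := by
  have h := div_sqrt_factorial m fun k => complexHermite k n x y
  have h1 := sqrt_succ_ne_zero n
  have h2 := sqrt_factorial_ne_zero m
  have h3 := sqrt_factorial_ne_zero n
  have h4 := sqrt_factorial_ne_zero (m - 1)
  simp only [hermiteFun, complexHermite_succ_right, sqrt_factorial_succ]
  field_simp at h ⊢
  linear_combination h

lemma hasDerivAt_hermiteFun {𝕜 : Type*} [NontriviallyNormedField 𝕜] [NormedAlgebra 𝕜 ℂ]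
    {x y : 𝕜 → ℂ} {x' y' : ℂ} {t : 𝕜} (hx : HasDerivAt x x' t) (hy : HasDerivAt y y' t) (m n : ℕ) :
    HasDerivAt (fun s => hermiteFun m n (x s) (y s))
      (((Real.sqrt ((n : ℝ) + 1) : ℂ) * hermiteFun m (n + 1) (x t) (y t) +
          (Real.sqrt (m : ℝ) : ℂ) * hermiteFun (m - 1) n (x t) (y t)) / 2 * x' +
        ((Real.sqrt ((m : ℝ) + 1) : ℂ) * hermiteFun (m + 1) n (x t) (y t) +
          (Real.sqrt (n : ℝ) : ℂ) * hermiteFun m (n - 1) (x t) (y t)) / 2 * y') t := by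
  have hexp : HasDerivAt (fun s => Complex.exp (x s * y s / 2))
      (Complex.exp (x t * y t / 2) * ((x' * y t + x t * y') / 2)) t :=
    (Complex.hasDerivAt_exp _).comp_of_eq t ((hx.fun_mul hy).div_const 2) rfl
  have hn := div_sqrt_factorial n fun k => complexHermite m k (x t) (y t)
  have hm := div_sqrt_factorial m fun k => complexHermite k n (x t) (y t)
  refine ((hexp.fun_mul (hasDerivAt_complexHermite hx hy m n)).div_const _).congr_deriv ?_
  rw [hermiteFun_succ_left, hermiteFun_succ_right]
  simp only [hermiteFun]
  linear_combination
    (Complex.exp (x t * y t / 2) * x' / (Real.sqrt (n.factorial : ℝ) : ℂ)) * hm +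
      (Complex.exp (x t * y t / 2) * y' / (Real.sqrt (m.factorial : ℝ) : ℂ)) * hn

/-- The matrix element `⟨m| exp(z a† - z^* a) |n⟩` of the displacement operator of one mode. -/
def modeDisp (m n : ℕ) (z : ℂ) : ℂ := hermiteFun m n z (-conj z)

lemma modeDisp_succ_left (m n : ℕ) (z : ℂ) :
    (Real.sqrt ((m : ℝ) + 1) : ℂ) * modeDisp (m + 1) n z =
      z * modeDisp m n z + (Real.sqrt (n : ℝ) : ℂ) * modeDisp m (n - 1) z :=
  hermiteFun_succ_left m n z _

lemma modeDisp_succ_right (m n : ℕ) (z : ℂ) :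
    (Real.sqrt ((n : ℝ) + 1) : ℂ) * modeDisp m (n + 1) z =
      -conj z * modeDisp m n z + (Real.sqrt (m : ℝ) : ℂ) * modeDisp (m - 1) n z :=
  hermiteFun_succ_right m n z _

/-- `∂/∂z` of a displacement matrix element. -/
def modeDispDz (m n : ℕ) (z : ℂ) : ℂ :=
  ((Real.sqrt ((n : ℝ) + 1) : ℂ) * modeDisp m (n + 1) z +
    (Real.sqrt (m : ℝ) : ℂ) * modeDisp (m - 1) n z) / 2

/-- `∂/∂z^*` of a displacement matrix element. -/
def modeDispDzConj (m n : ℕ) (z : ℂ) : ℂ :=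
  -((Real.sqrt ((m : ℝ) + 1) : ℂ) * modeDisp (m + 1) n z +
    (Real.sqrt (n : ℝ) : ℂ) * modeDisp m (n - 1) z) / 2

lemma hasDerivAt_modeDisp {γ : ℝ → ℂ} {v : ℂ} {t : ℝ} (hγ : HasDerivAt γ v t) (m n : ℕ) :
    HasDerivAt (fun s => modeDisp m n (γ s))
      (modeDispDz m n (γ t) * v + modeDispDzConj m n (γ t) * conj v) t := by
  have h2 : HasDerivAt (fun s => -conj (γ s)) (-conj v) t := (HasDerivAt.star hγ).fun_neg
  refine (hasDerivAt_hermiteFun hγ h2 m n).congr_deriv ?_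
  simp only [modeDispDz, modeDispDzConj, modeDisp]
  ring

lemma contDiff_complexHermite {E : Type*} [NormedAddCommGroup E] [NormedSpace ℝ E] {N : ℕ∞}
    {f g : E → ℂ} (hf : ContDiff ℝ N f) (hg : ContDiff ℝ N g) (m n : ℕ) :
    ContDiff ℝ N fun z => complexHermite m n (f z) (g z) := by
  induction m generalizing n with
  | zero => exact hg.pow n
  | succ m ih => exact (hf.mul (ih n)).add (contDiff_const.mul (ih (n - 1)))

lemma contDiff_modeDisp (m n : ℕ) : ContDiff ℝ (⊤ : ℕ∞) (modeDisp m n) := by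
  have hc : ContDiff ℝ (⊤ : ℕ∞) fun z : ℂ => -conj z := Complex.conjCLE.contDiff.neg
  exact ((Complex.contDiff_exp.comp ((contDiff_id.mul hc).div_const 2)).mul
    (contDiff_complexHermite contDiff_id hc m n)).div_const _

lemma continuous_modeDisp (m n : ℕ) : Continuous (modeDisp m n) :=
  (contDiff_modeDisp m n).continuous

lemma norm_exp_neg_normSq (z : ℂ) :
    ‖Complex.exp (z * -conj z / 2)‖ = Real.exp (-(‖z‖ ^ 2) / 2) := by
  rw [Complex.norm_exp, mul_neg, Complex.mul_conj, Complex.normSq_eq_norm_sq]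
  congr 1
  have : (-((‖z‖ ^ 2 : ℝ) : ℂ) / 2) = ((-(‖z‖ ^ 2) / 2 : ℝ) : ℂ) := by push_cast; ring
  rw [this, Complex.ofReal_re]

lemma exists_norm_modeDisp_le (m n : ℕ) :
    ∃ C : ℝ, 0 ≤ C ∧ ∀ z, ‖modeDisp m n z‖ ≤ C * Real.exp (-(1 / 4) * ‖z‖ ^ 2) := by
  set a : ℝ := 1 + n with ha
  set D : ℝ := ‖(Real.sqrt (m.factorial : ℝ) : ℂ) * (Real.sqrt (n.factorial : ℝ) : ℂ)‖ with hD
  have hD0 : 0 < D := norm_pos_iff.mpr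
    (mul_ne_zero (sqrt_factorial_ne_zero m) (sqrt_factorial_ne_zero n))
  refine ⟨(m + n).factorial * Real.exp (a + 1) / D, by positivity, fun z => ?_⟩
  have h1 : ‖complexHermite m n z (-conj z)‖ ≤ (a + ‖z‖) ^ (m + n) := by
    refine (norm_complexHermite_le m n z _).trans ?_
    have hz : ‖-conj z‖ = ‖z‖ := by simp
    have hn : (0 : ℝ) ≤ n := Nat.cast_nonneg n
    rw [pow_add, hz]
    exact mul_le_mul (pow_le_pow_left₀ (by positivity) (by linarith) _)
      (pow_le_pow_left₀ (by positivity) (by linarith) _) (by positivity) (by positivity)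
  have h2 : (a + ‖z‖) ^ (m + n) ≤ (m + n).factorial * Real.exp (a + ‖z‖) := by
    have h := Real.pow_div_factorial_le_exp (x := a + ‖z‖) (by positivity) (m + n)
    have hf : (0 : ℝ) < (m + n).factorial := by exact_mod_cast (m + n).factorial_pos
    rw [div_le_iff₀ hf] at h
    linarith
  have h3 : Real.exp (-(‖z‖ ^ 2) / 2) * Real.exp (a + ‖z‖) ≤
      Real.exp (a + 1) * Real.exp (-(1 / 4) * ‖z‖ ^ 2) := by
    rw [← Real.exp_add, ← Real.exp_add]
    refine Real.exp_le_exp.mpr ?_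
    nlinarith [sq_nonneg (‖z‖ / 2 - 1)]
  rw [modeDisp, hermiteFun, norm_div, norm_mul, norm_exp_neg_normSq, ← hD, div_mul_eq_mul_div]
  refine div_le_div_of_nonneg_right ?_ hD0.le
  calc Real.exp (-(‖z‖ ^ 2) / 2) * ‖complexHermite m n z (-conj z)‖
      ≤ Real.exp (-(‖z‖ ^ 2) / 2) * ((m + n).factorial * Real.exp (a + ‖z‖)) :=
        mul_le_mul_of_nonneg_left (h1.trans h2) (Real.exp_pos _).le
    _ = (m + n).factorial * (Real.exp (-(‖z‖ ^ 2) / 2) * Real.exp (a + ‖z‖)) := by ring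
    _ ≤ (m + n).factorial * (Real.exp (a + 1) * Real.exp (-(1 / 4) * ‖z‖ ^ 2)) :=
        mul_le_mul_of_nonneg_left h3 (by positivity)
    _ = _ := by ring

lemma integrable_exp_neg_mul_norm_sq {b : ℝ} (hb : 0 < b) :
    Integrable fun z : ℂ => Real.exp (-b * ‖z‖ ^ 2) := by
  have := GaussianFourier.integrable_cexp_neg_mul_sq_norm_add (V := ℂ) (b := (b : ℂ))
    (by simpa using hb) 0 0
  refine this.re.congr (Eventually.of_forall fun z => ?_)
  simp only [zero_mul, add_zero, RCLike.re_eq_complex_re]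
  rw [show -(b : ℂ) * (‖z‖ : ℂ) ^ 2 = ((-b * ‖z‖ ^ 2 : ℝ) : ℂ) by push_cast; ring,
    ← Complex.ofReal_exp, Complex.ofReal_re]

lemma integrable_bdd_mul_modeDisp {g : ℂ → ℂ} (hg : Continuous g) {B : ℝ} (hB : ∀ z, ‖g z‖ ≤ B)
    (m n : ℕ) : Integrable fun z => g z * modeDisp m n z := by
  obtain ⟨C, hC0, hC⟩ := exists_norm_modeDisp_le m n
  refine Integrable.mono' ((integrable_exp_neg_mul_norm_sq (b := 1 / 4) (by norm_num)).const_mul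
    (B * C)) (hg.mul (continuous_modeDisp m n)).aestronglyMeasurable
    (Eventually.of_forall fun z => ?_)
  rw [norm_mul, mul_assoc]
  exact mul_le_mul (hB z) (hC z) (norm_nonneg _) ((norm_nonneg _).trans (hB z))

lemma norm_modeDisp_le (m n : ℕ) : ∃ C : ℝ, ∀ z, ‖modeDisp m n z‖ ≤ C := by
  obtain ⟨C, hC0, hC⟩ := exists_norm_modeDisp_le m n
  refine ⟨C, fun z => (hC z).trans (mul_le_of_le_one_right hC0 (Real.exp_le_one_iff.mpr ?_))⟩
  nlinarith [sq_nonneg ‖z‖]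

lemma integrable_modeDisp (m n : ℕ) : Integrable (modeDisp m n) := by
  simpa using integrable_bdd_mul_modeDisp (g := fun _ => 1) continuous_const (B := 1) (by simp) m n

lemma integrable_conj_modeDisp_mul (m n m' n' : ℕ) :
    Integrable fun z => conj (modeDisp m n z) * modeDisp m' n' z := by
  obtain ⟨C, hC⟩ := norm_modeDisp_le m n
  exact integrable_bdd_mul_modeDisp (Complex.continuous_conj.comp (continuous_modeDisp m n))
    (B := C) (by simpa using hC) m' n'

/-- A real-linear identity in `v` splits into its coefficients of `v` and `v^*`. -/
lemma eq_zero_of_forall_mul_add_conj_mul {a b : ℂ} (h : ∀ v : ℂ, v * a + conj v * b = 0) :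
    a = 0 ∧ b = 0 := by
  have h1 := h 1
  have h2 := h Complex.I
  simp only [map_one, Complex.conj_I] at h1 h2
  have h3 : a - b = 0 := by
    have : Complex.I * (a - b) = 0 := by linear_combination h2
    simpa using this
  exact ⟨by linear_combination (h1 + h3) / 2, by linear_combination (h1 - h3) / 2⟩

lemma hasLineDerivAt_modeDisp (m n : ℕ) (z v : ℂ) :
    HasLineDerivAt ℝ (modeDisp m n) (modeDispDz m n z * v + modeDispDzConj m n z * conj v) z v := by
  have hγ : HasDerivAt (fun t : ℝ => z + t • v) v 0 := by
    simpa using ((hasDerivAt_id (0 : ℝ)).smul_const v).const_add z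
  simpa [HasLineDerivAt] using hasDerivAt_modeDisp hγ m n

lemma integrable_bdd_mul_modeDispDz {g : ℂ → ℂ} (hg : Continuous g) {B : ℝ} (hB : ∀ z, ‖g z‖ ≤ B)
    (m n : ℕ) : Integrable fun z => g z * modeDispDz m n z := by
  have h := (((integrable_bdd_mul_modeDisp hg hB m (n + 1)).const_mul
    (Real.sqrt ((n : ℝ) + 1) : ℂ)).add ((integrable_bdd_mul_modeDisp hg hB (m - 1) n).const_mul
    (Real.sqrt (m : ℝ) : ℂ))).div_const 2
  refine h.congr (Eventually.of_forall fun z => ?_)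
  simp only [Pi.add_apply, modeDispDz]
  ring

lemma integrable_bdd_mul_modeDispDzConj {g : ℂ → ℂ} (hg : Continuous g) {B : ℝ}
    (hB : ∀ z, ‖g z‖ ≤ B) (m n : ℕ) : Integrable fun z => g z * modeDispDzConj m n z := by
  have h := ((((integrable_bdd_mul_modeDisp hg hB (m + 1) n).const_mul
    (Real.sqrt ((m : ℝ) + 1) : ℂ)).add ((integrable_bdd_mul_modeDisp hg hB m (n - 1)).const_mul
    (Real.sqrt (n : ℝ) : ℂ))).neg).div_const 2
  refine h.congr (Eventually.of_forall fun z => ?_)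
  simp only [Pi.add_apply, Pi.neg_apply, modeDispDzConj]
  ring

/-- The symplectic character `exp(z^* a - z a^*)`. -/
def character (a z : ℂ) : ℂ := Complex.exp (conj z * a - z * conj a)

lemma norm_character (a z : ℂ) : ‖character a z‖ = 1 := by
  rw [character, Complex.norm_exp]
  simp only [Complex.sub_re, Complex.mul_re, Complex.conj_re, Complex.conj_im]
  rw [Real.exp_eq_one_iff]
  ring

lemma continuous_character (a : ℂ) : Continuous (character a) :=
  Complex.continuous_exp.comp (by fun_prop)

lemma hasLineDerivAt_character (a z v : ℂ) :
    HasLineDerivAt ℝ (character a) (character a z * (conj v * a - v * conj a)) z v := by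
  have hγ : HasDerivAt (fun t : ℝ => z + t • v) v 0 := by
    simpa using ((hasDerivAt_id (0 : ℝ)).smul_const v).const_add z
  have hγ' : HasDerivAt (fun t : ℝ => conj (z + t • v)) (conj v) 0 := hγ.star
  have := (Complex.hasDerivAt_exp _).comp (0 : ℝ)
    ((hγ'.mul_const a).fun_sub (hγ.mul_const (conj a)))
  simpa [HasLineDerivAt, character, Function.comp_def] using this

/-- The symplectic Fourier transform of a displacement matrix element of one mode. -/
def modeFourier (m n : ℕ) (a : ℂ) : ℂ := ∫ z, character a z * modeDisp m n z

/-- The integration by parts `∫ (∂e/∂z) f = -∫ e (∂f/∂z)`, and its conjugate, for the character `e`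
turn multiplication by `a` and `a^*` into ladder operators. -/
lemma modeFourier_mul (m n : ℕ) (a : ℂ) :
    2 * a * modeFourier m n a = (Real.sqrt ((m : ℝ) + 1) : ℂ) * modeFourier (m + 1) n a +
        (Real.sqrt (n : ℝ) : ℂ) * modeFourier m (n - 1) a ∧
    2 * conj a * modeFourier m n a = (Real.sqrt ((n : ℝ) + 1) : ℂ) * modeFourier m (n + 1) a +
        (Real.sqrt (m : ℝ) : ℂ) * modeFourier (m - 1) n a := by
  have hI : ∀ m n, Integrable fun z => character a z * modeDisp m n z :=
    integrable_bdd_mul_modeDisp (continuous_character a) fun z => (norm_character a z).le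
  have hz := integrable_bdd_mul_modeDispDz (continuous_character a)
    (fun z => (norm_character a z).le) m n
  have hzc := integrable_bdd_mul_modeDispDzConj (continuous_character a)
    (fun z => (norm_character a z).le) m n
  have hez : ∫ z, character a z * modeDispDz m n z =
      ((Real.sqrt ((n : ℝ) + 1) : ℂ) * modeFourier m (n + 1) a +
        (Real.sqrt (m : ℝ) : ℂ) * modeFourier (m - 1) n a) / 2 := by
    simp only [modeFourier]
    rw [← integral_const_mul, ← integral_const_mul, ← integral_add ((hI _ _).const_mul _)
      ((hI _ _).const_mul _), ← integral_div]
    refine integral_congr_ae (Eventually.of_forall fun z => ?_)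
    simp only [modeDispDz]
    ring
  have hezc : ∫ z, character a z * modeDispDzConj m n z =
      -((Real.sqrt ((m : ℝ) + 1) : ℂ) * modeFourier (m + 1) n a +
        (Real.sqrt (n : ℝ) : ℂ) * modeFourier m (n - 1) a) / 2 := by
    simp only [modeFourier]
    rw [← integral_const_mul, ← integral_const_mul, ← integral_add ((hI _ _).const_mul _)
      ((hI _ _).const_mul _), ← integral_neg, ← integral_div]
    refine integral_congr_ae (Eventually.of_forall fun z => ?_)
    simp only [modeDispDzConj]
    ring
  have key : ∀ v : ℂ, v * ((∫ z, character a z * modeDispDz m n z) - conj a * modeFourier m n a) +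
      conj v * ((∫ z, character a z * modeDispDzConj m n z) + a * modeFourier m n a) = 0 := by
    intro v
    have h1 := (hI m n).const_mul (conj v * a - v * conj a)
    have h2 := hz.const_mul v
    have h3 := hzc.const_mul (conj v)
    have h12 := h1.add h2
    have h123 := h12.add h3
    have := integral_lineDeriv_eq_zero (v := v) (hI m n) h123 fun z => by
      refine ((hasLineDerivAt_character a z v).fun_mul
        (hasLineDerivAt_modeDisp m n z v)).congr_deriv ?_
      simp only [Pi.add_apply, zero_smul, add_zero]
      ring
    rw [integral_add' h12 h3, integral_add' h1 h2, integral_const_mul, integral_const_mul,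
      integral_const_mul] at this
    rw [modeFourier]
    linear_combination this
  obtain ⟨k1, k2⟩ := eq_zero_of_forall_mul_add_conj_mul key
  rw [hez] at k1
  rw [hezc] at k2
  exact ⟨by linear_combination (2 : ℂ) * k2, by linear_combination (-2 : ℂ) * k1⟩

lemma modeFourier_zero_zero (a : ℂ) :
    modeFourier 0 0 a = 2 * Real.pi * Complex.exp (-2 * (a * conj a)) := by
  have h := GaussianFourier.integral_cexp_neg_mul_sq_norm_add (V := ℂ) (b := 1 / 2)
    (by norm_num) Complex.I (-2 * Complex.I * a)
  have hfun : ∀ z, character a z * modeDisp 0 0 z = Complex.exp (-(1 / 2) * (‖z‖ : ℂ) ^ 2 +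
      Complex.I * ((inner ℝ (-2 * Complex.I * a) z : ℝ) : ℂ)) := by
    intro z
    have h1 : modeDisp 0 0 z = Complex.exp (-(1 / 2) * (‖z‖ : ℂ) ^ 2) := by
      simp only [modeDisp, hermiteFun, complexHermite, pow_zero, Nat.factorial_zero, Nat.cast_one,
        Real.sqrt_one, Complex.ofReal_one, mul_one, div_one, ← Complex.mul_conj']
      congr 1
      ring
    have h2 : Complex.I * ((inner ℝ (-2 * Complex.I * a) z : ℝ) : ℂ) = conj z * a - z * conj a := by
      rw [Complex.inner, Complex.re_eq_add_conj]
      simp only [map_mul, map_neg, map_ofNat, Complex.conj_I, Complex.conj_conj]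
      linear_combination (-(z * conj a) + a * conj z) * (-Complex.I_sq)
    rw [h1, character, ← Complex.exp_add, h2, add_comm]
  rw [modeFourier]
  simp only [hfun]
  rw [h]
  have hn : ((‖-2 * Complex.I * a‖ : ℝ) : ℂ) ^ 2 = 4 * (a * conj a) := by
    rw [← Complex.mul_conj']
    simp only [map_mul, map_neg, map_ofNat, Complex.conj_I]
    linear_combination (-4 * (a * conj a)) * Complex.I_sq
  rw [hn, Complex.finrank_real_complex]
  have h22 : ((2 : ℕ) : ℂ) / 2 = 1 := by norm_num
  rw [h22, Complex.cpow_one, Complex.I_sq]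
  congr 1
  · ring
  · congr 1
    ring

/-- Displacement matrix elements are eigenfunctions of the symplectic Fourier transform, up to a
rescaling: the parity operator is proportional to the integral of all displacements. -/
theorem modeFourier_eq (m n : ℕ) (a : ℂ) :
    modeFourier m n a = 2 * Real.pi * (-1) ^ n * modeDisp m n (2 * a) := by
  induction m generalizing n with
  | zero =>
    induction n with
    | zero =>
      rw [modeFourier_zero_zero]
      simp only [modeDisp, hermiteFun, complexHermite, pow_zero, Nat.factorial_zero, Nat.cast_one,
        Real.sqrt_one, Complex.ofReal_one, mul_one, div_one, map_mul, map_ofNat]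
      congr 2
      ring
    | succ n ih =>
      have h1 := (modeFourier_mul 0 n a).2
      have h2 := modeDisp_succ_right 0 n (2 * a)
      have h3 := sqrt_succ_ne_zero n
      simp only [Nat.cast_zero, Real.sqrt_zero, Complex.ofReal_zero, zero_mul, add_zero, map_mul,
        map_ofNat] at h1 h2
      refine mul_left_cancel₀ h3 ?_
      rw [ih] at h1
      rw [pow_succ]
      linear_combination -h1 + (2 * Real.pi * (-1) ^ n) * h2
  | succ m ih =>
    have h1 := (modeFourier_mul m n a).1
    have h2 := modeDisp_succ_left m n (2 * a)
    have h3 := sqrt_succ_ne_zero m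
    refine mul_left_cancel₀ h3 ?_
    rw [ih, ih] at h1
    cases n with
    | zero =>
      simp only [Nat.cast_zero, Real.sqrt_zero, Complex.ofReal_zero, zero_mul, add_zero] at h1 h2
      linear_combination -h1 - (2 * Real.pi * (-1) ^ 0) * h2
    | succ n =>
      rw [Nat.add_sub_cancel] at h1 h2
      rw [pow_succ] at h1 ⊢
      linear_combination -h1 + (2 * Real.pi * (-1) ^ n) * h2

/-- The inner product in `L²(ℂ)` of two displacement matrix elements of one mode. -/
def modeInner (m n m' n' : ℕ) : ℂ := ∫ z, conj (modeDisp m n z) * modeDisp m' n' z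

lemma conj_modeInner (m n m' n' : ℕ) : conj (modeInner m n m' n') = modeInner m' n' m n := by
  rw [modeInner, ← integral_conj, modeInner]
  refine integral_congr_ae (Eventually.of_forall fun z => ?_)
  simp only [map_mul, Complex.conj_conj]
  ring

/-- Raising an index on one side is the adjoint of lowering it on the other: the sum and the
difference of the integration by parts `⟨f, ∂g/∂z^*⟩ = -⟨∂f/∂z, g⟩` and of
`⟨f, z g⟩ = ⟨z^* f, g⟩`. -/
lemma modeInner_ladder (m n m' n' : ℕ) :
    (Real.sqrt ((m' : ℝ) + 1) : ℂ) * modeInner m n (m' + 1) n' =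
        (Real.sqrt (m : ℝ) : ℂ) * modeInner (m - 1) n m' n' ∧
      (Real.sqrt ((n : ℝ) + 1) : ℂ) * modeInner m (n + 1) m' n' =
        (Real.sqrt (n' : ℝ) : ℂ) * modeInner m n m' (n' - 1) := by
  have hI := integrable_conj_modeDisp_mul
  have hcont : ∀ m n, Continuous fun z => conj (modeDisp m n z) := fun m n =>
    Complex.continuous_conj.comp (continuous_modeDisp m n)
  have hbdd : ∀ m n, ∃ C : ℝ, ∀ z, ‖conj (modeDisp m n z)‖ ≤ C := fun m n => by
    simpa using norm_modeDisp_le m n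
  -- the multiplication identity
  have hmul : (Real.sqrt ((m' : ℝ) + 1) : ℂ) * modeInner m n (m' + 1) n' -
      (Real.sqrt (n' : ℝ) : ℂ) * modeInner m n m' (n' - 1) =
      (Real.sqrt (m : ℝ) : ℂ) * modeInner (m - 1) n m' n' -
      (Real.sqrt ((n : ℝ) + 1) : ℂ) * modeInner m (n + 1) m' n' := by
    simp only [modeInner]
    rw [← integral_const_mul, ← integral_const_mul, ← integral_const_mul, ← integral_const_mul,
      ← integral_sub ((hI _ _ _ _).const_mul _) ((hI _ _ _ _).const_mul _),
      ← integral_sub ((hI _ _ _ _).const_mul _) ((hI _ _ _ _).const_mul _)]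
    refine integral_congr_ae (Eventually.of_forall fun z => ?_)
    have h1 := modeDisp_succ_left m' n' z
    have h2 := congrArg conj (modeDisp_succ_right m n z)
    simp only [map_mul, map_add, map_neg, Complex.conj_conj, Complex.conj_ofReal] at h2
    linear_combination conj (modeDisp m n z) * h1 + modeDisp m' n' z * h2
  -- the integration by parts
  have hparts : (Real.sqrt ((m' : ℝ) + 1) : ℂ) * modeInner m n (m' + 1) n' +
      (Real.sqrt (n' : ℝ) : ℂ) * modeInner m n m' (n' - 1) =
      (Real.sqrt (m : ℝ) : ℂ) * modeInner (m - 1) n m' n' +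
      (Real.sqrt ((n : ℝ) + 1) : ℂ) * modeInner m (n + 1) m' n' := by
    obtain ⟨C, hC⟩ := hbdd m n
    obtain ⟨C', hC'⟩ := norm_modeDisp_le m' n'
    have i1 := integrable_bdd_mul_modeDispDz (hcont m n) hC m' n'
    have i2 := integrable_bdd_mul_modeDispDzConj (hcont m n) hC m' n'
    have i3 : Integrable fun z => modeDisp m' n' z * conj (modeDispDz m n z) := by
      have := Complex.conjCLE.toContinuousLinearMap.integrable_comp
        (integrable_bdd_mul_modeDispDz (hcont m' n') (B := C') (by simpa using hC') m n)
      simpa using this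
    have i4 : Integrable fun z => modeDisp m' n' z * conj (modeDispDzConj m n z) := by
      have := Complex.conjCLE.toContinuousLinearMap.integrable_comp
        (integrable_bdd_mul_modeDispDzConj (hcont m' n') (B := C') (by simpa using hC') m n)
      simpa using this
    have key : ∀ v : ℂ, v * ((∫ z, conj (modeDisp m n z) * modeDispDz m' n' z) +
        ∫ z, modeDisp m' n' z * conj (modeDispDzConj m n z)) +
        conj v * ((∫ z, conj (modeDisp m n z) * modeDispDzConj m' n' z) +
        ∫ z, modeDisp m' n' z * conj (modeDispDz m n z)) = 0 := by
      intro v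
      have j1 := i1.const_mul v
      have j2 := i4.const_mul v
      have j3 := i2.const_mul (conj v)
      have j4 := i3.const_mul (conj v)
      have j12 := j1.add j2
      have j34 := j3.add j4
      have := integral_lineDeriv_eq_zero (v := v) (hI m n m' n') (j12.add j34) fun z => by
        have hd : HasDerivAt (fun t : ℝ => conj (modeDisp m n (z + t • v)))
          (conj (modeDispDz m n z * v + modeDispDzConj m n z * conj v)) 0 :=
          HasDerivAt.star (hasLineDerivAt_modeDisp m n z v)
        refine (hd.fun_mul (hasLineDerivAt_modeDisp m' n' z v)).congr_deriv ?_
        simp only [Pi.add_apply, zero_smul, add_zero, map_add, map_mul, Complex.conj_conj]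
        ring
      rw [integral_add' j12 j34, integral_add' j1 j2, integral_add' j3 j4, integral_const_mul,
        integral_const_mul, integral_const_mul, integral_const_mul] at this
      linear_combination this
    have k := (eq_zero_of_forall_mul_add_conj_mul key).2
    have e1 : ∫ z, conj (modeDisp m n z) * modeDispDzConj m' n' z =
        -((Real.sqrt ((m' : ℝ) + 1) : ℂ) * modeInner m n (m' + 1) n' +
          (Real.sqrt (n' : ℝ) : ℂ) * modeInner m n m' (n' - 1)) / 2 := by
      simp only [modeInner]
      rw [← integral_const_mul, ← integral_const_mul, ← integral_add ((hI _ _ _ _).const_mul _)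
        ((hI _ _ _ _).const_mul _), ← integral_neg, ← integral_div]
      refine integral_congr_ae (Eventually.of_forall fun z => ?_)
      simp only [modeDispDzConj]
      ring
    have e2 : ∫ z, modeDisp m' n' z * conj (modeDispDz m n z) =
        ((Real.sqrt ((n : ℝ) + 1) : ℂ) * modeInner m (n + 1) m' n' +
          (Real.sqrt (m : ℝ) : ℂ) * modeInner (m - 1) n m' n') / 2 := by
      simp only [modeInner]
      rw [← integral_const_mul, ← integral_const_mul, ← integral_add ((hI _ _ _ _).const_mul _)
        ((hI _ _ _ _).const_mul _), ← integral_div]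
      refine integral_congr_ae (Eventually.of_forall fun z => ?_)
      simp only [modeDispDz, map_div₀, map_add, map_mul, Complex.conj_ofReal, map_ofNat]
      ring
    rw [e1, e2] at k
    linear_combination (-2 : ℂ) * k
  exact ⟨by linear_combination (hmul + hparts) / 2, by linear_combination (hmul - hparts) / 2⟩

lemma modeInner_zero : modeInner 0 0 0 0 = Real.pi := by
  have h := GaussianFourier.integral_cexp_neg_mul_sq_norm (V := ℂ) (b := 1) (by simp)
  rw [Complex.finrank_real_complex, show ((2 : ℕ) : ℂ) / 2 = 1 by norm_num, Complex.cpow_one,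
    div_one] at h
  rw [← h, modeInner]
  refine integral_congr_ae (Eventually.of_forall fun z => ?_)
  simp only [modeDisp, hermiteFun, complexHermite, pow_zero, Nat.factorial_zero, Nat.cast_one,
    Real.sqrt_one, Complex.ofReal_one, mul_one, div_one, ← Complex.mul_conj', ← Complex.exp_conj]
  rw [← Complex.exp_add]
  congr 1
  simp only [map_div₀, map_mul, map_neg, Complex.conj_conj, map_ofNat]
  ring

/-- Displacement matrix elements of one mode are orthogonal in `L²(ℂ)`. -/
theorem modeInner_eq (m n m' n' : ℕ) :
    modeInner m n m' n' = if m = m' ∧ n = n' then (Real.pi : ℂ) else 0 := by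
  have raise : ∀ m n m' n' : ℕ, (Real.sqrt ((m : ℝ) + 1) : ℂ) * modeInner (m + 1) n m' n' =
      (Real.sqrt (m' : ℝ) : ℂ) * modeInner m n (m' - 1) n' := by
    intro m n m' n'
    have := congrArg conj (modeInner_ladder m' n' m n).1
    simpa only [map_mul, Complex.conj_ofReal, conj_modeInner] using this
  have raise' : ∀ m n m' n' : ℕ, (Real.sqrt ((n' : ℝ) + 1) : ℂ) * modeInner m n m' (n' + 1) =
      (Real.sqrt (n : ℝ) : ℂ) * modeInner m (n - 1) m' n' := by
    intro m n m' n'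
    have := congrArg conj (modeInner_ladder m' n' m n).2
    simpa only [map_mul, Complex.conj_ofReal, conj_modeInner] using this
  induction m generalizing m' with
  | zero =>
    cases m' with
    | zero =>
      induction n generalizing n' with
      | zero =>
        cases n' with
        | zero => simpa using modeInner_zero
        | succ n' =>
          have := raise' 0 0 0 n'
          rw [Nat.cast_zero, Real.sqrt_zero, Complex.ofReal_zero, zero_mul] at this
          simpa using (mul_eq_zero.mp this).resolve_left (sqrt_succ_ne_zero _)
      | succ n ih =>
        refine mul_left_cancel₀ (sqrt_succ_ne_zero n) ?_
        rw [(modeInner_ladder 0 n 0 n').2, ih]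
        cases n' with
        | zero => simp
        | succ n' =>
          by_cases h : n = n'
          · simp [h]
          · simp [h]
    | succ m' =>
      have := (modeInner_ladder 0 n m' n').1
      rw [Nat.cast_zero, Real.sqrt_zero, Complex.ofReal_zero, zero_mul] at this
      simpa using (mul_eq_zero.mp this).resolve_left (sqrt_succ_ne_zero _)
  | succ m ih =>
    refine mul_left_cancel₀ (sqrt_succ_ne_zero m) ?_
    rw [raise, ih]
    cases m' with
    | zero => simp
    | succ m' =>
      by_cases h : m = m'
      · simp [h]
      · simp [h]

/-! ### Several modes -/

/-- The product over all modes of functions `k m n` of one amplitude, where `m`, `n` are the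
occupation numbers of the mode in `μ`, `ν`. -/
def modeProd {J : Type*} {M : J → Type*} [Fintype J] [∀ j, Fintype (M j)] (k : ℕ → ℕ → ℂ → ℂ)
    (μ ν : Occ M) (α : Amp M) : ℂ := ∏ i, k (μ i) (ν i) (α i)

open Classical in
lemma add_single_of_ne {J : Type*} {M : J → Type*} {A : Type*} [AddZeroClass A]
    (f : Modes M → A) (i : Modes M) (a : A) {l : Modes M} (h : l ≠ i) :
    (f + Pi.single i a : Modes M → A) l = f l := by
  simp [h]

open Classical in
lemma sub_single_of_ne {J : Type*} {M : J → Type*} (f : Occ M) (i : Modes M) (a : ℕ)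
    {l : Modes M} (h : l ≠ i) :
    (f - Pi.single i a : Occ M) l = f l := by
  simp [h]

open Classical in
lemma add_single_same {J : Type*} {M : J → Type*} {A : Type*} [AddZeroClass A]
    (f : Modes M → A) (i : Modes M) (a : A) :
    (f + Pi.single i a : Modes M → A) i = f i + a := by
  simp

open Classical in
lemma sub_single_same {J : Type*} {M : J → Type*} (f : Occ M) (i : Modes M) (a : ℕ) :
    (f - Pi.single i a : Occ M) i = f i - a := by
  simp

section Modes

variable {J : Type*} {M : J → Type*} [Fintype J] [∀ j, Fintype (M j)]

open Classical in
/-- A product over all modes with the mode `i` left out. -/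
def modeProdErase (k : ℕ → ℕ → ℂ → ℂ) (i : Modes M) (μ ν : Occ M) (α : Amp M) : ℂ :=
  ∏ l ∈ Finset.univ.erase i, k (μ l) (ν l) (α l)

lemma modeProd_eq_mul_erase (k : ℕ → ℕ → ℂ → ℂ) (i : Modes M) {μ ν μ' ν' : Occ M} {α α' : Amp M}
    (hμ : ∀ l, l ≠ i → μ' l = μ l) (hν : ∀ l, l ≠ i → ν' l = ν l) (hα : ∀ l, l ≠ i → α' l = α l) :
    modeProd k μ' ν' α' = k (μ' i) (ν' i) (α' i) * modeProdErase k i μ ν α := by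
  classical
  rw [modeProd, modeProdErase, ← Finset.mul_prod_erase Finset.univ _ (Finset.mem_univ i)]
  congr 1
  refine Finset.prod_congr (by congr) fun l hl => ?_
  have hl' := Finset.ne_of_mem_erase hl
  rw [hμ l hl', hν l hl', hα l hl']

lemma modeProd_self (k : ℕ → ℕ → ℂ → ℂ) (i : Modes M) (μ ν : Occ M) (α : Amp M) :
    modeProd k μ ν α = k (μ i) (ν i) (α i) * modeProdErase k i μ ν α :=
  modeProd_eq_mul_erase k i (fun _ _ => rfl) (fun _ _ => rfl) fun _ _ => rfl

open Classical in
lemma modeProd_add_left (k : ℕ → ℕ → ℂ → ℂ) (i : Modes M) (μ ν : Occ M) (α : Amp M) :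
    modeProd k (μ + Pi.single i 1) ν α =
      k (μ i + 1) (ν i) (α i) * modeProdErase k i μ ν α := by
  rw [modeProd_eq_mul_erase k i (fun _ h => add_single_of_ne μ i 1 h) (fun _ _ => rfl)
    fun _ _ => rfl, add_single_same]

open Classical in
lemma modeProd_add_right (k : ℕ → ℕ → ℂ → ℂ) (i : Modes M) (μ ν : Occ M) (α : Amp M) :
    modeProd k μ (ν + Pi.single i 1) α =
      k (μ i) (ν i + 1) (α i) * modeProdErase k i μ ν α := by
  rw [modeProd_eq_mul_erase k i (fun _ _ => rfl) (fun _ h => add_single_of_ne ν i 1 h)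
    fun _ _ => rfl, add_single_same]

open Classical in
lemma modeProd_sub_left (k : ℕ → ℕ → ℂ → ℂ) (i : Modes M) (μ ν : Occ M) (α : Amp M) :
    modeProd k (μ - Pi.single i 1) ν α =
      k (μ i - 1) (ν i) (α i) * modeProdErase k i μ ν α := by
  rw [modeProd_eq_mul_erase k i (fun _ h => sub_single_of_ne μ i 1 h) (fun _ _ => rfl)
    fun _ _ => rfl, sub_single_same]

open Classical in
lemma modeProd_sub_right (k : ℕ → ℕ → ℂ → ℂ) (i : Modes M) (μ ν : Occ M) (α : Amp M) :
    modeProd k μ (ν - Pi.single i 1) α =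
      k (μ i) (ν i - 1) (α i) * modeProdErase k i μ ν α := by
  rw [modeProd_eq_mul_erase k i (fun _ _ => rfl) (fun _ h => sub_single_of_ne ν i 1 h)
    fun _ _ => rfl, sub_single_same]

end Modes

/-! ### Orthonormal modes -/

open Classical in
/-- The modes of each component are orthonormal in `L²(R)`, all the integrals being convergent. -/
structure IsOrthonormalModes {d : ℕ} {J : Type*} {M : J → Type*}
    (R : Set (EuclideanSpace ℝ (Fin d))) (φ : ∀ j, M j → EuclideanSpace ℝ (Fin d) → ℂ) :
    Prop where
  integrable : ∀ j, ∀ n m : M j, IntegrableOn (fun x => φ j n x * conj (φ j m x)) R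
  integral : ∀ j, ∀ n m : M j,
    ∫ x in R, φ j n x * conj (φ j m x) = if n = m then (1 : ℂ) else 0

/-- The off-diagonal products are integrable because the diagonal integrals are not zero, which
they would be by convention if they diverged. -/
lemma isOrthonormalModes {d : ℕ} {J : Type*} {M : J → Type*}
    {R : Set (EuclideanSpace ℝ (Fin d))} (hR : IsOpen R)
    {φ : ∀ j, M j → EuclideanSpace ℝ (Fin d) → ℂ} (hcont : ∀ j n, ContinuousOn (φ j n) R)
    (horth : ∀ j, ∀ n m : M j, n ≠ m → ∫ x in R, conj (φ j n x) * φ j m x = 0)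
    (hnorm : ∀ j, ∀ n : M j, ∫ x in R, conj (φ j n x) * φ j n x = 1) :
    IsOrthonormalModes R φ := by
  have hmeas : ∀ j n, AEStronglyMeasurable (φ j n) (volume.restrict R) := fun j n =>
    (hcont j n).aestronglyMeasurable hR.measurableSet
  have hL2 : ∀ j n, MemLp (φ j n) 2 (volume.restrict R) := fun j n => by
    rw [memLp_two_iff_integrable_sq_norm (hmeas j n)]
    have hi : IntegrableOn (fun x => conj (φ j n x) * φ j n x) R :=
      not_imp_comm.mp integral_undef (by rw [hnorm]; exact one_ne_zero)
    refine hi.norm.congr (Eventually.of_forall fun x => ?_)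
    simp only [norm_mul, RCLike.norm_conj]
    ring
  refine ⟨fun j n m => ?_, fun j n m => ?_⟩
  · have := (hL2 j m).star.integrable_mul (hL2 j n) (p := 2) (q := 2)
    refine Integrable.congr this (Eventually.of_forall fun x => ?_)
    simp [mul_comm]
  · have : ∀ x, φ j n x * conj (φ j m x) = conj (φ j m x) * φ j n x := fun x => mul_comm _ _
    simp only [this]
    by_cases h : n = m
    · subst h
      simpa using hnorm j n
    · rw [horth j m n (Ne.symm h), if_neg h]

section Displacement

variable {d : ℕ} {J : Type*} {M : J → Type*} [∀ j, Fintype (M j)]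
  {R : Set (EuclideanSpace ℝ (Fin d))} {φ : ∀ j, M j → EuclideanSpace ℝ (Fin d) → ℂ}

lemma compose_mul_conj_compose (j : J) (a b : Amp M) (x : EuclideanSpace ℝ (Fin d)) :
    compose φ j a x * conj (compose φ j b x) =
      ∑ n, ∑ m, a ⟨j, n⟩ * conj (b ⟨j, m⟩) * (φ j n x * conj (φ j m x)) := by
  simp only [compose, map_sum, map_mul]
  rw [Finset.sum_mul_sum]
  exact Finset.sum_congr rfl fun n _ => Finset.sum_congr rfl fun m _ => by ring

lemma IsOrthonormalModes.integrable_compose (h : IsOrthonormalModes R φ) (j : J) (a b : Amp M) :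
    IntegrableOn (fun x => compose φ j a x * conj (compose φ j b x)) R := by
  simp only [compose_mul_conj_compose]
  exact integrable_finsetSum _ fun n _ => integrable_finsetSum _ fun m _ =>
    (h.integrable j n m).const_mul _

lemma IsOrthonormalModes.integral_compose (h : IsOrthonormalModes R φ) (j : J) (a b : Amp M) :
    ∫ x in R, compose φ j a x * conj (compose φ j b x) = ∑ n, a ⟨j, n⟩ * conj (b ⟨j, n⟩) := by
  classical
  simp only [compose_mul_conj_compose]
  rw [integral_finsetSum _ fun n _ => integrable_finsetSum _ fun m _ =>
    (h.integrable j n m).const_mul _]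
  refine Finset.sum_congr rfl fun n _ => ?_
  rw [integral_finsetSum _ fun m _ => (h.integrable j n m).const_mul _]
  simp only [integral_const_mul, h.integral]
  rw [Finset.sum_eq_single n]
  · simp
  · intro m _ hm
    simp [Ne.symm hm]
  · simp

variable [Fintype J]

lemma IsOrthonormalModes.displacementGenerator_apply (h : IsOrthonormalModes R φ) (lam : Amp M)
    (v : NumSeq M) (μ : Occ M) : displacementGenerator R φ lam v μ =
      ∑ i, (lam i * create i v μ - conj (lam i) * annihilate i v μ) := by
  set a : Amp M := fun i => conj (create i v μ) with ha
  set b : Amp M := fun i => annihilate i v μ with hb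
  have h1 : ∀ j x, fieldOpDagger φ j x v μ = conj (compose φ j a x) := fun j x => by
    simp [fieldOpDagger, compose, ha]
  have h2 : ∀ j x, fieldOp φ j x v μ = compose φ j b x := fun j x => by
    simp [fieldOp, compose, hb]
  simp only [displacementGenerator, h1, h2]
  have hi1 := fun j => h.integrable_compose j lam a
  have hi2 : ∀ j, IntegrableOn (fun x => conj (compose φ j lam x) * compose φ j b x) R :=
      fun j => by
    simpa only [mul_comm] using h.integrable_compose j b lam
  have hi3 : ∀ j, ∫ x in R, conj (compose φ j lam x) * compose φ j b x =
      ∑ n, b ⟨j, n⟩ * conj (lam ⟨j, n⟩) := fun j => by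
    rw [← h.integral_compose j b lam]
    simp only [mul_comm]
  have hi12 : ∀ j, IntegrableOn (fun x => compose φ j lam x * conj (compose φ j a x) -
      conj (compose φ j lam x) * compose φ j b x) R := fun j => (hi1 j).sub (hi2 j)
  rw [integral_finsetSum _ fun j _ => hi12 j, Fintype.sum_sigma]
  refine Finset.sum_congr rfl fun j _ => ?_
  rw [integral_sub (hi1 j) (hi2 j), h.integral_compose, hi3, ← Finset.sum_sub_distrib]
  refine Finset.sum_congr rfl fun n _ => ?_
  simp only [ha, hb, Complex.conj_conj]
  ring

lemma IsOrthonormalModes.displacementFunctional_eq (h : IsOrthonormalModes R φ) (lam α : Amp M) :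
    displacementFunctional R φ lam α = ∏ i, character (α i) (lam i) := by
  rw [displacementFunctional, Fintype.prod_sigma]
  refine Finset.prod_congr rfl fun j _ => ?_
  simp only [character, ← Complex.exp_sum]
  congr 1
  have hi1 := h.integrable_compose j lam α
  have hi2 : IntegrableOn (fun x => conj (compose φ j lam x) * compose φ j α x) R := by
    simpa only [mul_comm] using h.integrable_compose j α lam
  have hi3 : ∫ x in R, conj (compose φ j lam x) * compose φ j α x =
      ∑ n, α ⟨j, n⟩ * conj (lam ⟨j, n⟩) := by
    rw [← h.integral_compose j α lam]
    simp only [mul_comm]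
  have : ∀ x, -(compose φ j lam x) * conj (compose φ j α x) + conj (compose φ j lam x) *
      compose φ j α x = conj (compose φ j lam x) * compose φ j α x -
      compose φ j lam x * conj (compose φ j α x) := fun x => by ring
  simp only [this]
  rw [integral_sub hi2 hi1, hi3, h.integral_compose, ← Finset.sum_sub_distrib]
  exact Finset.sum_congr rfl fun n _ => by ring

/-- A curve in the sequences of number coefficients that solves `v' = G v` has the iterates of the
generator as its derivatives. -/
lemma IsOrthonormalModes.iteratedDeriv_eq (h : IsOrthonormalModes R φ) (lam : Amp M) (k : ℕ)
    (v : ℂ → NumSeq M)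
    (hv : ∀ t μ, HasDerivAt (fun s => v s μ) (displacementGenerator R φ lam (v t) μ) t)
    (μ : Occ M) (t : ℂ) :
    iteratedDeriv k (fun s => v s μ) t = ((displacementGenerator R φ lam)^[k] (v t)) μ := by
  induction k generalizing v with
  | zero => simp
  | succ k ih =>
    rw [iteratedDeriv_succ', Function.iterate_succ_apply]
    have hd : deriv (fun s => v s μ) = fun s => displacementGenerator R φ lam (v s) μ :=
      funext fun s => (hv s μ).deriv
    rw [hd]
    refine ih (fun s => displacementGenerator R φ lam (v s)) fun s κ => ?_
    have hG : (fun s => displacementGenerator R φ lam (v s) κ) = fun s =>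
        ∑ i, (lam i * create i (v s) κ - conj (lam i) * annihilate i (v s) κ) :=
      funext fun s => h.displacementGenerator_apply lam (v s) κ
    rw [hG, h.displacementGenerator_apply]
    refine HasDerivAt.fun_sum fun i _ => HasDerivAt.fun_sub ?_ ?_
    · exact ((hv s _).const_mul _).const_mul _
    · exact ((hv s _).const_mul _).const_mul _

lemma complexHermite_zero_zero (m n : ℕ) :
    complexHermite m n 0 0 = if m = n then (n.factorial : ℂ) else 0 := by
  induction m generalizing n with
  | zero => cases n <;> simp [complexHermite]
  | succ m ih =>
    rw [complexHermite_succ_left]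
    cases n with
    | zero => simp
    | succ n =>
      rw [Nat.add_sub_cancel, zero_mul, zero_add, ih]
      by_cases hmn : m = n
      · simp [hmn, Nat.factorial_succ]
      · simp [hmn]

lemma hermiteFun_zero_zero (m n : ℕ) : hermiteFun m n 0 0 = if m = n then (1 : ℂ) else 0 := by
  rw [hermiteFun, complexHermite_zero_zero]
  by_cases hmn : m = n
  · subst hmn
    have h1 : (Real.sqrt (m.factorial : ℝ) : ℂ) * (Real.sqrt (m.factorial : ℝ) : ℂ) =
        m.factorial := by
      rw [← Complex.ofReal_mul, Real.mul_self_sqrt (by positivity)]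
      simp
    have h2 : (m.factorial : ℂ) ≠ 0 := by exact_mod_cast m.factorial_ne_zero
    rw [h1]
    simp [h2]
  · simp [hmn]

/-- The matrix of the displacement operator, in closed form: along the ray `t ↦ tΛ` the closed form
is entire in `t` and solves the equation of the exponential, so that its Taylor series at `0` is the
exponential series. -/
theorem IsOrthonormalModes.displacementOp_eq (h : IsOrthonormalModes R φ) (lam : Amp M)
    (μ ν : Occ M) : displacementOp R φ lam μ ν = modeProd modeDisp μ ν lam := by
  classical
  set v : ℂ → NumSeq M := fun t κ =>
    ∏ i, hermiteFun (κ i) (ν i) (t * lam i) (t * -conj (lam i)) with hvdef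
  have hv : ∀ t κ, HasDerivAt (fun s => v s κ) (displacementGenerator R φ lam (v t) κ) t := by
    intro t κ
    have h1 := fun i => hasDerivAt_hermiteFun ((hasDerivAt_id t).mul_const (lam i))
      ((hasDerivAt_id t).mul_const (-conj (lam i))) (κ i) (ν i)
    refine (HasDerivAt.fun_finsetProd fun i (_ : i ∈ Finset.univ) => h1 i).congr_deriv ?_
    rw [h.displacementGenerator_apply]
    refine Finset.sum_congr rfl fun i _ => ?_
    -- ladder operators of the mode `i` change only the factor of that mode
    have hc : create i (v t) κ = (Real.sqrt (κ i : ℝ) : ℂ) *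
        (hermiteFun (κ i - 1) (ν i) (t * lam i) (t * -conj (lam i)) *
        ∏ l ∈ Finset.univ.erase i, hermiteFun (κ l) (ν l) (t * lam l) (t * -conj (lam l))) := by
      rw [create, hvdef]
      simp only
      rw [← Finset.mul_prod_erase Finset.univ _ (Finset.mem_univ i)]
      congr 2
      · simp
      · refine Finset.prod_congr rfl fun l hl => ?_
        simp [Finset.ne_of_mem_erase hl]
    have ha : annihilate i (v t) κ = (Real.sqrt ((κ i : ℝ) + 1) : ℂ) *
        (hermiteFun (κ i + 1) (ν i) (t * lam i) (t * -conj (lam i)) *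
        ∏ l ∈ Finset.univ.erase i, hermiteFun (κ l) (ν l) (t * lam l) (t * -conj (lam l))) := by
      rw [annihilate, hvdef]
      simp only
      rw [← Finset.mul_prod_erase Finset.univ _ (Finset.mem_univ i)]
      congr 2
      · simp
      · refine Finset.prod_congr rfl fun l hl => ?_
        simp [Finset.ne_of_mem_erase hl]
    rw [hc, ha]
    have hl := hermiteFun_succ_left (κ i) (ν i) (t * lam i) (t * -conj (lam i))
    have hr := hermiteFun_succ_right (κ i) (ν i) (t * lam i) (t * -conj (lam i))
    simp only [smul_eq_mul, id, one_mul]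
    linear_combination (∏ l ∈ Finset.univ.erase i, hermiteFun (κ l) (ν l) (t * lam l)
      (t * -conj (lam l))) * (lam i * hr / 2 + conj (lam i) * hl / 2)
  have hdiff : Differentiable ℂ fun t => v t μ := fun t => (hv t μ).differentiableAt
  have h0 : v 0 = numState ν := by
    ext κ
    simp only [hvdef, zero_mul, hermiteFun_zero_zero, numState, Pi.single_apply]
    rw [Finset.prod_ite_zero]
    simp [funext_iff]
  have ht := Complex.taylorSeries_eq_of_entire' 0 1 hdiff
  rw [displacementOp, modeProd]
  have h1 : v 1 μ = ∏ i, modeDisp (μ i) (ν i) (lam i) := by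
    simp [hvdef, modeDisp]
  rw [← h1, ← ht]
  refine tsum_congr fun k => ?_
  rw [h.iteratedDeriv_eq lam k v hv, h0]
  simp

end Displacement

/-! ### Wigner functions of the matrix units -/

/-- The Wigner function of the matrix unit `|m⟩⟨n|` of one mode. -/
def modeWigner (m n : ℕ) (z : ℂ) : ℂ := 2 / Real.pi * (-1) ^ m * modeDisp n m (2 * z)

/-- `∂/∂z` of `modeWigner`. -/
def modeWignerDz (m n : ℕ) (z : ℂ) : ℂ := 2 / Real.pi * (-1) ^ m * (2 * modeDispDz n m (2 * z))

/-- `∂/∂z^*` of `modeWigner`. -/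
def modeWignerDzConj (m n : ℕ) (z : ℂ) : ℂ :=
  2 / Real.pi * (-1) ^ m * (2 * modeDispDzConj n m (2 * z))

lemma hasLineDerivAt_modeWigner (m n : ℕ) (z v : ℂ) :
    HasLineDerivAt ℝ (modeWigner m n) (modeWignerDz m n z * v + modeWignerDzConj m n z * conj v)
      z v := by
  have hγ : HasDerivAt (fun t : ℝ => 2 * (z + t • v)) (2 * v) 0 := by
    have : HasDerivAt (fun t : ℝ => z + t • v) v 0 := by
      simpa using ((hasDerivAt_id (0 : ℝ)).smul_const v).const_add z
    exact this.const_mul 2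
  refine ((hasDerivAt_modeDisp hγ n m).const_mul (2 / Real.pi * (-1) ^ m : ℂ)).congr_deriv ?_
  simp only [zero_smul, add_zero, modeWignerDz, modeWignerDzConj, map_mul, map_ofNat]
  ring

/-- `|m⟩⟨n| ↦ a† |m⟩⟨n|`. -/
lemma modeWigner_create_left (m n : ℕ) (z : ℂ) :
    (Real.sqrt ((m : ℝ) + 1) : ℂ) * modeWigner (m + 1) n z =
      conj z * modeWigner m n z - modeWignerDz m n z / 2 := by
  have h := modeDisp_succ_right n m (2 * z)
  simp only [modeWigner, modeWignerDz, modeDispDz, map_mul, map_ofNat, pow_succ] at h ⊢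
  linear_combination (-(1 / Real.pi) * (-1) ^ m : ℂ) * h

/-- `|m⟩⟨n| ↦ |m⟩⟨n| a†`. -/
lemma modeWigner_create_right (m n : ℕ) (z : ℂ) :
    (Real.sqrt (n : ℝ) : ℂ) * modeWigner m (n - 1) z =
      conj z * modeWigner m n z + modeWignerDz m n z / 2 := by
  have h := modeDisp_succ_right n m (2 * z)
  simp only [modeWigner, modeWignerDz, modeDispDz, map_mul, map_ofNat] at h ⊢
  linear_combination (-(1 / Real.pi) * (-1) ^ m : ℂ) * h

/-- `|m⟩⟨n| ↦ |m⟩⟨n| a`. -/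
lemma modeWigner_annihilate_right (m n : ℕ) (z : ℂ) :
    (Real.sqrt ((n : ℝ) + 1) : ℂ) * modeWigner m (n + 1) z =
      z * modeWigner m n z - modeWignerDzConj m n z / 2 := by
  have h := modeDisp_succ_left n m (2 * z)
  simp only [modeWigner, modeWignerDzConj, modeDispDzConj] at h ⊢
  linear_combination ((1 / Real.pi) * (-1) ^ m : ℂ) * h

/-- `|m⟩⟨n| ↦ a |m⟩⟨n|`. -/
lemma modeWigner_annihilate_left (m n : ℕ) (z : ℂ) :
    (Real.sqrt (m : ℝ) : ℂ) * modeWigner (m - 1) n z =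
      z * modeWigner m n z + modeWignerDzConj m n z / 2 := by
  have h := modeDisp_succ_left n m (2 * z)
  cases m with
  | zero =>
    simp only [modeWigner, modeWignerDzConj, modeDispDzConj, Nat.cast_zero, Real.sqrt_zero,
      Complex.ofReal_zero, zero_mul, add_zero] at h ⊢
    linear_combination ((1 / Real.pi) : ℂ) * h
  | succ m =>
    simp only [modeWigner, modeWignerDzConj, modeDispDzConj, Nat.add_sub_cancel, pow_succ] at h ⊢
    linear_combination (-(1 / Real.pi) * (-1) ^ m : ℂ) * h

lemma contDiff_modeWigner (m n : ℕ) : ContDiff ℝ (⊤ : ℕ∞) (modeWigner m n) :=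
  contDiff_const.mul ((contDiff_modeDisp n m).comp (contDiff_const.mul contDiff_id))

lemma modeFourier_eq_modeWigner (m n : ℕ) (a : ℂ) :
    ((Real.pi : ℂ) ^ 2)⁻¹ * modeFourier n m a = modeWigner m n a := by
  have hpi : (Real.pi : ℂ) ≠ 0 := by exact_mod_cast Real.pi_ne_zero
  rw [modeFourier_eq, modeWigner]
  field_simp

/-- The Wigner functions of the matrix units of one mode are orthogonal. -/
lemma integral_conj_modeWigner_mul (m n m' n' : ℕ) :
    ∫ z, conj (modeWigner m n z) * modeWigner m' n' z =
      if m = m' ∧ n = n' then (Real.pi : ℂ)⁻¹ else 0 := by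
  have h1 : ∀ z, conj (modeWigner m n z) * modeWigner m' n' z =
      (4 / Real.pi ^ 2 * ((-1) ^ m * (-1) ^ m')) *
        (conj (modeDisp n m ((2 : ℝ) • z)) * modeDisp n' m' ((2 : ℝ) • z)) := by
    intro z
    have h2 : ((2 : ℝ) • z : ℂ) = 2 * z := by simp
    simp only [modeWigner, map_mul, map_div₀, map_pow, map_neg, map_one, map_ofNat,
      Complex.conj_ofReal, h2]
    ring
  have hpi : (Real.pi : ℂ) ≠ 0 := by exact_mod_cast Real.pi_ne_zero
  simp only [h1]
  rw [integral_const_mul, Measure.integral_comp_smul volume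
    (fun z => conj (modeDisp n m z) * modeDisp n' m' z)]
  have h3 := modeInner_eq n m n' m'
  rw [modeInner] at h3
  rw [h3, Complex.finrank_real_complex]
  by_cases h : m = m' ∧ n = n'
  · obtain ⟨rfl, rfl⟩ := h
    have h4 : ((-1 : ℂ) ^ m * (-1) ^ m) = 1 := by rw [← mul_pow]; simp
    rw [h4]
    norm_num
    field_simp
  · rw [if_neg h, if_neg (by tauto)]
    simp

lemma truncate_of_notMem {J : Type*} {M : J → Type*} (c : Kernel M)
    (s : Finset (Occ M × Occ M)) (p : Occ M × Occ M) (hp : p ∉ s) : truncate c s p.1 p.2 = 0 :=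
  if_neg hp

section Modes

variable {J : Type*} {M : J → Type*} [Fintype J] [∀ j, Fintype (M j)]

/-- The Wigner function of the matrix unit `|μ⟩⟨ν|`. -/
def unitWigner (μ ν : Occ M) : Amp M → ℂ := modeProd modeWigner μ ν

lemma contDiff_modeProd {k : ℕ → ℕ → ℂ → ℂ} (hk : ∀ m n, ContDiff ℝ (⊤ : ℕ∞) (k m n))
    (μ ν : Occ M) : ContDiff ℝ (⊤ : ℕ∞) (modeProd k μ ν) :=
  contDiff_prod fun i _ => (hk _ _).comp (contDiff_apply ℝ ℂ i)

lemma contDiff_unitWigner (μ ν : Occ M) : ContDiff ℝ (⊤ : ℕ∞) (unitWigner μ ν) :=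
  contDiff_modeProd contDiff_modeWigner μ ν

lemma continuous_dispProd (μ ν : Occ M) : Continuous (modeProd modeDisp μ ν : Amp M → ℂ) :=
  (contDiff_modeProd contDiff_modeDisp μ ν).continuous

lemma integrable_dispProd (μ ν : Occ M) : Integrable (modeProd modeDisp μ ν : Amp M → ℂ) :=
  Integrable.fintype_prod fun i => integrable_modeDisp (μ i) (ν i)

/-- The symplectic character of all the amplitudes. -/
def ampCharacter (α lam : Amp M) : ℂ := ∏ i, character (α i) (lam i)

lemma norm_ampCharacter (α lam : Amp M) : ‖ampCharacter α lam‖ = 1 := by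
  rw [ampCharacter, norm_prod]
  exact Finset.prod_eq_one fun i _ => norm_character _ _

lemma continuous_ampCharacter :
    Continuous fun p : Amp M × Amp M => ampCharacter p.1 p.2 := by
  unfold ampCharacter character
  fun_prop

lemma integrable_ampCharacter_mul (α : Amp M) {f : Amp M → ℂ} (hf : Integrable f) :
    Integrable fun lam => ampCharacter α lam * f lam := by
  have hm : AEStronglyMeasurable (fun lam : Amp M => ampCharacter α lam) volume :=
    (continuous_ampCharacter.comp (Continuous.prodMk_right α)).aestronglyMeasurable
  exact hf.bdd_mul hm (Eventually.of_forall fun lam => (norm_ampCharacter α lam).le)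

lemma integral_ampCharacter_mul_dispProd (μ ν : Occ M) (α : Amp M) :
    ((Real.pi : ℂ) ^ (2 * Fintype.card (Modes M)))⁻¹ *
      ∫ lam, ampCharacter α lam * modeProd modeDisp ν μ lam = unitWigner μ ν α := by
  have h : ∀ lam : Amp M, ampCharacter α lam * modeProd modeDisp ν μ lam =
      ∏ i, character (α i) (lam i) * modeDisp (ν i) (μ i) (lam i) := fun lam => by
    rw [ampCharacter, modeProd, Finset.prod_mul_distrib]
  simp only [h]
  rw [integral_fintype_prod_volume_eq_prod (fun (i : Modes M) (z : ℂ) =>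
    character (α i) z * modeDisp (ν i) (μ i) z), pow_mul, unitWigner, modeProd]
  have hc : (((Real.pi : ℂ) ^ 2) ^ Fintype.card (Modes M))⁻¹ =
      ∏ _i : Modes M, ((Real.pi : ℂ) ^ 2)⁻¹ := by
    rw [Finset.prod_const, inv_pow, Finset.card_univ]
  rw [hc, ← Finset.prod_mul_distrib]
  exact Finset.prod_congr rfl fun i _ => modeFourier_eq_modeWigner (μ i) (ν i) (α i)

variable {d : ℕ} {R : Set (EuclideanSpace ℝ (Fin d))}
  {φ : ∀ j, M j → EuclideanSpace ℝ (Fin d) → ℂ}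

lemma IsOrthonormalModes.charFunctional_truncate (h : IsOrthonormalModes R φ) (c : Kernel M)
    (s : Finset (Occ M × Occ M)) (lam : Amp M) : charFunctional R φ (truncate c s) lam =
      ∑ p ∈ s, c p.1 p.2 * modeProd modeDisp p.2 p.1 lam := by
  have h0 : ∀ p ∉ s, truncate c s p.1 p.2 * modeProd modeDisp p.2 p.1 lam = 0 := fun p hp => by
    rw [truncate_of_notMem c s p hp, zero_mul]
  have hs : Summable fun p : Occ M × Occ M =>
      truncate c s p.1 p.2 * modeProd modeDisp p.2 p.1 lam := summable_of_ne_finset_zero h0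
  simp only [charFunctional, charDiag, h.displacementOp_eq]
  rw [← hs.tsum_prod, tsum_eq_sum h0]
  refine Finset.sum_congr rfl fun p hp => ?_
  rw [truncate, if_pos hp]

/-- The Wigner transform of a finite matrix. -/
lemma IsOrthonormalModes.wigner_truncate (h : IsOrthonormalModes R φ) (c : Kernel M)
    (s : Finset (Occ M × Occ M)) (α : Amp M) :
    wigner R φ (truncate c s) α = ∑ p ∈ s, c p.1 p.2 * unitWigner p.1 p.2 α := by
  rw [wigner]
  simp only [h.displacementFunctional_eq, h.charFunctional_truncate, Finset.mul_sum]
  rw [integral_finsetSum, Finset.mul_sum]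
  · refine Finset.sum_congr rfl fun p _ => ?_
    have e : ∀ lam : Amp M, (∏ i, character (α i) (lam i)) *
        (c p.1 p.2 * modeProd modeDisp p.2 p.1 lam) =
        c p.1 p.2 * (ampCharacter α lam * modeProd modeDisp p.2 p.1 lam) := fun lam => by
      rw [ampCharacter]
      ring
    simp only [e]
    rw [integral_const_mul, ← integral_ampCharacter_mul_dispProd]
    ring
  · intro p _
    exact integrable_ampCharacter_mul α ((integrable_dispProd p.2 p.1).const_mul (c p.1 p.2))

end Modes

/-! ### Orthogonal series in `L²` -/

section OrthogonalSeries

variable {X : Type*} [MeasurableSpace X] {m : Measure X}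

lemma inner_toLp {f g : X → ℂ} (hf : MemLp f 2 m) (hg : MemLp g 2 m) :
    inner ℂ (hf.toLp f) (hg.toLp g) = ∫ x, conj (f x) * g x ∂m := by
  rw [L2.inner_def]
  refine integral_congr_ae ?_
  filter_upwards [hf.coeFn_toLp, hg.coeFn_toLp] with x hx hy
  rw [hx, hy, RCLike.inner_apply, mul_comm]

/-- Convergence in `L²` implies weak convergence. -/
lemma tendsto_integral_mul_of_eLpNorm {ι : Type*} {l : Filter ι} {u : ι → X → ℂ} {w h : X → ℂ}
    (hu : ∀ s, MemLp (u s) 2 m) (hw : MemLp w 2 m) (hh : MemLp h 2 m)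
    (hlim : Tendsto (fun s => eLpNorm (fun x => u s x - w x) 2 m) l (𝓝 0)) :
    Tendsto (fun s => ∫ x, u s x * h x ∂m) l (𝓝 (∫ x, w x * h x ∂m)) := by
  have h1 := (Lp.tendsto_Lp_iff_tendsto_eLpNorm'' u hu w hw).mpr hlim
  have h2 := Filter.Tendsto.inner (𝕜 := ℂ) (tendsto_const_nhds (x := hh.star.toLp (star h))) h1
  simp only [inner_toLp] at h2
  simpa [mul_comm] using h2

variable {ι : Type*} {ψ : ι → X → ℂ}

lemma memLp_sum_mul (hψ : ∀ p, MemLp (ψ p) 2 m) (c : ι → ℂ) (s : Finset ι) :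
    MemLp (fun x => ∑ p ∈ s, c p * ψ p x) 2 m :=
  memLp_finsetSum s fun p _ => (hψ p).const_mul (c p)

lemma sum_smul_toLp (hψ : ∀ p, MemLp (ψ p) 2 m) (c : ι → ℂ) (s : Finset ι) :
    ∑ p ∈ s, c p • (hψ p).toLp (ψ p) = (memLp_sum_mul hψ c s).toLp _ := by
  classical
  induction s using Finset.induction_on with
  | empty =>
    simp only [Finset.sum_empty]
    exact (MemLp.toLp_zero _).symm
  | insert p s hp ih =>
    rw [Finset.sum_insert hp, ih, ← MemLp.toLp_const_smul, ← MemLp.toLp_add]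
    refine MemLp.toLp_congr _ _ (Eventually.of_forall fun x => ?_)
    simp [Finset.sum_insert hp]

/-- A series of orthogonal functions of equal norm with square-summable coefficients converges
in `L²`. -/
lemma summable_smul_toLp [DecidableEq ι] (hψ : ∀ p, MemLp (ψ p) 2 m) {C : ℝ} (hC : 0 < C)
    (horth : ∀ p q, ∫ x, conj (ψ p x) * ψ q x ∂m = if p = q then (C : ℂ) else 0) {c : ι → ℂ}
    (hc : Summable fun p => ‖c p‖ ^ 2) : Summable fun p => c p • (hψ p).toLp (ψ p) := by
  have hs : (Real.sqrt C : ℂ) ≠ 0 := by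
    rw [Complex.ofReal_ne_zero, Real.sqrt_ne_zero']
    exact hC
  have hs2 : (Real.sqrt C : ℂ) * (Real.sqrt C : ℂ) = C := by
    rw [← Complex.ofReal_mul, Real.mul_self_sqrt hC.le]
  have hon : Orthonormal ℂ fun p => (Real.sqrt C : ℂ)⁻¹ • (hψ p).toLp (ψ p) := by
    rw [orthonormal_iff_ite]
    intro p q
    rw [inner_smul_left, inner_smul_right, inner_toLp, horth, map_inv₀, Complex.conj_ofReal]
    by_cases hpq : p = q
    · rw [if_pos hpq, if_pos hpq, ← hs2]
      field_simp
    · rw [if_neg hpq, if_neg hpq, mul_zero, mul_zero]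
  have key := (hon.orthogonalFamily.summable_iff_norm_sq_summable
    fun p => (Real.sqrt C : ℂ) * c p).mpr (by
      simp only [norm_mul, mul_pow]
      exact hc.mul_left _)
  refine key.congr fun p => ?_
  simp only [LinearIsometry.toSpanSingleton_apply, smul_smul]
  congr 1
  field_simp

/-- The sum of an orthogonal series, as a function. -/
lemma exists_eLpNorm_limit [DecidableEq ι] (hψ : ∀ p, MemLp (ψ p) 2 m) {C : ℝ} (hC : 0 < C)
    (horth : ∀ p q, ∫ x, conj (ψ p x) * ψ q x ∂m = if p = q then (C : ℂ) else 0) {c : ι → ℂ}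
    (hc : Summable fun p => ‖c p‖ ^ 2) : ∃ w : X → ℂ, MemLp w 2 m ∧
      Tendsto (fun s : Finset ι => eLpNorm (fun x => ∑ p ∈ s, c p * ψ p x - w x) 2 m) atTop
        (𝓝 0) := by
  obtain ⟨W, hW⟩ := summable_smul_toLp hψ hC horth hc
  refine ⟨W, Lp.memLp W, ?_⟩
  have h1 : Tendsto (fun s : Finset ι => (memLp_sum_mul hψ c s).toLp _) atTop (𝓝 W) := by
    simpa only [HasSum, sum_smul_toLp, SummationFilter.unconditional_filter] using hW
  rw [← Lp.toLp_coeFn W (Lp.memLp W)] at h1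
  exact (Lp.tendsto_Lp_iff_tendsto_eLpNorm'' _ (memLp_sum_mul hψ c) _ (Lp.memLp W)).mp h1

end OrthogonalSeries

/-! ### Existence of the transform in `L²` -/

lemma IsHilbertSchmidt.kernel {J : Type*} {M : J → Type*} {A : Fock M →L[ℂ] Fock M}
    (hA : IsHilbertSchmidt A) :
    IsHilbertSchmidtKernel (matrixElement A) := by
  have h : ∀ ν, HasSum (fun μ => ‖matrixElement A μ ν‖ ^ 2) (‖A (fockState ν)‖ ^ 2) := fun ν => by
    have := lp.hasSum_norm (p := 2) (by norm_num) (A (fockState ν))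
    simpa [matrixElement] using this
  have h2 : Summable fun p : Occ M × Occ M => ‖matrixElement A p.2 p.1‖ ^ 2 := by
    rw [summable_prod_of_nonneg fun p => by positivity]
    exact ⟨fun ν => (h ν).summable, by
      simpa only [(h _).tsum_eq, IsHilbertSchmidt] using hA⟩
  exact (Equiv.prodComm (Occ M) (Occ M)).summable_iff.mp h2

section Modes

variable {J : Type*} {M : J → Type*} [Fintype J] [∀ j, Fintype (M j)]

lemma integral_conj_modeProd_mul {k : ℕ → ℕ → ℂ → ℂ} {C : ℂ}
    (hk : ∀ m n m' n', ∫ z, conj (k m n z) * k m' n' z = if m = m' ∧ n = n' then C else 0)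
    (μ ν μ' ν' : Occ M) : ∫ α : Amp M, conj (modeProd k μ ν α) * modeProd k μ' ν' α =
      if (μ, ν) = (μ', ν') then C ^ Fintype.card (Modes M) else 0 := by
  have h : ∀ α : Amp M, conj (modeProd k μ ν α) * modeProd k μ' ν' α =
      ∏ i, conj (k (μ i) (ν i) (α i)) * k (μ' i) (ν' i) (α i) := fun α => by
    rw [modeProd, modeProd, map_prod, Finset.prod_mul_distrib]
  simp only [h]
  rw [integral_fintype_prod_volume_eq_prod (fun (i : Modes M) (z : ℂ) =>
    conj (k (μ i) (ν i) z) * k (μ' i) (ν' i) z)]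
  simp only [hk]
  rw [Finset.prod_ite_zero]
  simp only [Finset.mem_univ, true_implies, forall_and, Prod.mk.injEq, funext_iff,
    Finset.prod_const, Finset.card_univ]

lemma integral_conj_dispProd_mul (p q : Occ M × Occ M) :
    ∫ α : Amp M, conj (modeProd modeDisp p.2 p.1 α) * modeProd modeDisp q.2 q.1 α =
      if p = q then ((Real.pi ^ Fintype.card (Modes M) : ℝ) : ℂ) else 0 := by
  rw [integral_conj_modeProd_mul modeInner_eq]
  have : ((p.2, p.1) = (q.2, q.1)) ↔ p = q := by
    rw [Prod.mk.injEq, Prod.ext_iff, and_comm]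
  simp only [this]
  push_cast
  rfl

lemma integral_conj_unitWigner_mul (p q : Occ M × Occ M) :
    ∫ α : Amp M, conj (unitWigner p.1 p.2 α) * unitWigner q.1 q.2 α =
      if p = q then ((Real.pi⁻¹ ^ Fintype.card (Modes M) : ℝ) : ℂ) else 0 := by
  simp only [unitWigner]
  rw [integral_conj_modeProd_mul integral_conj_modeWigner_mul]
  push_cast
  rfl

/-- A continuous function with non-zero norm integral is square-integrable. -/
lemma memLp_of_integral_conj_mul_ne_zero {f : Amp M → ℂ} (hf : Continuous f)
    (h : ∫ α, conj (f α) * f α ≠ 0) : MemLp f 2 volume := by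
  rw [memLp_two_iff_integrable_sq_norm hf.aestronglyMeasurable]
  have hi : Integrable (fun x => conj (f x) * f x) := not_imp_comm.mp integral_undef h
  refine hi.norm.congr (Eventually.of_forall fun x => ?_)
  simp only [norm_mul, RCLike.norm_conj]
  ring

lemma memLp_dispProd (p : Occ M × Occ M) :
    MemLp (modeProd modeDisp p.2 p.1 : Amp M → ℂ) 2 volume := by
  refine memLp_of_integral_conj_mul_ne_zero (continuous_dispProd _ _) ?_
  rw [integral_conj_dispProd_mul, if_pos rfl]
  exact_mod_cast (by positivity : (Real.pi ^ Fintype.card (Modes M)) ≠ 0)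

lemma memLp_unitWigner (p : Occ M × Occ M) : MemLp (unitWigner p.1 p.2) 2 volume := by
  refine memLp_of_integral_conj_mul_ne_zero (contDiff_unitWigner _ _).continuous ?_
  rw [integral_conj_unitWigner_mul, if_pos rfl]
  exact_mod_cast (by positivity : (Real.pi⁻¹ ^ Fintype.card (Modes M)) ≠ 0)

variable {d : ℕ} {R : Set (EuclideanSpace ℝ (Fin d))}
  {φ : ∀ j, M j → EuclideanSpace ℝ (Fin d) → ℂ}

theorem IsOrthonormalModes.exists_isWignerL2 (h : IsOrthonormalModes R φ) {c : Kernel M}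
    (hc : IsHilbertSchmidtKernel c) : ∃ w, IsWignerL2 R φ c w := by
  obtain ⟨w, hw, hlim⟩ := exists_eLpNorm_limit memLp_unitWigner
    (C := Real.pi⁻¹ ^ Fintype.card (Modes M)) (by positivity)
    integral_conj_unitWigner_mul hc
  refine ⟨w, hw, ?_⟩
  simpa only [h.wigner_truncate] using hlim

end Modes

/-! ### Wirtinger calculus -/

section Wirtinger

variable {J : Type*} {M : J → Type*} [Fintype J] [∀ j, Fintype (M j)]

open Classical in
lemma wirtinger_eq_fderiv {F : Amp M → ℂ} {α : Amp M} (hF : DifferentiableAt ℝ F α) (i : Modes M) :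
    wirtinger i F α = (1 / 2) * (fderiv ℝ F α (Pi.single i 1) -
      Complex.I * fderiv ℝ F α (Pi.single i Complex.I)) := by
  rw [wirtinger, hF.lineDeriv_eq_fderiv, hF.lineDeriv_eq_fderiv]

open Classical in
lemma wirtingerConj_eq_fderiv {F : Amp M → ℂ} {α : Amp M} (hF : DifferentiableAt ℝ F α)
    (i : Modes M) :
    wirtingerConj i F α = (1 / 2) * (fderiv ℝ F α (Pi.single i 1) +
      Complex.I * fderiv ℝ F α (Pi.single i Complex.I)) := by
  rw [wirtingerConj, hF.lineDeriv_eq_fderiv, hF.lineDeriv_eq_fderiv]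

open Classical in
/-- The Wirtinger derivatives are the coefficients of `v` and `v^*` in the derivative along `v`. -/
lemma wirtinger_of_hasLineDerivAt {F : Amp M → ℂ} {α : Amp M} {i : Modes M} {a b : ℂ}
    (h : ∀ v : ℂ, HasLineDerivAt ℝ F (a * v + b * conj v) α (Pi.single i v)) :
    wirtinger i F α = a ∧ wirtingerConj i F α = b := by
  rw [wirtinger, wirtingerConj, (h 1).lineDeriv, (h Complex.I).lineDeriv]
  simp only [map_one, Complex.conj_I]
  exact ⟨by linear_combination (-(a - b) / 2) * Complex.I_sq,
    by linear_combination ((a - b) / 2) * Complex.I_sq⟩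

lemma wirtinger_mul {F G : Amp M → ℂ} {α : Amp M} (hF : DifferentiableAt ℝ F α)
    (hG : DifferentiableAt ℝ G α) (i : Modes M) :
    wirtinger i (fun β => F β * G β) α = wirtinger i F α * G α + F α * wirtinger i G α := by
  classical
  rw [wirtinger_eq_fderiv (hF.fun_mul hG), wirtinger_eq_fderiv hF, wirtinger_eq_fderiv hG,
    fderiv_fun_mul hF hG]
  simp only [add_apply, smul_apply, smul_eq_mul]
  ring

lemma wirtingerConj_mul {F G : Amp M → ℂ} {α : Amp M} (hF : DifferentiableAt ℝ F α)
    (hG : DifferentiableAt ℝ G α) (i : Modes M) :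
    wirtingerConj i (fun β => F β * G β) α =
      wirtingerConj i F α * G α + F α * wirtingerConj i G α := by
  classical
  rw [wirtingerConj_eq_fderiv (hF.fun_mul hG), wirtingerConj_eq_fderiv hF,
    wirtingerConj_eq_fderiv hG, fderiv_fun_mul hF hG]
  simp only [add_apply, smul_apply, smul_eq_mul]
  ring

lemma wirtinger_add {F G : Amp M → ℂ} {α : Amp M} (hF : DifferentiableAt ℝ F α)
    (hG : DifferentiableAt ℝ G α) (i : Modes M) :
    wirtinger i (fun β => F β + G β) α = wirtinger i F α + wirtinger i G α := by
  classical
  rw [wirtinger_eq_fderiv (hF.fun_add hG), wirtinger_eq_fderiv hF, wirtinger_eq_fderiv hG,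
    fderiv_fun_add hF hG]
  simp only [add_apply]
  ring

lemma wirtingerConj_add {F G : Amp M → ℂ} {α : Amp M} (hF : DifferentiableAt ℝ F α)
    (hG : DifferentiableAt ℝ G α) (i : Modes M) :
    wirtingerConj i (fun β => F β + G β) α = wirtingerConj i F α + wirtingerConj i G α := by
  classical
  rw [wirtingerConj_eq_fderiv (hF.fun_add hG), wirtingerConj_eq_fderiv hF,
    wirtingerConj_eq_fderiv hG, fderiv_fun_add hF hG]
  simp only [add_apply]
  ring

lemma wirtinger_const_mul {F : Amp M → ℂ} {α : Amp M} (hF : DifferentiableAt ℝ F α) (c : ℂ)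
    (i : Modes M) : wirtinger i (fun β => c * F β) α = c * wirtinger i F α := by
  classical
  rw [wirtinger_eq_fderiv (hF.const_mul c), wirtinger_eq_fderiv hF, fderiv_const_mul hF]
  simp only [smul_apply, smul_eq_mul]
  ring

lemma wirtingerConj_const_mul {F : Amp M → ℂ} {α : Amp M} (hF : DifferentiableAt ℝ F α) (c : ℂ)
    (i : Modes M) : wirtingerConj i (fun β => c * F β) α = c * wirtingerConj i F α := by
  classical
  rw [wirtingerConj_eq_fderiv (hF.const_mul c), wirtingerConj_eq_fderiv hF, fderiv_const_mul hF]
  simp only [smul_apply, smul_eq_mul]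
  ring

open Classical in
lemma hasLineDerivAt_apply (n i : Modes M) (α : Amp M) (v : ℂ) :
    HasLineDerivAt ℝ (fun β : Amp M => β n) (if n = i then v else 0) α (Pi.single i v) := by
  have h := ((ContinuousLinearMap.proj (R := ℝ) (φ := fun _ : Modes M => ℂ)
    n).hasFDerivAt (x := α)).hasLineDerivAt (Pi.single i v)
  refine HasDerivAt.congr_deriv h ?_
  by_cases hn : n = i
  · subst hn
    simp
  · simp [hn]

open Classical in
lemma wirtinger_apply (i n : Modes M) (α : Amp M) :
    wirtinger i (fun β => β n) α = (if n = i then 1 else 0) ∧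
      wirtingerConj i (fun β => β n) α = 0 := by
  refine wirtinger_of_hasLineDerivAt fun v =>
    HasDerivAt.congr_deriv (hasLineDerivAt_apply n i α v) ?_
  by_cases h : n = i <;> simp [h]

open Classical in
lemma wirtinger_conj_apply (i n : Modes M) (α : Amp M) :
    wirtinger i (fun β => conj (β n)) α = 0 ∧
      wirtingerConj i (fun β => conj (β n)) α = (if n = i then 1 else 0) := by
  refine wirtinger_of_hasLineDerivAt fun v =>
    HasDerivAt.congr_deriv (HasDerivAt.star (hasLineDerivAt_apply n i α v)) ?_
  by_cases h : n = i <;> simp [h]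

lemma contDiff_amp {N : ℕ∞} (n : Modes M) : ContDiff ℝ N fun β : Amp M => β n :=
  contDiff_apply ℝ ℂ n

lemma contDiff_conj_amp {N : ℕ∞} (n : Modes M) : ContDiff ℝ N fun β : Amp M => conj (β n) :=
  Complex.conjCLE.contDiff.comp (contDiff_amp n)

/-- Smooth compactly supported functions of the amplitudes. -/
structure IsTest (g : Amp M → ℂ) : Prop where
  contDiff : ContDiff ℝ (⊤ : ℕ∞) g
  hasCompactSupport : HasCompactSupport g

namespace IsTest

variable {g : Amp M → ℂ}

lemma differentiable (hg : IsTest g) : Differentiable ℝ g := hg.contDiff.differentiable (by simp)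

lemma add {f : Amp M → ℂ} (hf : IsTest f) (hg : IsTest g) : IsTest fun α => f α + g α :=
  ⟨hf.contDiff.add hg.contDiff, hf.hasCompactSupport.add hg.hasCompactSupport⟩

lemma mul_left (hg : IsTest g) {f : Amp M → ℂ} (hf : ContDiff ℝ (⊤ : ℕ∞) f) :
    IsTest fun α => f α * g α :=
  ⟨hf.mul hg.contDiff, hg.hasCompactSupport.mul_left⟩

lemma const_mul (hg : IsTest g) (c : ℂ) : IsTest fun α => c * g α := hg.mul_left contDiff_const

lemma fderiv_apply (hg : IsTest g) (v : Amp M) : IsTest fun α => fderiv ℝ g α v :=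
  ⟨(hg.contDiff.fderiv_right (m := (⊤ : ℕ∞)) (by simp)).clm_apply contDiff_const,
    hg.hasCompactSupport.fderiv_apply ℝ v⟩

lemma wirtinger (hg : IsTest g) (i : Modes M) : IsTest (wirtinger i g) := by
  classical
  have := ((hg.fderiv_apply (Pi.single i 1)).add
    ((hg.fderiv_apply (Pi.single i Complex.I)).const_mul (-Complex.I))).const_mul (1 / 2)
  convert this using 1
  ext α
  rw [wirtinger_eq_fderiv (hg.differentiable α)]
  ring

lemma wirtingerConj (hg : IsTest g) (i : Modes M) : IsTest (wirtingerConj i g) := by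
  classical
  have := ((hg.fderiv_apply (Pi.single i 1)).add
    ((hg.fderiv_apply (Pi.single i Complex.I)).const_mul Complex.I)).const_mul (1 / 2)
  convert this using 1
  ext α
  rw [wirtingerConj_eq_fderiv (hg.differentiable α)]

lemma memLp (hg : IsTest g) : MemLp g 2 volume :=
  hg.contDiff.continuous.memLp_of_hasCompactSupport hg.hasCompactSupport

lemma integrable_mul (hg : IsTest g) {f : Amp M → ℂ} (hf : LocallyIntegrable f) :
    Integrable fun α => f α * g α :=
  hf.integrable_smul_right_of_hasCompactSupport hg.contDiff.continuous hg.hasCompactSupport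

/-- Mixed Wirtinger derivatives commute. -/
lemma wirtinger_comm (hg : IsTest g) (m n : Modes M) (α : Amp M) :
    FieldWigner.wirtinger n (FieldWigner.wirtingerConj m g) α =
      FieldWigner.wirtingerConj m (FieldWigner.wirtinger n g) α := by
  classical
  have hd : ∀ v, DifferentiableAt ℝ (fun β => fderiv ℝ g β v) α := fun v =>
    (hg.fderiv_apply v).differentiable α
  have hdd : DifferentiableAt ℝ (fderiv ℝ g) α :=
    (hg.contDiff.fderiv_right (m := (⊤ : ℕ∞)) (by simp)).differentiable (by simp) α
  have hsymm : ∀ u v, fderiv ℝ (fun β => fderiv ℝ g β u) α v =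
      fderiv ℝ (fun β => fderiv ℝ g β v) α u := by
    intro u v
    have := (contDiff_infty.mp hg.contDiff 2).contDiffAt (x := α) |>.isSymmSndFDerivAt (by simp) v u
    rw [fderiv_clm_apply hdd (differentiableAt_const _),
      fderiv_clm_apply hdd (differentiableAt_const _)]
    simpa using this
  have e1 : FieldWigner.wirtinger n g = fun β => (1 / 2) * fderiv ℝ g β (Pi.single n 1) +
      (-Complex.I / 2) * fderiv ℝ g β (Pi.single n Complex.I) := by
    ext β
    rw [wirtinger_eq_fderiv (hg.differentiable β)]
    ring
  have e2 : FieldWigner.wirtingerConj m g = fun β => (1 / 2) * fderiv ℝ g β (Pi.single m 1) +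
      (Complex.I / 2) * fderiv ℝ g β (Pi.single m Complex.I) := by
    ext β
    rw [wirtingerConj_eq_fderiv (hg.differentiable β)]
    ring
  rw [e1, e2, wirtinger_add ((hd _).const_mul _) ((hd _).const_mul _),
    wirtingerConj_add ((hd _).const_mul _) ((hd _).const_mul _), wirtinger_const_mul (hd _),
    wirtinger_const_mul (hd _), wirtingerConj_const_mul (hd _), wirtingerConj_const_mul (hd _),
    wirtinger_eq_fderiv (hd _), wirtinger_eq_fderiv (hd _), wirtingerConj_eq_fderiv (hd _),
    wirtingerConj_eq_fderiv (hd _), hsymm (Pi.single m 1), hsymm (Pi.single m 1),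
    hsymm (Pi.single m Complex.I), hsymm (Pi.single m Complex.I)]
  ring

end IsTest

lemma integral_wirtinger_eq_zero {G : Amp M → ℂ} (hG : ContDiff ℝ 1 G) (hc : HasCompactSupport G)
    (i : Modes M) : ∫ α, wirtinger i G α = 0 ∧ ∫ α, wirtingerConj i G α = 0 := by
  classical
  have hint : ∀ v, Integrable fun α => fderiv ℝ G α v := fun v =>
    ((hG.continuous_fderiv one_ne_zero).clm_apply continuous_const).integrable_of_hasCompactSupport
      (hc.fderiv_apply ℝ v)
  have h0 := integral_fderiv_eq_zero_of_compactSupport hG hc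
  have hd := hG.differentiable one_ne_zero
  simp only [fun α => wirtinger_eq_fderiv (hd α) i, fun α => wirtingerConj_eq_fderiv (hd α) i]
  rw [integral_const_mul, integral_const_mul, integral_sub (hint _) ((hint _).const_mul _),
    integral_add (hint _) ((hint _).const_mul _), integral_const_mul, h0, h0]
  simp

lemma continuous_wirtinger {F : Amp M → ℂ} (hF : ContDiff ℝ 1 F) (i : Modes M) :
    Continuous (wirtinger i F) ∧ Continuous (wirtingerConj i F) := by
  classical
  have hd := hF.differentiable one_ne_zero
  have hc : ∀ v, Continuous fun α => fderiv ℝ F α v := fun v =>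
    (hF.continuous_fderiv one_ne_zero).clm_apply continuous_const
  constructor
  · rw [show wirtinger i F = _ from funext fun α => wirtinger_eq_fderiv (hd α) i]
    exact continuous_const.mul ((hc _).sub (continuous_const.mul (hc _)))
  · rw [show wirtingerConj i F = _ from funext fun α => wirtingerConj_eq_fderiv (hd α) i]
    exact continuous_const.mul ((hc _).add (continuous_const.mul (hc _)))

/-- Integration by parts for the Wirtinger derivatives. -/
lemma integral_wirtinger_mul {F g : Amp M → ℂ} (hF : ContDiff ℝ 1 F) (hg : IsTest g)
    (i : Modes M) : ∫ α, wirtinger i F α * g α = -∫ α, F α * wirtinger i g α ∧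
      ∫ α, wirtingerConj i F α * g α = -∫ α, F α * wirtingerConj i g α := by
  have hg1 : ContDiff ℝ 1 g := hg.contDiff.of_le (by exact_mod_cast le_top)
  have h := integral_wirtinger_eq_zero (hF.mul hg1) hg.hasCompactSupport.mul_left i
  have hdF := hF.differentiable one_ne_zero
  simp only [wirtinger_mul (hdF _) (hg.differentiable _),
    wirtingerConj_mul (hdF _) (hg.differentiable _)] at h
  have hc := continuous_wirtinger hF i
  rw [integral_add (hg.integrable_mul hc.1.locallyIntegrable)
      ((hg.wirtinger i).integrable_mul hF.continuous.locallyIntegrable),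
    integral_add (hg.integrable_mul hc.2.locallyIntegrable)
      ((hg.wirtingerConj i).integrable_mul hF.continuous.locallyIntegrable)] at h
  exact ⟨by linear_combination h.1, by linear_combination h.2⟩

end Wirtinger

/-! ### Ladder operators paired with test functions -/

section Shift

variable {J : Type*} {M : J → Type*} {β : Type*}

open Classical in
/-- Creation is the transpose of annihilation in the number basis. The parameter `p.2` allows
summation over further indices. -/
lemma hasSum_create_mul (i : Modes M) (u v : Occ M → β → ℂ) (S : ℂ) :
    HasSum (fun p : Occ M × β => create i (fun κ => u κ p.2) p.1 * v p.1 p.2) S ↔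
      HasSum (fun p : Occ M × β => u p.1 p.2 * annihilate i (fun κ => v κ p.2) p.1) S := by
  have hinj : Function.Injective fun p : Occ M × β => (p.1 + Pi.single i 1, p.2) := by
    rintro ⟨μ, b⟩ ⟨μ', b'⟩ h
    simpa using h
  -- the shift by one quantum in the mode `i` misses only the terms where the factor `√(μ i)` is `0`
  rw [← hinj.hasSum_iff]
  · refine iff_of_eq (congrArg (HasSum · S _) (funext fun p => ?_))
    simp only [Function.comp_apply, create, annihilate, add_tsub_cancel_right, add_single_same]
    push_cast
    ring
  · rintro ⟨μ, b⟩ hμ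
    have h0 : μ i = 0 := by
      by_contra h
      refine hμ ⟨(μ - Pi.single i 1, b), ?_⟩
      simp only [Prod.mk.injEq, and_true]
      ext l
      by_cases hl : l = i
      · subst hl
        rw [add_single_same, sub_single_same]
        omega
      · rw [add_single_of_ne _ _ _ hl, sub_single_of_ne _ _ _ hl]
    simp [create, h0]

/-- The transpose of `a_n† a_m` is `a_m† a_n`. The sums on the two sides converge together, so
that no decay of `u` or `v` is assumed. -/
lemma hasSum_create_annihilate_mul (n m : Modes M) (u v : Occ M → β → ℂ) (S : ℂ) :
    HasSum (fun p : Occ M × β =>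
      create n (annihilate m fun κ => u κ p.2) p.1 * v p.1 p.2) S ↔
    HasSum (fun p : Occ M × β =>
      u p.1 p.2 * create m (annihilate n fun κ => v κ p.2) p.1) S := by
  have h1 := hasSum_create_mul n (fun κ b => annihilate m (fun κ' => u κ' b) κ) v S
  have h2 := hasSum_create_mul m (fun κ b => annihilate n (fun κ' => v κ' b) κ) u S
  simp only [mul_comm] at h1 h2 ⊢
  exact h1.trans h2.symm

/-- The product of a matrix and a normally ordered pair of ladder operators. -/
lemma hasSum_mul_create_annihilate_numState (n m : Modes M) (u : NumSeq M) (ν : Occ M) :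
    HasSum (fun κ => u κ * create n (annihilate m (numState ν)) κ)
      (create m (annihilate n u) ν) := by
  classical
  have h := hasSum_create_annihilate_mul m n (fun κ (_ : Unit) => u κ) (fun κ _ => numState ν κ)
    (create m (annihilate n u) ν)
  rw [← (Equiv.prodPUnit.{0} (Occ M)).symm.hasSum_iff,
    ← (Equiv.prodPUnit.{0} (Occ M)).symm.hasSum_iff] at h
  refine h.mp ?_
  have := hasSum_single (f := fun κ => create m (annihilate n u) κ * numState ν κ) ν
    fun κ hκ => by simp [numState, hκ]
  simpa [numState, Function.comp_def] using this

lemma create_sum (i : Modes M) {ι : Type*} (s : Finset ι) (a : ι → ℂ) (v : ι → NumSeq M)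
    (μ : Occ M) : create i (∑ m ∈ s, a m • v m) μ = ∑ m ∈ s, a m * create i (v m) μ := by
  simp only [create, Finset.sum_apply, Pi.smul_apply, smul_eq_mul, Finset.mul_sum]
  exact Finset.sum_congr rfl fun m _ => by ring

end Shift

section Kinetic

variable {d : ℕ} {J : Type*} {M : J → Type*} [∀ j, Fintype (M j)]
  {R : Set (EuclideanSpace ℝ (Fin d))} {φ : ∀ j, M j → EuclideanSpace ℝ (Fin d) → ℂ}

lemma kineticDensity_apply (j : J) (x : EuclideanSpace ℝ (Fin d)) (v : NumSeq M) (μ : Occ M) :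
    kineticDensity φ j x v μ = ∑ n, ∑ m, conj (φ j n x) * (Δ (φ j m)) x *
      create ⟨j, n⟩ (annihilate ⟨j, m⟩ v) μ := by
  simp only [kineticDensity, fieldOpDagger, laplacianFieldOp, Finset.sum_apply, Pi.smul_apply,
    create_sum, smul_eq_mul, Finset.mul_sum, mul_assoc]

/-- The matrix `⟨μ| a_n† a_m C - C a_n† a_m |ν⟩`. -/
def ladderCommutator (n m : Modes M) (c : Kernel M) : Kernel M := fun μ ν =>
  create n (annihilate m fun κ => c κ ν) μ - create m (annihilate n (c μ)) ν

lemma commutatorKernel_kineticDensity (j : J) (x : EuclideanSpace ℝ (Fin d)) (c : Kernel M)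
    (μ ν : Occ M) : commutatorKernel (kineticDensity φ j x) c μ ν =
      ∑ n, ∑ m, conj (φ j n x) * (Δ (φ j m)) x * ladderCommutator ⟨j, n⟩ ⟨j, m⟩ c μ ν := by
  have h : HasSum (fun κ => c μ κ * kineticDensity φ j x (numState ν) κ)
      (∑ n, ∑ m, conj (φ j n x) * (Δ (φ j m)) x *
        create ⟨j, m⟩ (annihilate ⟨j, n⟩ (c μ)) ν) := by
    have h1 := hasSum_sum (s := Finset.univ) fun n _ => hasSum_sum (s := Finset.univ) fun m _ =>
      (hasSum_mul_create_annihilate_numState ⟨j, n⟩ ⟨j, m⟩ (c μ) ν).mul_left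
        (conj (φ j n x) * (Δ (φ j m)) x)
    refine (iff_of_eq (congrArg (HasSum · _ _) (funext fun κ => Eq.symm ?_))).mp h1
    rw [kineticDensity_apply, Finset.mul_sum]
    refine Finset.sum_congr rfl fun n _ => ?_
    rw [Finset.mul_sum]
    exact Finset.sum_congr rfl fun m _ => by ring
  rw [commutatorKernel, h.tsum_eq, kineticDensity_apply, ← Finset.sum_sub_distrib]
  refine Finset.sum_congr rfl fun n _ => ?_
  rw [← Finset.sum_sub_distrib]
  exact Finset.sum_congr rfl fun m _ => by rw [ladderCommutator]; ring

/-- The matrix elements of the Laplacian between the modes of one component. -/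
def kineticMatrix (R : Set (EuclideanSpace ℝ (Fin d)))
    (φ : ∀ j, M j → EuclideanSpace ℝ (Fin d) → ℂ) (j : J) (n m : M j) : ℂ :=
  ∫ x in R, conj (φ j n x) * (Δ (φ j m)) x

lemma kineticCommutator_eq
    (hkin : ∀ j, ∀ n m : M j, IntegrableOn (fun x => conj (φ j n x) * (Δ (φ j m)) x) R)
    (j : J) (c : Kernel M) (μ ν : Occ M) : kineticCommutator R φ j c μ ν =
      ∑ n, ∑ m, kineticMatrix R φ j n m * ladderCommutator ⟨j, n⟩ ⟨j, m⟩ c μ ν := by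
  simp only [kineticCommutator, commutatorKernel_kineticDensity, kineticMatrix]
  rw [integral_finsetSum _ fun n _ => integrable_finsetSum _ fun m _ =>
    (hkin j n m).mul_const _]
  refine Finset.sum_congr rfl fun n _ => ?_
  rw [integral_finsetSum _ fun m _ => (hkin j n m).mul_const _]
  exact Finset.sum_congr rfl fun m _ => integral_mul_const _ _

end Kinetic

section Pairing

variable {J : Type*} {M : J → Type*} [Fintype J] [∀ j, Fintype (M j)]

open Classical in
lemma hasLineDerivAt_unitWigner (μ ν : Occ M) (i : Modes M) (α : Amp M) (v : ℂ) :
    HasLineDerivAt ℝ (unitWigner μ ν)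
      (modeWignerDz (μ i) (ν i) (α i) * modeProdErase modeWigner i μ ν α * v +
        modeWignerDzConj (μ i) (ν i) (α i) * modeProdErase modeWigner i μ ν α * conj v)
      α (Pi.single i v) := by
  have h : ∀ t : ℝ, unitWigner μ ν (α + t • (Pi.single i v : Amp M)) =
      modeWigner (μ i) (ν i) (α i + t • v) * modeProdErase modeWigner i μ ν α := fun t => by
    rw [unitWigner, modeProd_eq_mul_erase modeWigner i (fun _ _ => rfl) (fun _ _ => rfl)
      (α := α) fun l hl => by simp [hl]]
    simp
  have h1 := HasDerivAt.mul_const (hasLineDerivAt_modeWigner (μ i) (ν i) (α i) v)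
    (modeProdErase modeWigner i μ ν α)
  rw [HasLineDerivAt, funext h]
  exact h1.congr_deriv (by ring)

lemma wirtinger_unitWigner (μ ν : Occ M) (i : Modes M) (α : Amp M) :
    wirtinger i (unitWigner μ ν) α =
        modeWignerDz (μ i) (ν i) (α i) * modeProdErase modeWigner i μ ν α ∧
      wirtingerConj i (unitWigner μ ν) α =
        modeWignerDzConj (μ i) (ν i) (α i) * modeProdErase modeWigner i μ ν α :=
  wirtinger_of_hasLineDerivAt (hasLineDerivAt_unitWigner μ ν i α)

/-- The pairing of the Wigner function of `|μ⟩⟨ν|` with a test function. -/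
def unitPairing (g : Amp M → ℂ) (μ ν : Occ M) : ℂ := ∫ α, unitWigner μ ν α * g α

/-- The operator `α_i + (s/2) ∂/∂α_i^*`. -/
def shift (s : ℂ) (i : Modes M) (g : Amp M → ℂ) (α : Amp M) : ℂ :=
  α i * g α + s / 2 * wirtingerConj i g α

/-- The operator `α_i^* + (s/2) ∂/∂α_i`. -/
def shiftConj (s : ℂ) (i : Modes M) (g : Amp M → ℂ) (α : Amp M) : ℂ :=
  conj (α i) * g α + s / 2 * wirtinger i g α

variable {g : Amp M → ℂ}

lemma IsTest.shift (hg : IsTest g) (s : ℂ) (i : Modes M) : IsTest (FieldWigner.shift s i g) :=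
  (hg.mul_left (contDiff_amp i)).add ((hg.wirtingerConj i).const_mul _)

lemma IsTest.shiftConj (hg : IsTest g) (s : ℂ) (i : Modes M) :
    IsTest (FieldWigner.shiftConj s i g) :=
  (hg.mul_left (contDiff_conj_amp i)).add ((hg.wirtinger i).const_mul _)

/-- `shift s i` is the transpose of `shift (-s) i`. -/
lemma integral_shift_mul {F : Amp M → ℂ} (hF : ContDiff ℝ 1 F) (hg : IsTest g) (s : ℂ)
    (i : Modes M) : ∫ α, shift s i F α * g α = ∫ α, F α * shift (-s) i g α := by
  have h := (integral_wirtinger_mul hF hg i).2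
  have h1 : Integrable fun α => F α * (α i * g α) :=
    (hg.mul_left (contDiff_amp i)).integrable_mul hF.continuous.locallyIntegrable
  have h2 : Integrable fun α => wirtingerConj i F α * g α :=
    hg.integrable_mul (continuous_wirtinger hF i).2.locallyIntegrable
  have h3 : Integrable fun α => F α * wirtingerConj i g α :=
    (hg.wirtingerConj i).integrable_mul hF.continuous.locallyIntegrable
  have e1 : ∀ α, shift s i F α * g α =
      F α * (α i * g α) + s / 2 * (wirtingerConj i F α * g α) := fun α => by
    rw [shift]; ring
  have e2 : ∀ α, F α * shift (-s) i g α =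
      F α * (α i * g α) + -s / 2 * (F α * wirtingerConj i g α) := fun α => by
    rw [shift]; ring
  simp only [e1, e2]
  rw [integral_add h1 (h2.const_mul _), integral_add h1 (h3.const_mul _), integral_const_mul,
    integral_const_mul, h]
  ring

/-- `shiftConj s i` is the transpose of `shiftConj (-s) i`. -/
lemma integral_shiftConj_mul {F : Amp M → ℂ} (hF : ContDiff ℝ 1 F) (hg : IsTest g) (s : ℂ)
    (i : Modes M) : ∫ α, shiftConj s i F α * g α = ∫ α, F α * shiftConj (-s) i g α := by
  have h := (integral_wirtinger_mul hF hg i).1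
  have h1 : Integrable fun α => F α * (conj (α i) * g α) :=
    (hg.mul_left (contDiff_conj_amp i)).integrable_mul hF.continuous.locallyIntegrable
  have h2 : Integrable fun α => wirtinger i F α * g α :=
    hg.integrable_mul (continuous_wirtinger hF i).1.locallyIntegrable
  have h3 : Integrable fun α => F α * wirtinger i g α :=
    (hg.wirtinger i).integrable_mul hF.continuous.locallyIntegrable
  have e1 : ∀ α, shiftConj s i F α * g α =
      F α * (conj (α i) * g α) + s / 2 * (wirtinger i F α * g α) := fun α => by
    rw [shiftConj]; ring
  have e2 : ∀ α, F α * shiftConj (-s) i g α =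
      F α * (conj (α i) * g α) + -s / 2 * (F α * wirtinger i g α) := fun α => by
    rw [shiftConj]; ring
  simp only [e1, e2]
  rw [integral_add h1 (h2.const_mul _), integral_add h1 (h3.const_mul _), integral_const_mul,
    integral_const_mul, h]
  ring

lemma contDiff_one_unitWigner (μ ν : Occ M) : ContDiff ℝ 1 (unitWigner μ ν) :=
  (contDiff_unitWigner μ ν).of_le (by exact_mod_cast le_top)

lemma annihilate_unitPairing_left (hg : IsTest g) (i : Modes M) (μ ν : Occ M) :
    annihilate i (fun κ => unitPairing g κ ν) μ = unitPairing (shiftConj 1 i g) μ ν := by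
  have h := integral_shiftConj_mul (contDiff_one_unitWigner μ ν) hg (-1) i
  rw [neg_neg] at h
  rw [annihilate, unitPairing, unitPairing, ← h, ← integral_const_mul]
  refine integral_congr_ae (Eventually.of_forall fun α => ?_)
  have hl := modeWigner_create_left (μ i) (ν i) (α i)
  simp only [shiftConj, wirtinger_unitWigner]
  simp only [unitWigner, modeProd_add_left, modeProd_self _ i μ ν]
  linear_combination (modeProdErase modeWigner i μ ν α * g α) * hl

lemma annihilate_unitPairing_right (hg : IsTest g) (i : Modes M) (μ ν : Occ M) :
    annihilate i (fun κ => unitPairing g μ κ) ν = unitPairing (shift 1 i g) μ ν := by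
  have h := integral_shift_mul (contDiff_one_unitWigner μ ν) hg (-1) i
  rw [neg_neg] at h
  rw [annihilate, unitPairing, unitPairing, ← h, ← integral_const_mul]
  refine integral_congr_ae (Eventually.of_forall fun α => ?_)
  have hl := modeWigner_annihilate_right (μ i) (ν i) (α i)
  simp only [shift, wirtinger_unitWigner]
  simp only [unitWigner, modeProd_add_right, modeProd_self _ i μ ν]
  linear_combination (modeProdErase modeWigner i μ ν α * g α) * hl

lemma create_unitPairing_left (hg : IsTest g) (i : Modes M) (μ ν : Occ M) :
    create i (fun κ => unitPairing g κ ν) μ = unitPairing (shift (-1) i g) μ ν := by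
  have h := integral_shift_mul (contDiff_one_unitWigner μ ν) hg 1 i
  rw [create, unitPairing, unitPairing, ← h, ← integral_const_mul]
  refine integral_congr_ae (Eventually.of_forall fun α => ?_)
  have hl := modeWigner_annihilate_left (μ i) (ν i) (α i)
  simp only [shift, wirtinger_unitWigner]
  simp only [unitWigner, modeProd_sub_left, modeProd_self _ i μ ν]
  linear_combination (modeProdErase modeWigner i μ ν α * g α) * hl

lemma create_unitPairing_right (hg : IsTest g) (i : Modes M) (μ ν : Occ M) :
    create i (fun κ => unitPairing g μ κ) ν = unitPairing (shiftConj (-1) i g) μ ν := by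
  have h := integral_shiftConj_mul (contDiff_one_unitWigner μ ν) hg 1 i
  rw [create, unitPairing, unitPairing, ← h, ← integral_const_mul]
  refine integral_congr_ae (Eventually.of_forall fun α => ?_)
  have hl := modeWigner_create_right (μ i) (ν i) (α i)
  simp only [shiftConj, wirtinger_unitWigner]
  simp only [unitWigner, modeProd_sub_right, modeProd_self _ i μ ν]
  linear_combination (modeProdErase modeWigner i μ ν α * g α) * hl

/-- On test functions the commutator with `a_n† a_m` is a first-order differential operator: the
terms of order zero and two cancel. -/
lemma shift_shiftConj_sub (hg : IsTest g) (n m : Modes M) (α : Amp M) :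
    shift (-1) m (shiftConj 1 n g) α - shiftConj (-1) n (shift 1 m g) α =
      α m * wirtinger n g α - conj (α n) * wirtingerConj m g α := by
  classical
  have hd := hg.differentiable
  have ha : ∀ k : Modes M, DifferentiableAt ℝ (fun β : Amp M => β k) α := fun k =>
    (contDiff_amp (N := 1) k).differentiable (by simp) α
  have hb : ∀ k : Modes M, DifferentiableAt ℝ (fun β : Amp M => conj (β k)) α := fun k =>
    (contDiff_conj_amp (N := 1) k).differentiable (by simp) α
  have e1 : wirtingerConj m (shiftConj 1 n g) α = (if n = m then 1 else 0) * g α +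
      conj (α n) * wirtingerConj m g α + 1 / 2 * wirtingerConj m (wirtinger n g) α := by
    have : shiftConj 1 n g = fun β => conj (β n) * g β + 1 / 2 * wirtinger n g β := rfl
    rw [this, wirtingerConj_add ((hb n).fun_mul (hd α))
      (((hg.wirtinger n).differentiable α).const_mul _), wirtingerConj_mul (hb n) (hd α),
      wirtingerConj_const_mul ((hg.wirtinger n).differentiable α), (wirtinger_conj_apply m n α).2]
  have e2 : wirtinger n (shift 1 m g) α = (if m = n then 1 else 0) * g α +
      α m * wirtinger n g α + 1 / 2 * wirtinger n (wirtingerConj m g) α := by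
    have : shift 1 m g = fun β => β m * g β + 1 / 2 * wirtingerConj m g β := rfl
    rw [this, wirtinger_add ((ha m).fun_mul (hd α))
      (((hg.wirtingerConj m).differentiable α).const_mul _), wirtinger_mul (ha m) (hd α),
      wirtinger_const_mul ((hg.wirtingerConj m).differentiable α), (wirtinger_apply n m α).1]
  have e3 : shift (-1) m (shiftConj 1 n g) α =
      α m * shiftConj 1 n g α + -1 / 2 * wirtingerConj m (shiftConj 1 n g) α := rfl
  have e4 : shiftConj (-1) n (shift 1 m g) α =
      conj (α n) * shift 1 m g α + -1 / 2 * wirtinger n (shift 1 m g) α := rfl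
  rw [e3, e4, e1, e2, hg.wirtinger_comm m n α, shift, shiftConj,
    if_congr (eq_comm (a := n) (b := m)) rfl rfl]
  ring

/-- If the matrix `c` sums against test functions to `w`, then its commutator with `a_n† a_m` sums
to the transposed first-order operator. -/
lemma hasSum_ladderCommutator_mul {c : Kernel M} {w : Amp M → ℂ} (hw : LocallyIntegrable w)
    (hc : ∀ h, IsTest h →
      HasSum (fun p : Occ M × Occ M => c p.1 p.2 * unitPairing h p.1 p.2) (∫ α, w α * h α))
    (hg : IsTest g) (n m : Modes M) :
    HasSum (fun p : Occ M × Occ M => ladderCommutator n m c p.1 p.2 * unitPairing g p.1 p.2)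
      (∫ α, w α * (α m * wirtinger n g α - conj (α n) * wirtingerConj m g α)) := by
  have h1 := (hg.shiftConj 1 n).shift (-1) m
  have h2 := (hg.shift 1 m).shiftConj (-1) n
  have s1 := (hasSum_create_annihilate_mul n m c (unitPairing g)
    (∫ α, w α * shift (-1) m (shiftConj 1 n g) α)).mpr (by
      have e : ∀ ν, (annihilate n fun κ => unitPairing g κ ν) =
          fun κ => unitPairing (shiftConj 1 n g) κ ν := fun ν =>
        funext fun κ => annihilate_unitPairing_left hg n κ ν
      simp only [e, create_unitPairing_left (hg.shiftConj 1 n)]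
      exact hc _ h1)
  have s2 := (hasSum_create_annihilate_mul m n (fun κ b => c b κ) (fun κ b => unitPairing g b κ)
    (∫ α, w α * shiftConj (-1) n (shift 1 m g) α)).mpr (by
      have e : ∀ μ, (annihilate m fun κ => unitPairing g μ κ) =
          fun κ => unitPairing (shift 1 m g) μ κ := fun μ =>
        funext fun κ => annihilate_unitPairing_right hg m μ κ
      simp only [e, create_unitPairing_right (hg.shift 1 m)]
      exact (Equiv.prodComm _ _).hasSum_iff.mpr (hc _ h2))
  have s3 := s1.sub ((Equiv.prodComm (Occ M) (Occ M)).hasSum_iff.mpr s2)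
  rw [← integral_sub (h1.integrable_mul hw) (h2.integrable_mul hw)] at s3
  simp only [← mul_sub, shift_shiftConj_sub hg] at s3
  refine (iff_of_eq (congrArg (HasSum · _ _) (funext fun p => Eq.symm ?_))).mp s3
  simp only [Function.comp_apply, Equiv.prodComm_apply, Prod.fst_swap, Prod.snd_swap,
    ladderCommutator]
  ring

end Pairing

/-! ### The kinetic operator in terms of the mode amplitudes -/

section KineticOp

variable {d : ℕ} {J : Type*} {M : J → Type*} [∀ j, Fintype (M j)]
  {R : Set (EuclideanSpace ℝ (Fin d))} {φ : ∀ j, M j → EuclideanSpace ℝ (Fin d) → ℂ}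

lemma laplacian_compose (hR : IsOpen R) (hsmooth : ∀ j n, ContDiffOn ℝ 2 (φ j n) R) (j : J)
    (α : Amp M) {x : EuclideanSpace ℝ (Fin d)} (hx : x ∈ R) :
    (Δ (compose φ j α)) x = ∑ m, (Δ (φ j m)) x * α ⟨j, m⟩ := by
  classical
  have hs : ∀ m, ContDiffAt ℝ 2 (φ j m) x := fun m => (hsmooth j m).contDiffAt (hR.mem_nhds hx)
  have hs' : ∀ m, ContDiffAt ℝ 2 (α ⟨j, m⟩ • φ j m) x := fun m =>
    (hs m).const_smul (α ⟨j, m⟩)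
  have h : ∀ s : Finset (M j), (Δ (∑ m ∈ s, α ⟨j, m⟩ • φ j m)) x =
      ∑ m ∈ s, (Δ (φ j m)) x * α ⟨j, m⟩ := by
    intro s
    induction s using Finset.induction_on with
    | empty =>
      rw [Finset.sum_empty, Finset.sum_empty]
      exact congrFun (InnerProductSpace.laplacian_const (c := (0 : ℂ))) x
    | insert m s hm ih =>
      have h2 : ContDiffAt ℝ 2 (∑ m ∈ s, α ⟨j, m⟩ • φ j m) x := by
        rw [Finset.sum_fn]
        exact ContDiffAt.sum fun m _ => hs' m
      rw [Finset.sum_insert hm, Finset.sum_insert hm,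
        (hs' m).laplacian_add h2, ih,
        InnerProductSpace.laplacian_smul _ (hs m), smul_eq_mul, mul_comm]
  have hc : compose φ j α = ∑ m, α ⟨j, m⟩ • φ j m := by
    ext y
    simp only [compose, Finset.sum_apply, Pi.smul_apply, smul_eq_mul, mul_comm]
  rw [hc, h]

lemma laplacian_conj (f : EuclideanSpace ℝ (Fin d) → ℂ) (x : EuclideanSpace ℝ (Fin d)) :
    (Δ (fun y => conj (f y))) x = conj ((Δ f) x) :=
  congrFun (InnerProductSpace.laplacian_CLE_comp_left (f := f) (l := Complex.conjCLE)) x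

/-- Green's identity turns the Laplacian on the conjugate field into the one on the field, so that
both parts of the kinetic operators have the same coefficients. -/
lemma integral_kinetic_sum (hR : IsOpen R)
    (hkin : ∀ j, ∀ n m : M j, IntegrableOn (fun x => conj (φ j n x) * (Δ (φ j m)) x) R) (j : J)
    (hK : ∀ n m, conj (kineticMatrix R φ j n m) = kineticMatrix R φ j m n)
    (a b : M j → M j → ℂ) {f : EuclideanSpace ℝ (Fin d) → ℂ}
    (hf : ∀ x ∈ R, f x = ∑ n, ∑ m, (conj (φ j n x) * (Δ (φ j m)) x * a n m +
      conj (conj (φ j m x) * (Δ (φ j n)) x) * b n m)) :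
    ∫ x in R, f x = ∑ n, ∑ m, kineticMatrix R φ j n m * (a n m + b n m) := by
  have h1 : ∀ n m, IntegrableOn (fun x => conj (φ j n x) * (Δ (φ j m)) x * a n m) R :=
    fun n m => (hkin j n m).mul_const _
  have h2 : ∀ n m, IntegrableOn (fun x => conj (conj (φ j m x) * (Δ (φ j n)) x) * b n m) R :=
    fun n m => (Complex.conjCLE.toContinuousLinearMap.integrable_comp (hkin j m n)).mul_const _
  have h3 : ∀ n m, IntegrableOn (fun x => conj (φ j n x) * (Δ (φ j m)) x * a n m +
      conj (conj (φ j m x) * (Δ (φ j n)) x) * b n m) R := fun n m => (h1 n m).add (h2 n m)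
  rw [setIntegral_congr_fun hR.measurableSet hf, integral_finsetSum _ fun n _ =>
    integrable_finsetSum _ fun m _ => h3 n m]
  refine Finset.sum_congr rfl fun n _ => ?_
  rw [integral_finsetSum _ fun m _ => h3 n m]
  refine Finset.sum_congr rfl fun m _ => ?_
  rw [integral_add (h1 n m) (h2 n m), integral_mul_const, integral_mul_const, integral_conj]
  change kineticMatrix R φ j n m * _ + conj (kineticMatrix R φ j m n) * _ = _
  rw [hK]
  ring

variable [Fintype J]

lemma kineticOpTranspose_eq (hR : IsOpen R) (hsmooth : ∀ j n, ContDiffOn ℝ 2 (φ j n) R)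
    (hkin : ∀ j, ∀ n m : M j, IntegrableOn (fun x => conj (φ j n x) * (Δ (φ j m)) x) R) (j : J)
    (hK : ∀ n m, conj (kineticMatrix R φ j n m) = kineticMatrix R φ j m n)
    (g : Amp M → ℂ) (α : Amp M) : kineticOpTranspose R φ j g α =
      ∑ n, ∑ m, kineticMatrix R φ j n m * (α ⟨j, m⟩ * wirtinger ⟨j, n⟩ g α -
        conj (α ⟨j, n⟩) * wirtingerConj ⟨j, m⟩ g α) := by
  simp only [sub_eq_add_neg]
  refine integral_kinetic_sum hR hkin j hK _ _ fun x hx => ?_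
  rw [laplacian_conj, laplacian_compose hR hsmooth j α hx, funcDeriv, funcDerivConj, map_sum,
    Finset.sum_mul_sum, Finset.sum_comm, Finset.sum_mul_sum, ← Finset.sum_sub_distrib]
  refine Finset.sum_congr rfl fun n _ => ?_
  rw [← Finset.sum_sub_distrib]
  refine Finset.sum_congr rfl fun m _ => ?_
  simp only [map_mul, Complex.conj_conj]
  ring

lemma wirtinger_sum {ι : Type*} (s : Finset ι) {f : ι → Amp M → ℂ} {α : Amp M}
    (hf : ∀ m ∈ s, DifferentiableAt ℝ (f m) α) (i : Modes M) :
    wirtinger i (fun β => ∑ m ∈ s, f m β) α = ∑ m ∈ s, wirtinger i (f m) α ∧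
      wirtingerConj i (fun β => ∑ m ∈ s, f m β) α = ∑ m ∈ s, wirtingerConj i (f m) α := by
  classical
  rw [wirtinger_eq_fderiv (DifferentiableAt.fun_sum hf),
    wirtingerConj_eq_fderiv (DifferentiableAt.fun_sum hf), fderiv_fun_sum hf,
    Finset.sum_congr rfl fun m hm => wirtinger_eq_fderiv (hf m hm) i,
    Finset.sum_congr rfl fun m hm => wirtingerConj_eq_fderiv (hf m hm) i]
  simp [Finset.mul_sum, Finset.sum_add_distrib, mul_add, mul_sub]

lemma kineticOp_eq (hR : IsOpen R) (hsmooth : ∀ j n, ContDiffOn ℝ 2 (φ j n) R)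
    (hkin : ∀ j, ∀ n m : M j, IntegrableOn (fun x => conj (φ j n x) * (Δ (φ j m)) x) R) (j : J)
    (hK : ∀ n m, conj (kineticMatrix R φ j n m) = kineticMatrix R φ j m n)
    {F : Amp M → ℂ} (hF : Differentiable ℝ F) (α : Amp M) : kineticOp R φ j F α =
      ∑ n, ∑ m, kineticMatrix R φ j n m * (-wirtinger ⟨j, n⟩ (fun β => β ⟨j, m⟩ * F β) α +
        wirtingerConj ⟨j, m⟩ (fun β => conj (β ⟨j, n⟩) * F β) α) := by
  have hd1 : ∀ k : Modes M, DifferentiableAt ℝ (fun β : Amp M => β k * F β) α := fun k =>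
    ((contDiff_amp (N := 1) k).differentiable (by simp) α).fun_mul (hF α)
  have hd2 : ∀ k : Modes M, DifferentiableAt ℝ (fun β : Amp M => conj (β k) * F β) α := fun k =>
    ((contDiff_conj_amp (N := 1) k).differentiable (by simp) α).fun_mul (hF α)
  refine integral_kinetic_sum hR hkin j hK _ _ fun x hx => ?_
  have e1 : (fun β => (Δ (compose φ j β)) x * F β) =
      fun β => ∑ m, (Δ (φ j m)) x * (β ⟨j, m⟩ * F β) := funext fun β => by
    rw [laplacian_compose hR hsmooth j β hx, Finset.sum_mul]
    exact Finset.sum_congr rfl fun m _ => by ring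
  have e2 : (fun β => (Δ (fun y => conj (compose φ j β y))) x * F β) =
      fun β => ∑ n, conj ((Δ (φ j n)) x) * (conj (β ⟨j, n⟩) * F β) := funext fun β => by
    rw [laplacian_conj, laplacian_compose hR hsmooth j β hx, map_sum, Finset.sum_mul]
    exact Finset.sum_congr rfl fun m _ => by rw [map_mul]; ring
  rw [e1, e2, funcDeriv, funcDerivConj]
  simp only [(wirtinger_sum Finset.univ (fun m _ => (hd1 ⟨j, m⟩).const_mul _) _).1,
    (wirtinger_sum Finset.univ (fun n _ => (hd2 ⟨j, n⟩).const_mul _) _).2,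
    fun m i => wirtinger_const_mul (hd1 ⟨j, m⟩) ((Δ (φ j m)) x) i,
    fun n i => wirtingerConj_const_mul (hd2 ⟨j, n⟩) (conj ((Δ (φ j n)) x)) i, Finset.mul_sum]
  rw [Finset.sum_comm (f := fun m n => φ j m x * _), ← Finset.sum_neg_distrib,
    ← Finset.sum_add_distrib]
  refine Finset.sum_congr rfl fun n _ => ?_
  rw [← Finset.sum_neg_distrib, ← Finset.sum_add_distrib]
  refine Finset.sum_congr rfl fun m _ => ?_
  simp only [map_mul, Complex.conj_conj]
  ring

lemma integral_mul_kineticOpTranspose (hR : IsOpen R)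
    (hsmooth : ∀ j n, ContDiffOn ℝ 2 (φ j n) R)
    (hkin : ∀ j, ∀ n m : M j, IntegrableOn (fun x => conj (φ j n x) * (Δ (φ j m)) x) R) (j : J)
    (hK : ∀ n m, conj (kineticMatrix R φ j n m) = kineticMatrix R φ j m n)
    {w g : Amp M → ℂ} (hw : LocallyIntegrable w) (hg : IsTest g) :
    ∫ α, w α * kineticOpTranspose R φ j g α =
      ∑ n, ∑ m, kineticMatrix R φ j n m * ∫ α, w α * (α ⟨j, m⟩ * wirtinger ⟨j, n⟩ g α -
        conj (α ⟨j, n⟩) * wirtingerConj ⟨j, m⟩ g α) := by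
  have hi : ∀ n m, Integrable fun α => kineticMatrix R φ j n m *
      (w α * (α ⟨j, m⟩ * wirtinger ⟨j, n⟩ g α -
        conj (α ⟨j, n⟩) * wirtingerConj ⟨j, m⟩ g α)) := fun n m => by
    simp only [mul_sub]
    exact ((((hg.wirtinger ⟨j, n⟩).mul_left (contDiff_amp ⟨j, m⟩)).integrable_mul hw).const_mul
      _).sub ((((hg.wirtingerConj ⟨j, m⟩).mul_left (contDiff_conj_amp ⟨j, n⟩)).integrable_mul
        hw).const_mul _)
  simp only [kineticOpTranspose_eq hR hsmooth hkin j hK, Finset.mul_sum]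
  simp only [mul_left_comm (w _) (kineticMatrix R φ j _ _)]
  rw [integral_finsetSum _ fun n _ => integrable_finsetSum _ fun m _ => hi n m]
  refine Finset.sum_congr rfl fun n _ => ?_
  rw [integral_finsetSum _ fun m _ => hi n m]
  exact Finset.sum_congr rfl fun m _ => integral_const_mul _ _

/-- `kineticOpTranspose` is the transpose of `kineticOp`. -/
lemma integral_kineticOp_mul (hR : IsOpen R)
    (hsmooth : ∀ j n, ContDiffOn ℝ 2 (φ j n) R)
    (hkin : ∀ j, ∀ n m : M j, IntegrableOn (fun x => conj (φ j n x) * (Δ (φ j m)) x) R) (j : J)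
    (hK : ∀ n m, conj (kineticMatrix R φ j n m) = kineticMatrix R φ j m n)
    {F g : Amp M → ℂ} (hF : ContDiff ℝ 1 F) (hg : IsTest g) :
    ∫ α, kineticOp R φ j F α * g α = ∫ α, F α * kineticOpTranspose R φ j g α := by
  have hd1 : ∀ k : Modes M, ContDiff ℝ 1 (fun β : Amp M => β k * F β) := fun k =>
    (contDiff_amp k).mul hF
  have hd2 : ∀ k : Modes M, ContDiff ℝ 1 (fun β : Amp M => conj (β k) * F β) := fun k =>
    (contDiff_conj_amp k).mul hF
  have hi1 : ∀ n m : M j, Integrable fun α =>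
      wirtinger ⟨j, n⟩ (fun β => β ⟨j, m⟩ * F β) α * g α := fun n m =>
    hg.integrable_mul (continuous_wirtinger (hd1 _) _).1.locallyIntegrable
  have hi2 : ∀ n m : M j, Integrable fun α =>
      wirtingerConj ⟨j, m⟩ (fun β => conj (β ⟨j, n⟩) * F β) α * g α := fun n m =>
    hg.integrable_mul (continuous_wirtinger (hd2 _) _).2.locallyIntegrable
  have hi : ∀ n m : M j, Integrable fun α => kineticMatrix R φ j n m *
      (-wirtinger ⟨j, n⟩ (fun β => β ⟨j, m⟩ * F β) α +
        wirtingerConj ⟨j, m⟩ (fun β => conj (β ⟨j, n⟩) * F β) α) * g α := fun n m => by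
    refine (((hi1 n m).neg.add (hi2 n m)).const_mul (kineticMatrix R φ j n m)).congr
      (Eventually.of_forall fun α => ?_)
    simp only [Pi.add_apply, Pi.neg_apply]
    ring
  rw [integral_mul_kineticOpTranspose hR hsmooth hkin j hK hF.continuous.locallyIntegrable hg]
  simp only [kineticOp_eq hR hsmooth hkin j hK (hF.differentiable one_ne_zero), Finset.sum_mul]
  rw [integral_finsetSum _ fun n _ => integrable_finsetSum _ fun m _ => hi n m]
  refine Finset.sum_congr rfl fun n _ => ?_
  rw [integral_finsetSum _ fun m _ => hi n m]
  refine Finset.sum_congr rfl fun m _ => ?_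
  simp only [mul_assoc, add_mul, neg_mul]
  rw [integral_const_mul, integral_add (f := fun α => -_) (hi1 n m).neg (hi2 n m), integral_neg,
    (integral_wirtinger_mul (hd1 ⟨j, m⟩) hg ⟨j, n⟩).1,
    (integral_wirtinger_mul (hd2 ⟨j, n⟩) hg ⟨j, m⟩).2, neg_neg, ← sub_eq_add_neg, ← integral_sub]
  · congr 2
    ext α
    ring
  · exact (hg.wirtinger _).integrable_mul (hd1 _).continuous.locallyIntegrable
  · exact (hg.wirtingerConj _).integrable_mul (hd2 _).continuous.locallyIntegrable

lemma continuous_kineticOp (hR : IsOpen R)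
    (hsmooth : ∀ j n, ContDiffOn ℝ 2 (φ j n) R)
    (hkin : ∀ j, ∀ n m : M j, IntegrableOn (fun x => conj (φ j n x) * (Δ (φ j m)) x) R) (j : J)
    (hK : ∀ n m, conj (kineticMatrix R φ j n m) = kineticMatrix R φ j m n)
    {F : Amp M → ℂ} (hF : ContDiff ℝ 1 F) : Continuous (kineticOp R φ j F) := by
  rw [show kineticOp R φ j F = _ from funext fun α =>
    kineticOp_eq hR hsmooth hkin j hK (hF.differentiable one_ne_zero) α]
  refine continuous_finsetSum _ fun n _ => continuous_finsetSum _ fun m _ =>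
    continuous_const.mul ?_
  exact (continuous_wirtinger ((contDiff_amp _).mul hF) _).1.neg.add
    (continuous_wirtinger ((contDiff_conj_amp _).mul hF) _).2

/-- If the matrix `c` sums against test functions to `w`, then its kinetic commutator sums to the
kinetic operator applied to `w` in the sense of distributions. -/
lemma hasSum_kineticCommutator_mul (hR : IsOpen R)
    (hsmooth : ∀ j n, ContDiffOn ℝ 2 (φ j n) R)
    (hkin : ∀ j, ∀ n m : M j, IntegrableOn (fun x => conj (φ j n x) * (Δ (φ j m)) x) R) (j : J)
    (hK : ∀ n m, conj (kineticMatrix R φ j n m) = kineticMatrix R φ j m n)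
    {c : Kernel M} {w : Amp M → ℂ} (hw : LocallyIntegrable w)
    (hc : ∀ h, IsTest h →
      HasSum (fun p : Occ M × Occ M => c p.1 p.2 * unitPairing h p.1 p.2) (∫ α, w α * h α))
    {g : Amp M → ℂ} (hg : IsTest g) :
    HasSum (fun p : Occ M × Occ M => kineticCommutator R φ j c p.1 p.2 * unitPairing g p.1 p.2)
      (∫ α, w α * kineticOpTranspose R φ j g α) := by
  rw [integral_mul_kineticOpTranspose hR hsmooth hkin j hK hw hg]
  have h1 := hasSum_sum (s := Finset.univ) fun n _ => hasSum_sum (s := Finset.univ) fun m _ =>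
    (hasSum_ladderCommutator_mul hw hc hg ⟨j, n⟩ ⟨j, m⟩).mul_left (kineticMatrix R φ j n m)
  refine (iff_of_eq (congrArg (HasSum · _ _) (funext fun p => Eq.symm ?_))).mp h1
  rw [kineticCommutator_eq hkin, Finset.sum_mul]
  refine Finset.sum_congr rfl fun n _ => ?_
  rw [Finset.sum_mul]
  exact Finset.sum_congr rfl fun m _ => mul_assoc _ _ _

/-! ### The identity in the sense of distributions -/

lemma IsOrthonormalModes.integral_wigner_truncate_mul (h : IsOrthonormalModes R φ) (c : Kernel M)
    (s : Finset (Occ M × Occ M)) {g : Amp M → ℂ} (hg : IsTest g) :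
    ∫ α, wigner R φ (truncate c s) α * g α = ∑ p ∈ s, c p.1 p.2 * unitPairing g p.1 p.2 := by
  simp only [h.wigner_truncate, Finset.sum_mul, mul_assoc]
  rw [integral_finsetSum _ fun p _ => (hg.integrable_mul
    (contDiff_unitWigner p.1 p.2).continuous.locallyIntegrable).const_mul _]
  exact Finset.sum_congr rfl fun p _ => integral_const_mul _ _

lemma IsOrthonormalModes.hasSum_of_isWignerL2 (h : IsOrthonormalModes R φ) {c : Kernel M}
    {w : Amp M → ℂ} (hw : IsWignerL2 R φ c w) {g : Amp M → ℂ} (hg : IsTest g) :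
    HasSum (fun p : Occ M × Occ M => c p.1 p.2 * unitPairing g p.1 p.2) (∫ α, w α * g α) := by
  have h1 := tendsto_integral_mul_of_eLpNorm (fun s => by
    rw [funext (h.wigner_truncate c s)]
    exact memLp_sum_mul memLp_unitWigner (fun p => c p.1 p.2) s) hw.1 hg.memLp hw.2
  simpa only [h.integral_wigner_truncate_mul c _ hg] using! h1

theorem IsOrthonormalModes.isWignerDistribution (h : IsOrthonormalModes R φ) (hR : IsOpen R)
    (hsmooth : ∀ j n, ContDiffOn ℝ 2 (φ j n) R)
    (hkin : ∀ j, ∀ n m : M j, IntegrableOn (fun x => conj (φ j n x) * (Δ (φ j m)) x) R) (j : J)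
    (hK : ∀ n m, conj (kineticMatrix R φ j n m) = kineticMatrix R φ j m n)
    {c : Kernel M} {w : Amp M → ℂ} (hw : IsWignerL2 R φ c w) :
    IsWignerDistribution R φ (kineticCommutator R φ j c)
      (fun g => ∫ α, w α * kineticOpTranspose R φ j g α) := by
  intro g hg1 hg2
  have hg : IsTest g := ⟨hg1, hg2⟩
  simp only [h.integral_wigner_truncate_mul _ _ hg]
  exact hasSum_kineticCommutator_mul hR hsmooth hkin j hK (hw.1.locallyIntegrable (by norm_num))
    (fun f hf => h.hasSum_of_isWignerL2 hw hf) hg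

end KineticOp

/-! ### The characteristic functional of a Hilbert-Schmidt operator -/

section CharFunctional

/-- The columns of the displacement matrix of one mode are square-summable. -/
lemma summable_norm_sq_modeDisp (n : ℕ) (z : ℂ) : Summable fun m => ‖modeDisp m n z‖ ^ 2 := by
  have hs : Summable fun m : ℕ => (((‖z‖ + n) ^ 2) ^ m / (m.factorial : ℝ)) *
      (((1 + ‖z‖) ^ n) ^ 2 / (n.factorial : ℝ)) :=
    (Real.summable_pow_div_factorial ((‖z‖ + n) ^ 2)).mul_right _
  refine hs.of_nonneg_of_le (fun m => by positivity) fun m => ?_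
  have h1 : ‖Complex.exp (z * -conj z / 2)‖ ≤ 1 := by
    rw [norm_exp_neg_normSq, Real.exp_le_one_iff]
    nlinarith [sq_nonneg ‖z‖]
  have h2 : ‖complexHermite m n z (-conj z)‖ ≤ (‖z‖ + n) ^ m * (1 + ‖z‖) ^ n := by
    simpa using norm_complexHermite_le m n z (-conj z)
  have hf : ∀ k : ℕ, ‖(Real.sqrt (k.factorial : ℝ) : ℂ)‖ ^ 2 = k.factorial := fun k => by
    rw [Complex.norm_real, Real.norm_of_nonneg (Real.sqrt_nonneg _), Real.sq_sqrt (by positivity)]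
  have h3 : ‖Complex.exp (z * -conj z / 2)‖ * ‖complexHermite m n z (-conj z)‖ ≤
      (‖z‖ + n) ^ m * (1 + ‖z‖) ^ n :=
    (mul_le_of_le_one_left (norm_nonneg _) h1).trans h2
  rw [modeDisp, hermiteFun, norm_div, norm_mul, norm_mul, div_pow,
    mul_pow ‖(Real.sqrt (m.factorial : ℝ) : ℂ)‖, hf, hf, div_mul_div_comm]
  refine div_le_div_of_nonneg_right ?_ (by positivity)
  refine (pow_le_pow_left₀ (by positivity) h3 2).trans (le_of_eq ?_)
  rw [mul_pow, pow_right_comm]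

/-- A product of non-negative summable functions of finitely many independent indices is
summable. -/
lemma summable_prod_apply {ι : Type*} [Fintype ι] {κ : Type*} {f : ι → κ → ℝ}
    (h0 : ∀ i k, 0 ≤ f i k) (hf : ∀ i, Summable (f i)) :
    Summable fun k : ι → κ => ∏ i, f i (k i) := by
  classical
  refine summable_of_sum_le (c := ∏ i, ∑' k, f i k)
    (fun k => Finset.prod_nonneg fun i _ => h0 i _) fun s => ?_
  calc ∑ k ∈ s, ∏ i, f i (k i)
      ≤ ∑ k ∈ Fintype.piFinset fun i => s.image fun k => k i, ∏ i, f i (k i) := by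
        refine Finset.sum_le_sum_of_subset_of_nonneg (fun k hk => ?_)
          fun k _ _ => Finset.prod_nonneg fun i _ => h0 i _
        exact Fintype.mem_piFinset.mpr fun i => Finset.mem_image_of_mem _ hk
    _ = ∏ i, ∑ k ∈ s.image fun k => k i, f i k := (Finset.prod_univ_sum _ _).symm
    _ ≤ ∏ i, ∑' k, f i k := Finset.prod_le_prod
        (fun i _ => Finset.sum_nonneg fun k _ => h0 i k)
        fun i _ => (hf i).sum_le_tsum _ fun k _ => h0 i k

/-- A series that converges in `L²` and pointwise has the same sum in both senses. -/
lemma ae_eq_of_hasSum_Lp {X ι : Type*} [MeasurableSpace X] {m : Measure X} [Countable ι]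
    {f : ι → Lp ℂ 2 m} {F : Lp ℂ 2 m} {g : ι → X → ℂ} {G : X → ℂ} (hfg : ∀ i, f i =ᵐ[m] g i)
    (hF : HasSum f F) (hG : ∀ x, HasSum (fun i => g i x) (G x)) : F =ᵐ[m] G := by
  have hm := tendstoInMeasure_of_tendsto_Lp hF
  rw [SummationFilter.unconditional_filter] at hm
  obtain ⟨s, hs, hae⟩ := hm.exists_seq_tendsto_ae'
  have hsum : ∀ᵐ x ∂m, ∀ k, (∑ i ∈ s k, f i : Lp ℂ 2 m) x = ∑ i ∈ s k, f i x :=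
    ae_all_iff.mpr fun k => Lp.coeFn_fun_finsetSum (s k) f
  filter_upwards [hae, hsum, ae_all_iff.mpr hfg] with x h1 h2 h3
  simp only [h2, h3] at h1
  exact tendsto_nhds_unique h1 ((hG x).comp hs)

variable {d : ℕ} {J : Type*} {M : J → Type*} [Fintype J] [∀ j, Fintype (M j)]
  {R : Set (EuclideanSpace ℝ (Fin d))} {φ : ∀ j, M j → EuclideanSpace ℝ (Fin d) → ℂ}

lemma summable_norm_sq_dispProd (μ : Occ M) (lam : Amp M) :
    Summable fun ν : Occ M => ‖modeProd modeDisp ν μ lam‖ ^ 2 := by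
  simp only [modeProd, norm_prod, ← Finset.prod_pow]
  exact summable_prod_apply (f := fun (i : Modes M) k => ‖modeDisp k (μ i) (lam i)‖ ^ 2)
    (fun i k => sq_nonneg _)
    fun i => summable_norm_sq_modeDisp (μ i) (lam i)

lemma IsOrthonormalModes.hasSum_charDiag (h : IsOrthonormalModes R φ) {c : Kernel M}
    (hc : IsHilbertSchmidtKernel c) (lam : Amp M) (μ : Occ M) :
    HasSum (fun ν => c μ ν * modeProd modeDisp ν μ lam) (charDiag R φ c lam μ) := by
  simp only [charDiag, h.displacementOp_eq]
  refine Summable.hasSum (Summable.of_norm ?_)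
  have h1 : Summable fun ν => ‖c μ ν‖ ^ 2 := hc.prod_factor μ
  refine (h1.add (summable_norm_sq_dispProd μ lam)).of_nonneg_of_le (fun _ => norm_nonneg _)
    fun ν => ?_
  rw [norm_mul]
  nlinarith [sq_nonneg (‖c μ ν‖ - ‖modeProd modeDisp ν μ lam‖), sq_nonneg ‖c μ ν‖,
    sq_nonneg ‖modeProd modeDisp ν μ lam‖]

/-- The characteristic functional of a Hilbert-Schmidt operator is the sum of its expansion in
`L²`. The order of summation in the trace does not matter there. -/
lemma IsOrthonormalModes.hasSum_integral_dispProd_mul (h : IsOrthonormalModes R φ) {c : Kernel M}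
    (hc : IsHilbertSchmidtKernel c) (hs : ∀ lam, Summable fun μ => charDiag R φ c lam μ)
    {f : Amp M → ℂ} (hf : MemLp f 2 volume) :
    HasSum (fun p : Occ M × Occ M => c p.1 p.2 * ∫ lam, modeProd modeDisp p.2 p.1 lam * f lam)
      (∫ lam, charFunctional R φ c lam * f lam) := by
  classical
  have hsum := summable_smul_toLp (m := (volume : Measure (Amp M))) memLp_dispProd
    (C := Real.pi ^ Fintype.card (Modes M)) (by positivity) integral_conj_dispProd_mul hc
  obtain ⟨F, hF⟩ := hsum
  have hrow : ∀ μ, HasSum (fun ν => c μ ν • (memLp_dispProd (μ, ν)).toLp _)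
      (∑' ν, c μ ν • (memLp_dispProd (μ, ν)).toLp _) := fun μ =>
    (hF.summable.prod_factor μ).hasSum
  have hae : ∀ μ, (∑' ν, c μ ν • (memLp_dispProd (μ, ν)).toLp _ : Lp ℂ 2 volume) =ᵐ[volume]
      fun lam => charDiag R φ c lam μ := fun μ =>
    ae_eq_of_hasSum_Lp (g := fun ν lam => c μ ν * modeProd modeDisp ν μ lam)
      (fun ν => by
        filter_upwards [Lp.coeFn_smul (c μ ν) ((memLp_dispProd (μ, ν)).toLp _),
          (memLp_dispProd (μ, ν)).coeFn_toLp] with x h1 h2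
        rw [h1, Pi.smul_apply, h2, smul_eq_mul])
      (hrow μ) fun lam => h.hasSum_charDiag hc lam μ
  have hFX : F =ᵐ[volume] charFunctional R φ c :=
    ae_eq_of_hasSum_Lp hae (hF.prod_fiberwise hrow) fun lam => (hs lam).hasSum
  have h1 := hF.mapL (innerSL ℂ (hf.star.toLp (star f)))
  have e1 : innerSL ℂ (hf.star.toLp (star f)) F = ∫ lam, charFunctional R φ c lam * f lam := by
    rw [innerSL_apply_apply, L2.inner_def]
    refine integral_congr_ae ?_
    filter_upwards [hf.star.coeFn_toLp, hFX] with x hx hy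
    rw [hx, hy, RCLike.inner_apply]
    simp
  rw [e1] at h1
  refine (iff_of_eq (congrArg (HasSum · _ _) (funext fun p => ?_))).mp h1
  rw [innerSL_apply_apply, inner_smul_right, inner_toLp]
  congr 1
  refine integral_congr_ae (Eventually.of_forall fun x => ?_)
  simp [mul_comm]

end CharFunctional

/-! ### Symplectic Fourier transforms of test functions -/

section TestFourier

variable {J : Type*} {M : J → Type*} [Fintype J] [∀ j, Fintype (M j)]

/-- The symplectic Fourier transform of a function of the amplitudes. -/
def ampFourier (g : Amp M → ℂ) (lam : Amp M) : ℂ := ∫ α, ampCharacter α lam * g α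

lemma contDiff_ampCharacter (lam : Amp M) : ContDiff ℝ 1 fun α : Amp M => ampCharacter α lam := by
  unfold ampCharacter character
  refine contDiff_prod fun i _ => Complex.contDiff_exp.comp ?_
  exact (contDiff_const.mul (contDiff_amp i)).sub (contDiff_const.mul (contDiff_conj_amp i))

lemma wirtinger_ampCharacter (i : Modes M) (α lam : Amp M) :
    wirtinger i (fun β => ampCharacter β lam) α = conj (lam i) * ampCharacter α lam ∧
      wirtingerConj i (fun β => ampCharacter β lam) α = -lam i * ampCharacter α lam := by
  classical
  refine wirtinger_of_hasLineDerivAt fun v => ?_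
  -- up to a sign, the two arguments of the character play the same role
  have hsymm : ∀ a z, character a z = character (-z) a := fun a z => by
    rw [character, character, map_neg]
    ring_nf
  have h : ∀ t : ℝ, ampCharacter (α + t • (Pi.single i v : Amp M)) lam =
      character (-lam i) (α i + t • v) * ∏ l ∈ Finset.univ.erase i, character (α l) (lam l) := by
    intro t
    rw [ampCharacter, ← Finset.mul_prod_erase Finset.univ _ (Finset.mem_univ i), hsymm]
    congr 1
    · simp
    · refine Finset.prod_congr rfl fun l hl => ?_
      simp [Finset.ne_of_mem_erase hl]
  have h1 := HasDerivAt.mul_const (hasLineDerivAt_character (-lam i) (α i) v)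
    (∏ l ∈ Finset.univ.erase i, character (α l) (lam l))
  rw [HasLineDerivAt, funext h]
  refine h1.congr_deriv ?_
  have h2 : ampCharacter α lam = character (-lam i) (α i) *
      ∏ l ∈ Finset.univ.erase i, character (α l) (lam l) := by
    rw [ampCharacter, ← Finset.mul_prod_erase Finset.univ _ (Finset.mem_univ i), hsymm]
  rw [h2, map_neg]
  ring

variable {g : Amp M → ℂ}

lemma IsTest.integrable (hg : IsTest g) : Integrable g :=
  hg.contDiff.continuous.integrable_of_hasCompactSupport hg.hasCompactSupport

lemma integrable_ampCharacter_mul_left {f : Amp M → ℂ} (hf : Integrable f) (lam : Amp M) :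
    Integrable fun α => ampCharacter α lam * f α :=
  hf.bdd_mul (contDiff_ampCharacter lam).continuous.aestronglyMeasurable
    (Eventually.of_forall fun α => (norm_ampCharacter α lam).le)

lemma IsTest.ampFourier_wirtinger (hg : IsTest g) (i : Modes M) (lam : Amp M) :
    ampFourier (FieldWigner.wirtinger i g) lam = -(conj (lam i) * ampFourier g lam) ∧
      ampFourier (FieldWigner.wirtingerConj i g) lam = lam i * ampFourier g lam := by
  have h := integral_wirtinger_mul (contDiff_ampCharacter lam) hg i
  simp only [wirtinger_ampCharacter, mul_assoc] at h
  rw [integral_const_mul, integral_const_mul] at h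
  exact ⟨by rw [ampFourier, ampFourier]; linear_combination h.1,
    by rw [ampFourier, ampFourier]; linear_combination h.2⟩

/-- The operator `1 - ∂²/∂α_i ∂α_i^*` on test functions multiplies the transform by `1 + |λ_i|²`. -/
lemma IsTest.exists_ampFourier_eq (hg : IsTest g) (s : Finset (Modes M)) :
    ∃ f, IsTest f ∧ ∀ lam, ampFourier f lam =
      (∏ i ∈ s, ((1 + ‖lam i‖ ^ 2 : ℝ) : ℂ)) * ampFourier g lam := by
  classical
  induction s using Finset.induction_on with
  | empty => exact ⟨g, hg, fun lam => by simp⟩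
  | insert i s hi ih =>
    obtain ⟨f, hf, hfg⟩ := ih
    have hf2 := ((hf.wirtingerConj i).wirtinger i).const_mul (-1)
    refine ⟨_, hf.add hf2, fun lam => ?_⟩
    have h1 : ampFourier (fun α => f α + -1 *
        FieldWigner.wirtinger i (FieldWigner.wirtingerConj i f) α) lam =
        ampFourier f lam -
          ampFourier (FieldWigner.wirtinger i (FieldWigner.wirtingerConj i f)) lam := by
      simp only [ampFourier]
      rw [← integral_sub (integrable_ampCharacter_mul_left hf.integrable lam)
        (integrable_ampCharacter_mul_left ((hf.wirtingerConj i).wirtinger i).integrable lam)]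
      refine integral_congr_ae (Eventually.of_forall fun α => ?_)
      ring
    rw [h1, ((hf.wirtingerConj i).ampFourier_wirtinger i lam).1, (hf.ampFourier_wirtinger i lam).2,
      Finset.prod_insert hi, hfg]
    have h2 : conj (lam i) * lam i = ((‖lam i‖ ^ 2 : ℝ) : ℂ) := by
      rw [mul_comm, Complex.mul_conj, Complex.normSq_eq_norm_sq]
    push_cast at h2 ⊢
    linear_combination ((∏ i ∈ s, (1 + (‖lam i‖ : ℂ) ^ 2)) * ampFourier g lam) * h2

/-- The transform of a test function is square-integrable: it decays at least like the product of
`(1 + |λ_i|²)⁻¹`. -/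
lemma IsTest.memLp_ampFourier (hg : IsTest g) : MemLp (ampFourier g) 2 volume := by
  obtain ⟨f, hf, hfg⟩ := hg.exists_ampFourier_eq Finset.univ
  have hm : AEStronglyMeasurable (ampFourier g) volume := by
    have : Continuous fun p : Amp M × Amp M => ampCharacter p.2 p.1 * g p.2 :=
      (continuous_ampCharacter.comp continuous_swap).mul
        (hg.contDiff.continuous.comp continuous_snd)
    exact this.stronglyMeasurable.integral_prod_right'.aestronglyMeasurable
  have hpos : ∀ lam : Amp M, 0 < ∏ i, (1 + ‖lam i‖ ^ 2) := fun lam =>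
    Finset.prod_pos fun i _ => by positivity
  have hint : Integrable fun lam : Amp M => ∏ i, (1 + ‖lam i‖ ^ 2) ^ (-(4 : ℝ) / 2) :=
    Integrable.fintype_prod (f := fun (_ : Modes M) (z : ℂ) => (1 + ‖z‖ ^ 2) ^ (-(4 : ℝ) / 2))
      fun _ => integrable_rpow_neg_one_add_norm_sq (by rw [Complex.finrank_real_complex]; norm_num)
  rw [memLp_two_iff_integrable_sq_norm hm]
  refine (hint.const_mul ((∫ α, ‖f α‖) ^ 2)).mono' (hm.norm.pow 2)
    (Eventually.of_forall fun lam => ?_)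
  have h1 : (∏ i, (1 + ‖lam i‖ ^ 2)) * ‖ampFourier g lam‖ ≤ ∫ α, ‖f α‖ := by
    have h2 := congrArg norm (hfg lam)
    rw [norm_mul, ← Complex.ofReal_prod, Complex.norm_real, Real.norm_of_nonneg (hpos lam).le] at h2
    rw [← h2, ampFourier]
    refine (norm_integral_le_integral_norm _).trans (le_of_eq ?_)
    simp only [norm_mul, norm_ampCharacter, one_mul]
  have h3 : ∏ i, (1 + ‖lam i‖ ^ 2) ^ (-(4 : ℝ) / 2) = ((∏ i, (1 + ‖lam i‖ ^ 2)) ^ 2)⁻¹ := by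
    rw [← Finset.prod_pow, ← Finset.prod_inv_distrib]
    refine Finset.prod_congr rfl fun i _ => ?_
    rw [show (-(4 : ℝ) / 2) = -((2 : ℕ) : ℝ) by norm_num, Real.rpow_neg (by positivity),
      Real.rpow_natCast]
  rw [Real.norm_of_nonneg (by positivity), h3, ← div_eq_mul_inv,
    le_div_iff₀ (pow_pos (hpos lam) 2),
    ← mul_pow, mul_comm]
  exact pow_le_pow_left₀ (mul_nonneg (hpos lam).le (norm_nonneg _)) h1 2

/-- Fubini's theorem moves the symplectic Fourier transform to the test function. -/
lemma IsTest.integral_ampCharacter_mul (hg : IsTest g) {f : Amp M → ℂ} (hf : Integrable f) :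
    ∫ α, (∫ lam, ampCharacter α lam * f lam) * g α = ∫ lam, f lam * ampFourier g lam := by
  have hprod : Integrable (Function.uncurry fun α lam => ampCharacter α lam * f lam * g α)
      (volume.prod volume) := by
    have h1 : Integrable (fun p : Amp M × Amp M => g p.1 * f p.2) (volume.prod volume) :=
      hg.integrable.mul_prod hf
    refine (h1.bdd_mul continuous_ampCharacter.aestronglyMeasurable (c := 1)
      (Eventually.of_forall fun p => (norm_ampCharacter p.1 p.2).le)).congr
        (Eventually.of_forall fun p => ?_)
    simp only [Function.uncurry]
    ring
  simp only [← integral_mul_const]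
  rw [integral_integral_swap hprod]
  refine integral_congr_ae (Eventually.of_forall fun lam => ?_)
  simp only [ampFourier]
  rw [← integral_const_mul]
  refine integral_congr_ae (Eventually.of_forall fun α => ?_)
  ring

lemma IsTest.unitPairing_eq (hg : IsTest g) (μ ν : Occ M) : unitPairing g μ ν =
    ((Real.pi : ℂ) ^ (2 * Fintype.card (Modes M)))⁻¹ *
      ∫ lam, modeProd modeDisp ν μ lam * ampFourier g lam := by
  rw [unitPairing, ← hg.integral_ampCharacter_mul (integrable_dispProd ν μ), ← integral_const_mul]
  simp only [← integral_ampCharacter_mul_dispProd, mul_assoc]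

end TestFourier

/-! ### The pointwise identity -/

section Pointwise

variable {d : ℕ} {J : Type*} {M : J → Type*} [Fintype J] [∀ j, Fintype (M j)]
  {R : Set (EuclideanSpace ℝ (Fin d))} {φ : ∀ j, M j → EuclideanSpace ℝ (Fin d) → ℂ}

lemma IsOrthonormalModes.wigner_eq (h : IsOrthonormalModes R φ) (c : Kernel M) (α : Amp M) :
    wigner R φ c α = ((Real.pi : ℂ) ^ (2 * Fintype.card (Modes M)))⁻¹ *
      ∫ lam, ampCharacter α lam * charFunctional R φ c lam := by
  simp only [wigner, h.displacementFunctional_eq, ampCharacter]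

lemma IsOrthonormalModes.continuous_wigner (h : IsOrthonormalModes R φ) {c : Kernel M}
    (hw : HasWignerIntegral R φ c) : Continuous (wigner R φ c) := by
  rw [funext (h.wigner_eq c)]
  refine continuous_const.mul (continuous_of_dominated
    (fun α => (integrable_ampCharacter_mul α hw.2).aestronglyMeasurable)
    (fun α => Eventually.of_forall fun lam => ?_) hw.2.norm
    (Eventually.of_forall fun lam => ?_))
  · rw [norm_mul, norm_ampCharacter, one_mul]
  · exact (contDiff_ampCharacter lam).continuous.mul continuous_const

/-- Where the defining integral converges absolutely, it agrees in the sense of distributions with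
the limit of the transforms of the truncations. -/
lemma IsOrthonormalModes.hasSum_of_hasWignerIntegral (h : IsOrthonormalModes R φ) {c : Kernel M}
    (hc : IsHilbertSchmidtKernel c) (hw : HasWignerIntegral R φ c) {g : Amp M → ℂ}
    (hg : IsTest g) : HasSum (fun p : Occ M × Occ M => c p.1 p.2 * unitPairing g p.1 p.2)
      (∫ α, wigner R φ c α * g α) := by
  have h1 := (h.hasSum_integral_dispProd_mul hc hw.1 hg.memLp_ampFourier).mul_left
    ((Real.pi : ℂ) ^ (2 * Fintype.card (Modes M)))⁻¹
  simp only [h.wigner_eq, mul_assoc]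
  rw [integral_const_mul, hg.integral_ampCharacter_mul hw.2]
  simpa only [hg.unitPairing_eq, mul_left_comm] using! h1

/-- Continuous functions that agree in the sense of distributions are equal. -/
lemma eq_of_forall_integral_mul_eq {u v : Amp M → ℂ} (hu : Continuous u) (hv : Continuous v)
    (huv : ∀ g, IsTest g → ∫ α, u α * g α = ∫ α, v α * g α) : u = v := by
  refine (Continuous.ae_eq_iff_eq volume hu hv).mp (ae_eq_of_integral_contDiff_smul_eq
    hu.locallyIntegrable hv.locallyIntegrable fun g hg1 hg2 => ?_)
  have := huv (fun α => (g α : ℂ)) ⟨Complex.ofRealCLM.contDiff.comp hg1,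
    hg2.comp_left (g := fun x : ℝ => (x : ℂ)) Complex.ofReal_zero⟩
  simpa only [Complex.real_smul, mul_comm] using this

/-- Both sides sum the same series when paired with a test function. -/
theorem IsOrthonormalModes.wigner_kineticCommutator (h : IsOrthonormalModes R φ) (hR : IsOpen R)
    (hsmooth : ∀ j n, ContDiffOn ℝ 2 (φ j n) R)
    (hkin : ∀ j, ∀ n m : M j, IntegrableOn (fun x => conj (φ j n x) * (Δ (φ j m)) x) R) (j : J)
    (hK : ∀ n m, conj (kineticMatrix R φ j n m) = kineticMatrix R φ j m n)
    {c : Kernel M} (hc : IsHilbertSchmidtKernel c) (hw : HasWignerIntegral R φ c)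
    (hc' : IsHilbertSchmidtKernel (kineticCommutator R φ j c))
    (hw' : HasWignerIntegral R φ (kineticCommutator R φ j c))
    (hdiff : ContDiff ℝ 1 (wigner R φ c)) :
    wigner R φ (kineticCommutator R φ j c) = kineticOp R φ j (wigner R φ c) := by
  refine eq_of_forall_integral_mul_eq (h.continuous_wigner hw')
    (continuous_kineticOp hR hsmooth hkin j hK hdiff) fun g hg => ?_
  rw [integral_kineticOp_mul hR hsmooth hkin j hK hdiff hg]
  exact (h.hasSum_of_hasWignerIntegral hc' hw' hg).unique
    (hasSum_kineticCommutator_mul hR hsmooth hkin j hK hdiff.continuous.locallyIntegrable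
      (fun f hf => h.hasSum_of_hasWignerIntegral hc hw hf) hg)

end Pointwise

end FieldWigner

end

theorem mainTheorem6 {d : ℕ} {J : Type*} [Fintype J] {M : J → Type*} [∀ j, Fintype (M j)]
    (R : Set (EuclideanSpace ℝ (Fin d))) (hR : IsOpen R)
    (φ : ∀ j, M j → EuclideanSpace ℝ (Fin d) → ℂ)
    (hsmooth : ∀ j n, ContDiffOn ℝ 2 (φ j n) R)
    (hcont : ∀ j n, ContinuousOn (φ j n) (closure R))
    (hboundary : ∀ j n, ∀ x ∈ frontier R, φ j n x = 0)
    (hinfty : ∀ j n, Tendsto (φ j n) (cocompact (EuclideanSpace ℝ (Fin d)) ⊓ 𝓟 R) (𝓝 0))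
    (horth : ∀ j, ∀ n m : M j, n ≠ m → ∫ x in R, conj (φ j n x) * φ j m x = 0)
    (hnorm : ∀ j, ∀ n : M j, ∫ x in R, conj (φ j n x) * φ j n x = 1)
    (hkin : ∀ j, ∀ n m : M j, IntegrableOn (fun x => conj (φ j n x) * (Δ (φ j m)) x) R)
    (j : J) (A : FieldWigner.Fock M →L[ℂ] FieldWigner.Fock M)
    (hA : FieldWigner.IsHilbertSchmidt A) :
    (∃ w : FieldWigner.Amp M → ℂ,
      FieldWigner.IsWignerL2 R φ (FieldWigner.matrixElement A) w) ∧
    (∀ w : FieldWigner.Amp M → ℂ,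
      FieldWigner.IsWignerL2 R φ (FieldWigner.matrixElement A) w →
      FieldWigner.IsWignerDistribution R φ
        (FieldWigner.kineticCommutator R φ j (FieldWigner.matrixElement A))
        (fun g => ∫ α, w α * FieldWigner.kineticOpTranspose R φ j g α)) ∧
    (FieldWigner.HasWignerIntegral R φ (FieldWigner.matrixElement A) →
      FieldWigner.IsHilbertSchmidtKernel
        (FieldWigner.kineticCommutator R φ j (FieldWigner.matrixElement A)) →
      FieldWigner.HasWignerIntegral R φ
        (FieldWigner.kineticCommutator R φ j (FieldWigner.matrixElement A)) →
      ContDiff ℝ 1 (FieldWigner.wigner R φ (FieldWigner.matrixElement A)) →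
      ∀ α : FieldWigner.Amp M,
        FieldWigner.wigner R φ
            (FieldWigner.kineticCommutator R φ j (FieldWigner.matrixElement A)) α =
          FieldWigner.kineticOp R φ j
            (FieldWigner.wigner R φ (FieldWigner.matrixElement A)) α) := by
  have h := FieldWigner.isOrthonormalModes hR
    (fun j n => (hcont j n).mono subset_closure) horth hnorm
  have hK : ∀ n m, conj (FieldWigner.kineticMatrix R φ j n m) =
      FieldWigner.kineticMatrix R φ j m n := fun n m =>
    FieldWigner.integral_conj_mul_laplacian_symm hR (hsmooth j) (hcont j) (hboundary j) (hinfty j)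
      (hkin j) n m
  exact ⟨h.exists_isWignerL2 hA.kernel,
    fun w hw => h.isWignerDistribution hR hsmooth hkin j hK hw,
    fun hw hc' hw' hdiff α => congrFun
      (h.wigner_kineticCommutator hR hsmooth hkin j hK hA.kernel hw hc' hw' hdiff) α⟩
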